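/- **Model.** Let $n\ge 2$ items have covariates $x_1,\dots,x_n\in\mathbb R^d$ with $d\ge 0$, $d+1<n$, scaled so that $\max_i\|x_i\|_2\le\sqrt{(d+1)/n}$. Put $\tilde x_i=(e_i^\top,x_i^\top)^\top\in\mathbb R^{n+d}$, where $e_i$ is the $i$-th canonical basis vector of $\mathbb R^n$, let $\bar X\in\mathbb R^{n\times(d+1)}$ be the matrix with rows $(1,x_i^\top)$, and let $\Theta=\{b=(\alpha,\beta)\in\mathbb R^n\times\mathbb R^d:\bar X^\top\alpha=0\}$. Let $b^*=(\alpha^*,\beta^*)\in\Theta$. Each pair $i>j$ is an edge of the comparison graph $\mathcal E$ independently with probability $p\in(0,1]$; each edge $i>j$ is compared $L\ge1$ times, with outcomes $y_{j,i}^{(1)},\dots,y_{j,i}^{(L)}\in\{0,1\}$ that are independent (over $l$, over pairs, and of the graph) and satisfy $\mathbb P(y_{j,i}^{(l)}=1)=e^{\tilde x_i^\top b^*}/(e^{\tilde x_i^\top b^*}+e^{\tilde x_j^\top b^*})$. Let $y_{j,i}=L^{-1}\sum_l y_{j,i}^{(l)}$ and $$\mathcal L(b)=\sum_{(i,j)\in\mathcal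 E,\,i>j}\Big\{-y_{j,i}(\tilde x_i^\top b-\tilde x_j^\top b)+\log\big(1+e^{\tilde x_i^\top b-\tilde x_j^\top b}\big)\Big\},$$ $$\overline{\mathcal L}(b)=\mathcal L(b^*)+(b-b^*)^\top\nabla\mathcal L(b^*)+\tfrac12(b-b^*)^\top\nabla^2\mathcal L(b^*)(b-b^*).$$ Let $\hat b_M=(\hat\alpha_M,\hat\beta_M)$ be the minimizer of $\mathcal L$ over $\Theta$, let $\bar b=(\bar\alpha,\bar\beta)$ be the minimizer of $\overline{\mathcal L}$ over $\Theta$, and let $\kappa_1=\max_i e^{\tilde x_i^\top b^*}/\min_i e^{\tilde x_i^\top b^*}$. **Theorem.** Let $c_0,c_1,c_2,c_p,C_D,c_4,c_5,C_B>0$. There are constants $c,C,K>0$ depending only on these such that the following holds for all $n,d,L,p,(x_i),b^*$ as above. Assume 1. (incoherence) $\bar X(\bar X^\top\bar X)^{-1}\bar X^\top$ has all row norms at most $c_0\sqrt{(d+1)/n}$; 2. $\Sigma=\sum_{i>j}(\tilde x_i-\tilde x_j)(\tilde x_i-\tilde x_j)^\top$ satisfies $\|\Sigma\|\le c_1n$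 and $z^\top\Sigma z\ge c_2n\|z\|_2^2$ for all $z\in\Theta$; 3. $np>c_p\log n$, $(d+1)\log n\le C_D\,np$, and $L\le c_4n^{c_5}$; 4. $\kappa_1^2\sqrt{(d+1)\log n/(npL)}\le C_B$ and $\kappa_1^2\big(\sqrt{(d+1)/(np)}+\log n/(np)\big)\le c$. Then, with probability at least $1-Kn^{-5}$, $\hat b_M$ and $\bar b$ exist and are unique, and $$\|\hat b_M-\bar b\|_2\le C\,\kappa_1^4\,\frac{(d+1)^{1/2}\log n}{\sqrt n\,pL},$$ $$\|\hat\alpha_M-\bar\alpha\|_\infty\le C\left[\kappa_1^6\,\frac{(d+1)\log n}{npL}+\frac{\kappa_1^4}{np}\sqrt{\frac{(d+1)\log n}{L}}\left(\sqrt{d+1}+\frac{\log n}{\sqrt{np}}\right)\right].$$ -/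

import Mathlib

open MeasureTheory ProbabilityTheory

noncomputable section

namespace CARE

/-- Unordered pairs of distinct items, written as ordered pairs `(i, j)` with `i > j`. -/
abbrev Pair (n : ℕ) : Type := {q : Fin n × Fin n // q.2 < q.1}

/-- Parameter vectors `b = (α, β) ∈ ℝ^{n+d}` with the Euclidean norm: the coordinates
`Sum.inl i` are `α_i`, the coordinates `Sum.inr k` are `β_k`. -/
abbrev Param (n d : ℕ) : Type := EuclideanSpace ℝ (Fin n ⊕ Fin d)

variable {n d L : ℕ}

/-- The lifted covariate `x̃_i = (e_i, x_i) ∈ ℝ^{n+d}`. -/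
def lift (x : Fin n → EuclideanSpace ℝ (Fin d)) (i : Fin n) : Param n d :=
  WithLp.toLp 2 (Sum.elim (Pi.single i 1) (x i))

/-- The total score `x̃_iᵀ b = α_i + x_iᵀ β` of item `i`. -/
def score (x : Fin n → EuclideanSpace ℝ (Fin d)) (b : Param n d) (i : Fin n) : ℝ :=
  inner ℝ (lift x i) b

/-- The `n × (d+1)` matrix with rows `(1, x_i)`. -/
def designBar (x : Fin n → EuclideanSpace ℝ (Fin d)) : Matrix (Fin n) (Fin (d + 1)) ℝ :=
  Matrix.of fun i => Matrix.vecCons 1 (x i)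

/-- The constrained parameter space `Θ = {(α, β) : X̄ᵀ α = 0}`. -/
def paramSpace (x : Fin n → EuclideanSpace ℝ (Fin d)) : Set (Param n d) :=
  {b | Matrix.mulVec (designBar x).transpose (fun i => b (Sum.inl i)) = 0}

/-- The projection matrix `X̄ (X̄ᵀ X̄)⁻¹ X̄ᵀ`. -/
def projBar (x : Fin n → EuclideanSpace ℝ (Fin d)) : Matrix (Fin n) (Fin n) ℝ :=
  designBar x * ((designBar x).transpose * designBar x)⁻¹ * (designBar x).transpose

/-- The two-to-infinity norm of a matrix: the largest Euclidean norm of a row. -/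
def twoInftyNorm (M : Matrix (Fin n) (Fin n) ℝ) : ℝ :=
  ⨆ i, ‖(WithLp.toLp 2 (M i) : EuclideanSpace ℝ (Fin n))‖

/-- `Σ = ∑_{i > j} (x̃_i - x̃_j)(x̃_i - x̃_j)ᵀ`. -/
def sigmaMat (x : Fin n → EuclideanSpace ℝ (Fin d)) :
    Matrix (Fin n ⊕ Fin d) (Fin n ⊕ Fin d) ℝ :=
  ∑ q : Pair n, Matrix.vecMulVec (WithLp.ofLp (lift x q.1.1 - lift x q.1.2))
    (WithLp.ofLp (lift x q.1.1 - lift x q.1.2))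

/-- The spectral (operator) norm of a square matrix. -/
def opNorm (M : Matrix (Fin n ⊕ Fin d) (Fin n ⊕ Fin d) ℝ) : ℝ :=
  ‖Matrix.toEuclideanCLM (𝕜 := ℝ) M‖

/-- The smallest eigenvalue of a symmetric matrix on a subspace `S`: the largest `μ` with
`zᵀ M z ≥ μ ‖z‖²` for all `z ∈ S`. -/
def lambdaMinOn (S : Set (Param n d)) (M : Matrix (Fin n ⊕ Fin d) (Fin n ⊕ Fin d) ℝ) : ℝ :=
  sSup {μ : ℝ | ∀ z ∈ S, μ * ‖z‖ ^ 2 ≤ WithLp.ofLp z ⬝ᵥ Matrix.mulVec M (WithLp.ofLp z)}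

/-- The condition number `κ₁ = max_i w_i / min_i w_i`, with `w_i = exp(α_i + x_iᵀ β)`. -/
def kappa (x : Fin n → EuclideanSpace ℝ (Fin d)) (b : Param n d) : ℝ :=
  (⨆ i, Real.exp (score x b i)) / (⨅ i, Real.exp (score x b i))

/-- `y_{j,i} = L⁻¹ ∑_l y_{j,i}^{(l)}` for a pair `i > j`, the outcome `true` of a comparison
meaning that the item `i` (the first of the pair) is preferred. -/
def meanOutcome (y : Pair n → Fin L → Bool) (q : Pair n) : ℝ :=
  (∑ l : Fin L, if y q l then (1 : ℝ) else 0) / (L : ℝ)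

/-- The negative log-likelihood (divided by `L`) of the comparison graph with edge
indicators `e` and the outcomes `y`. -/
def loss (x : Fin n → EuclideanSpace ℝ (Fin d)) (e : Pair n → Bool)
    (y : Pair n → Fin L → Bool) (b : Param n d) : ℝ :=
  ∑ q : Pair n, if e q then
      -(meanOutcome y q) * (score x b q.1.1 - score x b q.1.2)
        + Real.log (1 + Real.exp (score x b q.1.1 - score x b q.1.2))
    else 0

/-- The second-order Taylor polynomial of `f` at `a`. -/
def quadExpansion (f : Param n d → ℝ) (a b : Param n d) : ℝ :=
  f a + fderiv ℝ f a (b - a) + (1 / 2) * fderiv ℝ (fderiv ℝ f) a (b - a) (b - a)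

/-- `b` is a minimizer of `f` over `S`. -/
def IsArgmin (f : Param n d → ℝ) (S : Set (Param n d)) (b : Param n d) : Prop :=
  b ∈ S ∧ IsMinOn f S b

/-- The CARE sampling model. Every pair `i > j` is an edge with probability `p`; every
comparison of `i > j` is won by `i` with probability `e^{s_i} / (e^{s_i} + e^{s_j})`, where
`s_i = α*_i + x_iᵀ β*`; all these variables are independent. The outcomes attached to a pair
that is not an edge are never observed (`loss` ignores them). -/
structure IsSample {Ω : Type*} [MeasurableSpace Ω] (P : Measure Ω)
    (x : Fin n → EuclideanSpace ℝ (Fin d)) (bstar : Param n d) (p : ℝ)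
    (E : Pair n → Ω → Bool) (Y : Pair n → Fin L → Ω → Bool) : Prop where
  measurable_edge : ∀ q, Measurable (E q)
  measurable_outcome : ∀ q l, Measurable (Y q l)
  prob_edge : ∀ q, P.real {ω | E q ω = true} = p
  prob_outcome : ∀ q l, P.real {ω | Y q l ω = true} =
    Real.exp (score x bstar q.1.1) /
      (Real.exp (score x bstar q.1.1) + Real.exp (score x bstar q.1.2))
  indep : iIndepFun (Sum.elim E (fun r : Pair n × Fin L => Y r.1 r.2)) P

end CARE

end

/-!
The loss depends on a parameter `b` only through the scores `s i = α i + xᵢᵀ β`, and only through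
their differences. Since the smallest eigenvalue of `Σ` on `Θ` is positive, `Θ` is isomorphic to the
space of score vectors modulo constants (`exists_score_eq`, `eq_of_score_sub_eq`); the incoherence
of the projection and the eigenvalue bound turn estimates for score vectors into estimates for
parameters (`abs_inl_le_of_score_eq`, `norm_le_of_score_eq`). What has to be proved is therefore an
estimate for the Bradley–Terry model without covariates, and the factors of the dimension in the
bounds are only needed to absorb the change of coordinates.

Write `δ` and `δb` for the centred deviations of the scores of the two minimizers from the true
scores `s`. The two first-order conditions are flow equations on the comparison graph `a`,
`∑ j, a i j * φ i j (δ i - δ j) = ∑ j, a i j * z i j`, with the same noise `z` on the right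
(`isArgmin_of_flow`). For the quadratic expansion `φ i j t = w i j * t`, with the Hessian weights
`w i j ∈ [1 / (4 κ), 1 / 4]`; for the loss, `φ i j` is the increment of the logistic function,
truncated so that its slopes stay comparable to `w i j` everywhere. Both equations are solvable by
strong monotonicity (`exists_isSol`), and the truncation is invisible once `‖δ‖` is small. The
spectral gap of the graph, from a Cheeger inequality (`spectral_gap_of_cuts`), gives the Euclidean
stability of these equations, with constant of order `κ / (n p)`.

The sup-norm bounds come from a leave-one-out argument. Replacing the row of `m` in the graph by its
mean, and deleting the noise of that row, gives solutions that do not depend on the edges at `m`, and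
that are close to the original solutions in the Euclidean norm (`Regular.l2_sub_looSol_le`). The
equation at the vertex `m` then expresses `δ m` through a sum, over the neighbours of `m`, of
coefficients independent of these neighbours, to which Bernstein's inequality applies
(`bernstein_frozen`). This bounds `‖δ‖` (`Regular.norm_sol_le`); the same argument for `δ - δb`, whose
flow equation has a source of second order in `δ`, gives the two error bounds
(`Regular.newton_error`). The probabilistic input is collected in `GoodConfig`, whose complement has
probability at most `22 / n ^ 5` (`IsSample.prob_goodConfig`); everything else is deterministic.
-/

noncomputable section

namespace CARE

/-! ### Euclidean and sup norms of plain functions -/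

section Euclid

variable {V : Type*} [Fintype V]

/-- The Euclidean norm of a vector given as a plain function; the norm `‖f‖` of such a function
is its sup norm. -/
def l2 (f : V → ℝ) : ℝ := ‖(WithLp.toLp 2 f : EuclideanSpace ℝ V)‖

lemma l2_nonneg (f : V → ℝ) : 0 ≤ l2 f := norm_nonneg _

lemma l2_sq (f : V → ℝ) : l2 f ^ 2 = ∑ i, f i ^ 2 := by
  simp [l2, EuclideanSpace.norm_sq_eq]

lemma l2_add_le (f g : V → ℝ) : l2 (f + g) ≤ l2 f + l2 g := by
  simpa [l2] using norm_add_le (WithLp.toLp 2 f : EuclideanSpace ℝ V) (WithLp.toLp 2 g)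

lemma l2_neg (f : V → ℝ) : l2 (-f) = l2 f := by
  simp [l2]

lemma l2_sub_le (f g : V → ℝ) : l2 (f - g) ≤ l2 f + l2 g := by
  simpa [l2] using norm_sub_le (WithLp.toLp 2 f : EuclideanSpace ℝ V) (WithLp.toLp 2 g)

lemma l2_le_of_sum_sq_le {f : V → ℝ} {c : ℝ} (hc : 0 ≤ c) (h : ∑ i, f i ^ 2 ≤ c ^ 2) :
    l2 f ≤ c :=
  le_of_sq_le_sq (by rwa [l2_sq]) hc

lemma l2_mono {f g : V → ℝ} (h : ∀ i, |f i| ≤ |g i|) : l2 f ≤ l2 g := by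
  refine l2_le_of_sum_sq_le (l2_nonneg _) ?_
  rw [l2_sq]
  exact Finset.sum_le_sum fun i _ => sq_le_sq.mpr (h i)

lemma l2_const_mul (c : ℝ) (f : V → ℝ) : l2 (fun i => c * f i) = |c| * l2 f := by
  have := norm_smul c (WithLp.toLp 2 f : EuclideanSpace ℝ V)
  rw [Real.norm_eq_abs] at this
  rw [l2, l2, ← this]
  rfl

lemma l2_abs (f : V → ℝ) : l2 (fun i => |f i|) = l2 f :=
  le_antisymm (l2_mono fun i => by simp) (l2_mono fun i => by simp)

lemma sum_mul_le_l2 (f g : V → ℝ) : ∑ i, f i * g i ≤ l2 f * l2 g := by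
  have := real_inner_le_norm (WithLp.toLp 2 g : EuclideanSpace ℝ V) (WithLp.toLp 2 f)
  simp only [PiLp.inner_apply, RCLike.inner_apply, conj_trivial] at this
  rw [mul_comm (l2 f)]
  exact this

lemma sum_abs_mul_abs_le_l2 (f g : V → ℝ) : ∑ i, |f i| * |g i| ≤ l2 f * l2 g := by
  rw [← l2_abs f, ← l2_abs g]
  exact sum_mul_le_l2 _ _

lemma abs_apply_le_norm (f : V → ℝ) (i : V) : |f i| ≤ ‖f‖ := norm_le_pi_norm f i

lemma norm_le_l2 (f : V → ℝ) : ‖f‖ ≤ l2 f := by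
  refine (pi_norm_le_iff_of_nonneg (l2_nonneg f)).mpr fun i => ?_
  rw [Real.norm_eq_abs]
  refine abs_le_of_sq_le_sq ?_ (l2_nonneg f)
  rw [l2_sq]
  exact Finset.single_le_sum (f := fun i => f i ^ 2) (fun i _ => sq_nonneg _) (Finset.mem_univ i)

lemma l2_le_sqrt_card_mul {f : V → ℝ} {c : ℝ} (h : ∀ i, |f i| ≤ c) (hc : 0 ≤ c) :
    l2 f ≤ √(Fintype.card V) * c := by
  refine l2_le_of_sum_sq_le (by positivity) ?_
  rw [mul_pow, Real.sq_sqrt (by positivity)]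
  calc ∑ i, f i ^ 2 ≤ ∑ _i : V, c ^ 2 :=
        Finset.sum_le_sum fun i _ => sq_le_sq' (by linarith [abs_le.mp (h i)]) (abs_le.mp (h i)).2
    _ = _ := by simp

end Euclid

/-! ### The spectral gap of a weighted graph from its cuts -/

section Cheeger

variable {V : Type*} [Fintype V] [DecidableEq V]

/-- Discrete co-area inequality, by peeling off the lowest level of `f` on its support. -/
lemma coarea (a : V → V → ℝ) (h : ℝ) (k : ℕ) :
    ∀ f : V → ℝ, (∀ i, 0 ≤ f i) → (Finset.univ.filter fun i => 0 < f i).card ≤ k →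
      (∀ S : Finset V, (∀ i ∈ S, 0 < f i) → h * S.card ≤ ∑ i ∈ S, ∑ j ∈ Sᶜ, a i j) →
      h * ∑ i, f i ≤ ∑ i, ∑ j, a i j * max (f i - f j) 0 := by
  induction k with
  | zero =>
    intro f hf hk _
    have h0 : ∀ i, f i = 0 := fun i => by
      by_contra hne
      have : i ∈ Finset.univ.filter fun i => 0 < f i := by
        simpa using lt_of_le_of_ne (hf i) (Ne.symm hne)
      rw [Finset.card_eq_zero.mp (Nat.le_zero.mp hk)] at this
      simp at this
    simp [h0]
  | succ k ih =>
    intro f hf hk hcut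
    set S := Finset.univ.filter fun i => 0 < f i with hS
    have memS : ∀ i, i ∈ S ↔ 0 < f i := fun i => by simp [hS]
    rcases S.eq_empty_or_nonempty with he | hne
    · have h0 : ∀ i, f i = 0 := fun i => by
        have : i ∉ S := by simp [he]
        rw [memS] at this
        exact le_antisymm (not_lt.mp this) (hf i)
      simp [h0]
    obtain ⟨m, hmS, hm⟩ := S.exists_min_image f hne
    have hτ : 0 < f m := (memS m).mp hmS
    set g : V → ℝ := fun i => if i ∈ S then f i - f m else 0 with hg
    have hg0 : ∀ i, 0 ≤ g i := fun i => by
      simp only [hg]; split_ifs with hi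
      · linarith [hm i hi]
      · exact le_rfl
    have hgS : ∀ i, 0 < g i → i ∈ S := fun i hi => by
      by_contra hc
      simp [hg, hc] at hi
    have hgk : (Finset.univ.filter fun i => 0 < g i).card ≤ k := by
      have : (Finset.univ.filter fun i => 0 < g i) ⊂ S := by
        refine ⟨fun i hi => hgS i (by simpa using hi), fun hsub => ?_⟩
        have := hsub hmS
        simp [hg, hmS] at this
      have := Finset.card_lt_card this
      omega
    have key := ih g hg0 hgk fun T hT => hcut T fun i hi => (memS i).mp (hgS i (hT i hi))
    have h1 := hcut S fun i hi => (memS i).mp hi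
    have hsum : ∑ i, f i = f m * S.card + ∑ i, g i := by
      have : ∀ i, f i = (if i ∈ S then f m else 0) + g i := fun i => by
        simp only [hg]; split_ifs with hi
        · ring
        · rw [memS] at hi
          linarith [hf i, not_lt.mp hi]
      rw [Finset.sum_congr rfl fun i _ => this i, Finset.sum_add_distrib,
        ← Finset.sum_filter]
      simp [mul_comm]
    have hdiff : ∑ i, ∑ j, a i j * max (f i - f j) 0
        = f m * ∑ i ∈ S, ∑ j ∈ Sᶜ, a i j + ∑ i, ∑ j, a i j * max (g i - g j) 0 := by
      have h2 : ∑ i ∈ S, ∑ j ∈ Sᶜ, a i j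
          = ∑ i, ∑ j, if i ∈ S ∧ j ∉ S then a i j else 0 := by
        rw [← Finset.sum_filter_add_sum_filter_not Finset.univ (fun i => i ∈ S)]
        have e1 : ∑ i ∈ Finset.univ.filter (fun i => i ∉ S),
            ∑ j, (if i ∈ S ∧ j ∉ S then a i j else 0) = 0 :=
          Finset.sum_eq_zero fun i hi => Finset.sum_eq_zero fun j _ => by
            have : i ∉ S := by simpa using hi
            simp [this]
        rw [e1, add_zero]
        have e2 : Finset.univ.filter (fun i => i ∈ S) = S := by ext; simp
        rw [e2]
        refine Finset.sum_congr rfl fun i hi => ?_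
        simp only [hi, true_and]
        rw [← Finset.sum_filter]
        refine Finset.sum_congr ?_ fun _ _ => rfl
        ext; simp
      rw [h2, Finset.mul_sum, ← Finset.sum_add_distrib]
      refine Finset.sum_congr rfl fun i _ => ?_
      rw [Finset.mul_sum, ← Finset.sum_add_distrib]
      refine Finset.sum_congr rfl fun j _ => ?_
      have hz : ∀ i, i ∉ S → f i = 0 := fun i hi => by
        rw [memS] at hi
        linarith [hf i, not_lt.mp hi]
      by_cases hi : i ∈ S <;> by_cases hj : j ∈ S
      · simp [hg, hi, hj]
      · have e : g i - g j = f i - f m := by simp [hg, hi, hj]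
        rw [e, hz j hj, max_eq_left (by linarith [hf i]), max_eq_left (by linarith [hm i hi])]
        simp only [hi, hj, not_false_iff, and_self, if_true]
        ring
      · have e : g i - g j = -(f j - f m) := by simp [hg, hi, hj]
        rw [e, hz i hi, max_eq_right (by linarith [hf j]), max_eq_right (by linarith [hm j hj])]
        simp [hi]
      · have e : g i - g j = 0 := by simp [hg, hi, hj]
        rw [e, hz i hi, hz j hj]
        simp [hi]
    rw [hsum, hdiff]
    nlinarith [mul_le_mul_of_nonneg_left h1 hτ.le]

/-- Cheeger's inequality for a nonnegative function, with the cuts restricted to subsets of its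
support: the co-area inequality for `x²`, followed by the inequality of arithmetic and geometric
means applied to `|x i² - x j²| = |x i - x j| (x i + x j)`. -/
lemma cheeger_of_nonneg {a : V → V → ℝ} {h D : ℝ} (ha : ∀ i j, 0 ≤ a i j)
    (hsymm : ∀ i j, a i j = a j i) (hh : 0 < h) (hdeg : ∀ i, ∑ j, a i j ≤ D) (hD : 0 < D)
    (x : V → ℝ) (hx : ∀ i, 0 ≤ x i)
    (hcut : ∀ S : Finset V, (∀ i ∈ S, 0 < x i) → h * S.card ≤ ∑ i ∈ S, ∑ j ∈ Sᶜ, a i j) :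
    h ^ 2 * ∑ i, x i ^ 2 ≤ 4 * D * ∑ i, ∑ j, a i j * (x i - x j) ^ 2 := by
  have h1 := coarea a h _ (fun i => x i ^ 2) (fun i => sq_nonneg _) le_rfl
    (fun S hS => hcut S fun i hi => lt_of_le_of_ne (hx i) fun h0 => by
      have := hS i hi; rw [← h0] at this; simp at this)
  set Q := ∑ i, ∑ j, a i j * (x i - x j) ^ 2 with hQ
  set X := ∑ i, x i ^ 2 with hX
  have hterm : ∀ i j, a i j * max (x i ^ 2 - x j ^ 2) 0
      ≤ 2 * D / h * (a i j * (x i - x j) ^ 2)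
        + h / (4 * D) * (a i j * x i ^ 2 + a j i * x j ^ 2) := by
    intro i j
    rw [hsymm j i]
    have e : 2 * D / h * (a i j * (x i - x j) ^ 2)
        + h / (4 * D) * (a i j * x i ^ 2 + a i j * x j ^ 2)
        = a i j * (2 * D / h * (x i - x j) ^ 2 + h / (4 * D) * (x i ^ 2 + x j ^ 2)) := by ring
    rw [e]
    refine mul_le_mul_of_nonneg_left (max_le ?_ (by positivity)) (ha i j)
    have hk : (x i - x j) * (x i + x j)
        ≤ 2 * D / h * (x i - x j) ^ 2 + h / (8 * D) * (x i + x j) ^ 2 := by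
      have : 2 * D / h * (x i - x j) ^ 2 + h / (8 * D) * (x i + x j) ^ 2
          - (x i - x j) * (x i + x j)
          = (4 * D * (x i - x j) - h * (x i + x j)) ^ 2 / (8 * D * h) := by
        field_simp; ring
      have h0 : 0 ≤ (4 * D * (x i - x j) - h * (x i + x j)) ^ 2 / (8 * D * h) := by positivity
      linarith
    have h3 : h / (8 * D) * (x i + x j) ^ 2 ≤ h / (4 * D) * (x i ^ 2 + x j ^ 2) := by
      have : h / (4 * D) * (x i ^ 2 + x j ^ 2) - h / (8 * D) * (x i + x j) ^ 2
          = h / (8 * D) * (x i - x j) ^ 2 := by field_simp; ring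
      have h0 : 0 ≤ h / (8 * D) * (x i - x j) ^ 2 := by positivity
      linarith
    linarith [hk, h3, sq_sub_sq (x i) (x j), mul_comm (x i + x j) (x i - x j)]
  have hdegX : ∑ i, ∑ j, a i j * x i ^ 2 ≤ D * X := by
    rw [hX, Finset.mul_sum]
    refine Finset.sum_le_sum fun i _ => ?_
    rw [← Finset.sum_mul]
    exact mul_le_mul_of_nonneg_right (hdeg i) (sq_nonneg _)
  have h2 : ∑ i, ∑ j, a i j * max (x i ^ 2 - x j ^ 2) 0
      ≤ 2 * D / h * Q + h / (4 * D) * (D * X + D * X) := by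
    calc _ ≤ ∑ i, ∑ j, (2 * D / h * (a i j * (x i - x j) ^ 2)
        + h / (4 * D) * (a i j * x i ^ 2 + a j i * x j ^ 2)) :=
          Finset.sum_le_sum fun i _ => Finset.sum_le_sum fun j _ => hterm i j
      _ = 2 * D / h * Q + h / (4 * D) * (∑ i, ∑ j, a i j * x i ^ 2
          + ∑ i, ∑ j, a j i * x j ^ 2) := by
          simp only [Finset.sum_add_distrib, ← Finset.mul_sum, hQ]
      _ ≤ _ := by
          rw [Finset.sum_comm (f := fun i j => a j i * x j ^ 2)]
          gcongr
  have h3 : h / (4 * D) * (D * X + D * X) = h * X / 2 := by field_simp; ring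
  have h4 : h * X / 2 ≤ 2 * D / h * Q := by linarith
  have h5 := mul_le_mul_of_nonneg_left h4 (by positivity : 0 ≤ 2 * h)
  have h6 : 2 * h * (2 * D / h * Q) = 4 * D * Q := by field_simp; ring
  nlinarith

lemma exists_median [Nonempty V] (z : V → ℝ) :
    ∃ c, 2 * (Finset.univ.filter fun i => c < z i).card ≤ Fintype.card V ∧
      2 * (Finset.univ.filter fun i => z i < c).card ≤ Fintype.card V := by
  set G := Finset.univ.filter fun k : V =>
    2 * (Finset.univ.filter fun i => z k < z i).card ≤ Fintype.card V with hG
  have hne : G.Nonempty := by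
    obtain ⟨k, _, hk⟩ := Finset.univ.exists_max_image z Finset.univ_nonempty
    refine ⟨k, ?_⟩
    have : (Finset.univ.filter fun i => z k < z i) = ∅ := by
      ext i; simpa using hk i (Finset.mem_univ i)
    simp [hG, this]
  obtain ⟨k, hkG, hk⟩ := G.exists_min_image z hne
  refine ⟨z k, by simpa [hG] using hkG, ?_⟩
  by_contra! hlt
  set B := Finset.univ.filter fun i => z i < z k with hB
  have hBne : B.Nonempty := by
    rw [← Finset.card_pos]
    have := Fintype.card_pos (α := V)
    omega
  obtain ⟨r, hrB, hr⟩ := B.exists_max_image z hBne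
  have hrk : z r < z k := by simpa [hB] using hrB
  have : r ∈ G := by
    have hsub : (Finset.univ.filter fun i => z r < z i) ⊆ Bᶜ := by
      intro i hi
      simp only [Finset.mem_compl]
      intro hiB
      have h1 := hr i hiB
      have h2 : z r < z i := by simpa using hi
      linarith
    have := Finset.card_le_card hsub
    rw [Finset.card_compl] at this
    simp only [hG, Finset.mem_filter, Finset.mem_univ, true_and]
    omega
  linarith [hk r this]

/-- Cheeger's inequality: if every set of at most half of the vertices has a boundary of weight
at least `h` per vertex, and the degrees are at most `D`, then the Laplacian quadratic form is
at least `h² / (8 D)` on centred vectors (the double sum counts every edge twice). -/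
lemma spectral_gap_of_cuts {a : V → V → ℝ} {h D : ℝ} (ha : ∀ i j, 0 ≤ a i j)
    (hsymm : ∀ i j, a i j = a j i) (hh : 0 < h) (hdeg : ∀ i, ∑ j, a i j ≤ D) (hD : 0 < D)
    (hcut : ∀ S : Finset V, 2 * S.card ≤ Fintype.card V →
      h * S.card ≤ ∑ i ∈ S, ∑ j ∈ Sᶜ, a i j)
    (z : V → ℝ) (hz : ∑ i, z i = 0) :
    h ^ 2 * ∑ i, z i ^ 2 ≤ 4 * D * ∑ i, ∑ j, a i j * (z i - z j) ^ 2 := by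
  cases isEmpty_or_nonempty V
  · simp
  obtain ⟨c, hc1, hc2⟩ := exists_median z
  have hp := cheeger_of_nonneg ha hsymm hh hdeg hD (fun i => max (z i - c) 0)
    (fun i => le_max_right _ _) (fun S hS => hcut S (le_trans (Nat.mul_le_mul_left 2
      (Finset.card_le_card fun i hi => by
        have := hS i hi
        simp only [lt_max_iff, lt_irrefl, or_false, sub_pos] at this
        simpa using this)) hc1))
  have hm := cheeger_of_nonneg ha hsymm hh hdeg hD (fun i => max (c - z i) 0)
    (fun i => le_max_right _ _) (fun S hS => hcut S (le_trans (Nat.mul_le_mul_left 2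
      (Finset.card_le_card fun i hi => by
        have := hS i hi
        simp only [lt_max_iff, lt_irrefl, or_false, sub_pos] at this
        simpa using this)) hc2))
  have h1 : ∑ i, z i ^ 2 ≤ ∑ i, max (z i - c) 0 ^ 2 + ∑ i, max (c - z i) 0 ^ 2 := by
    have e : ∀ i, max (z i - c) 0 ^ 2 + max (c - z i) 0 ^ 2 = z i ^ 2 - 2 * c * z i + c ^ 2 := by
      intro i
      rcases le_total (z i) c with hle | hle
      · rw [max_eq_right (by linarith), max_eq_left (by linarith)]; ring
      · rw [max_eq_left (by linarith), max_eq_right (by linarith)]; ring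
    rw [← Finset.sum_add_distrib, Finset.sum_congr rfl fun i _ => e i, Finset.sum_add_distrib,
      Finset.sum_sub_distrib, ← Finset.mul_sum, hz]
    have : 0 ≤ ∑ _i : V, c ^ 2 := Finset.sum_nonneg fun _ _ => sq_nonneg _
    linarith
  have h2 : ∑ i, ∑ j, a i j * (max (z i - c) 0 - max (z j - c) 0) ^ 2
      + ∑ i, ∑ j, a i j * (max (c - z i) 0 - max (c - z j) 0) ^ 2
      ≤ ∑ i, ∑ j, a i j * (z i - z j) ^ 2 := by
    rw [← Finset.sum_add_distrib]
    refine Finset.sum_le_sum fun i _ => ?_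
    rw [← Finset.sum_add_distrib]
    refine Finset.sum_le_sum fun j _ => ?_
    rw [← mul_add]
    refine mul_le_mul_of_nonneg_left ?_ (ha i j)
    rcases le_total (z i) c with hi | hi <;> rcases le_total (z j) c with hj | hj
    · rw [max_eq_right (by linarith), max_eq_left (by linarith : 0 ≤ c - z i),
        max_eq_right (by linarith), max_eq_left (by linarith)]
      nlinarith
    · rw [max_eq_right (by linarith), max_eq_left (by linarith : 0 ≤ c - z i),
        max_eq_left (by linarith : 0 ≤ z j - c), max_eq_right (by linarith)]
      nlinarith [mul_nonneg (sub_nonneg.2 hi) (sub_nonneg.2 hj)]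
    · rw [max_eq_left (by linarith : 0 ≤ z i - c), max_eq_right (by linarith : c - z i ≤ 0),
        max_eq_right (by linarith), max_eq_left (by linarith)]
      nlinarith [mul_nonneg (sub_nonneg.2 hi) (sub_nonneg.2 hj)]
    · rw [max_eq_left (by linarith : 0 ≤ z i - c), max_eq_right (by linarith : c - z i ≤ 0),
        max_eq_left (by linarith), max_eq_right (by linarith)]
      nlinarith
  have h3 := mul_le_mul_of_nonneg_left h1 (sq_nonneg h)
  have h4 := mul_le_mul_of_nonneg_left h2 (by positivity : 0 ≤ 4 * D)
  linarith

end Cheeger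

/-! ### Monotone flow equations on a weighted graph -/

section Flow

variable {V : Type*}

/-- A family of odd response functions `φ i j` on the ordered pairs, whose slopes stay within a
factor `3` of the weights `w i j`. -/
structure IsLink (w : V → V → ℝ) (φ : V → V → ℝ → ℝ) : Prop where
  zero : ∀ i j, φ i j 0 = 0
  antisymm : ∀ i j t, φ j i (-t) = -φ i j t
  lower : ∀ i j s t, s ≤ t → w i j / 3 * (t - s) ≤ φ i j t - φ i j s
  upper : ∀ i j s t, s ≤ t → φ i j t - φ i j s ≤ 3 * w i j * (t - s)

variable {w a : V → V → ℝ} {φ : V → V → ℝ → ℝ}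

lemma IsLink.mul_self_le (hφ : IsLink w φ) (i j : V) (s t : ℝ) :
    w i j / 3 * (t - s) ^ 2 ≤ (φ i j t - φ i j s) * (t - s) := by
  rcases le_total s t with h | h
  · have := mul_le_mul_of_nonneg_right (hφ.lower i j s t h) (sub_nonneg.2 h)
    nlinarith
  · have := mul_le_mul_of_nonneg_right (hφ.lower i j t s h) (sub_nonneg.2 h)
    nlinarith

lemma IsLink.abs_sub_le (hφ : IsLink w φ) (hw : ∀ i j, 0 ≤ w i j) (i j : V) (s t : ℝ) :
    |φ i j t - φ i j s| ≤ 3 * w i j * |t - s| := by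
  have h3 := hw i j
  rcases le_total s t with h | h
  · have h1 := hφ.lower i j s t h
    have h2 := hφ.upper i j s t h
    rw [abs_of_nonneg (sub_nonneg.2 h), abs_of_nonneg]
    · exact h2
    · exact le_trans (mul_nonneg (by positivity) (sub_nonneg.2 h)) h1
  · have h1 := hφ.lower i j t s h
    have h2 := hφ.upper i j t s h
    rw [abs_sub_comm, abs_sub_comm t, abs_of_nonneg (sub_nonneg.2 h), abs_of_nonneg]
    · exact h2
    · exact le_trans (mul_nonneg (by positivity) (sub_nonneg.2 h)) h1

lemma IsLink.abs_le (hφ : IsLink w φ) (hw : ∀ i j, 0 ≤ w i j) (i j : V) (t : ℝ) :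
    |φ i j t| ≤ 3 * w i j * |t| := by
  simpa [hφ.zero] using hφ.abs_sub_le hw i j 0 t

/-- The linear link with slopes `w`. -/
def linearLink (w : V → V → ℝ) (i j : V) (t : ℝ) : ℝ := w i j * t

lemma isLink_linearLink (hw : ∀ i j, 0 ≤ w i j) (hs : ∀ i j, w i j = w j i) :
    IsLink w (linearLink w) where
  zero i j := by simp [linearLink]
  antisymm i j t := by simp [linearLink, hs j i]
  lower i j s t h := by
    have := mul_nonneg (hw i j) (sub_nonneg.2 h)
    simp only [linearLink]; nlinarith
  upper i j s t h := by
    have := mul_nonneg (hw i j) (sub_nonneg.2 h)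
    simp only [linearLink]; nlinarith

lemma flow_antisymm (hφ : IsLink w φ) (hsymm : ∀ i j, a i j = a j i) (δ : V → ℝ) (i j : V) :
    a j i * φ j i (δ j - δ i) = -(a i j * φ i j (δ i - δ j)) := by
  rw [hsymm j i, ← neg_sub (δ i) (δ j), hφ.antisymm]; ring

variable [Fintype V]

/-- The net flow out of `i` when the vertices carry the potentials `δ`. -/
def flow (a : V → V → ℝ) (φ : V → V → ℝ → ℝ) (δ : V → ℝ) (i : V) : ℝ :=
  ∑ j, a i j * φ i j (δ i - δ j)

/-- `δ` is a centred potential whose net flows are the sources `ξ`. -/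
def IsSol (a : V → V → ℝ) (φ : V → V → ℝ → ℝ) (ξ δ : V → ℝ) : Prop :=
  ∑ i, δ i = 0 ∧ ∀ i, flow a φ δ i = ξ i

open Classical in
/-- A solution of the flow equation, `0` if there is none. -/
def sol (a : V → V → ℝ) (φ : V → V → ℝ → ℝ) (ξ : V → ℝ) : V → ℝ :=
  if h : ∃ δ, IsSol a φ ξ δ then h.choose else 0

lemma sol_spec {a : V → V → ℝ} {φ : V → V → ℝ → ℝ} {ξ : V → ℝ} (h : ∃ δ, IsSol a φ ξ δ) :
    IsSol a φ ξ (sol a φ ξ) := by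
  rw [sol, dif_pos h]
  exact h.choose_spec

/-- A weighted graph whose Laplacian quadratic form is at least `(μ / 2) ‖z‖²` on centred
vectors. -/
structure IsGapGraph (a : V → V → ℝ) (μ : ℝ) : Prop where
  nonneg : ∀ i j, 0 ≤ a i j
  symm : ∀ i j, a i j = a j i
  gap : ∀ z : V → ℝ, ∑ i, z i = 0 → μ * ∑ i, z i ^ 2 ≤ ∑ i, ∑ j, a i j * (z i - z j) ^ 2

/-- Summation by parts for an antisymmetric array. -/
lemma sum_mul_sum_antisymm {f : V → V → ℝ} (hf : ∀ i j, f j i = -f i j) (z : V → ℝ) :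
    ∑ i, z i * ∑ j, f i j = (1 / 2) * ∑ i, ∑ j, f i j * (z i - z j) := by
  have h1 : ∑ i, ∑ j, f i j * z i = ∑ i, z i * ∑ j, f i j :=
    Finset.sum_congr rfl fun i _ => by rw [Finset.mul_sum]; exact Finset.sum_congr rfl fun j _ => mul_comm _ _
  have h2 : ∑ i, ∑ j, f i j * z j = -∑ i, z i * ∑ j, f i j := by
    rw [Finset.sum_comm, ← h1, ← Finset.sum_neg_distrib]
    refine Finset.sum_congr rfl fun i _ => ?_
    rw [← Finset.sum_neg_distrib]
    exact Finset.sum_congr rfl fun j _ => by rw [hf]; ring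
  simp only [mul_sub, Finset.sum_sub_distrib, h1, h2]
  ring

lemma sum_flow (hφ : IsLink w φ) (hsymm : ∀ i j, a i j = a j i) (δ : V → ℝ) :
    ∑ i, flow a φ δ i = 0 := by
  simpa [flow] using sum_mul_sum_antisymm (flow_antisymm hφ hsymm δ) (fun _ => 1)

/-- Strong monotonicity of the flow in the energy of the graph. -/
lemma energy_le (hφ : IsLink w φ) {ω : ℝ} (hω : ∀ i j, ω ≤ w i j)
    (ha : ∀ i j, 0 ≤ a i j) (hsymm : ∀ i j, a i j = a j i) (δ δ' : V → ℝ) :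
    ω / 6 * ∑ i, ∑ j, a i j * ((δ - δ') i - (δ - δ') j) ^ 2
      ≤ ∑ i, (δ - δ') i * (flow a φ δ i - flow a φ δ' i) := by
  have h := sum_mul_sum_antisymm
    (f := fun i j => a i j * φ i j (δ i - δ j) - a i j * φ i j (δ' i - δ' j))
    (fun i j => by rw [flow_antisymm hφ hsymm δ i j, flow_antisymm hφ hsymm δ' i j]; ring) (δ - δ')
  simp only [Finset.sum_sub_distrib] at h
  change ∑ i, (δ - δ') i * (flow a φ δ i - flow a φ δ' i) = _ at h
  rw [h]
  have h1 : ω / 3 * ∑ i, ∑ j, a i j * ((δ - δ') i - (δ - δ') j) ^ 2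
      ≤ ∑ i, ∑ j, (a i j * φ i j (δ i - δ j) - a i j * φ i j (δ' i - δ' j))
        * ((δ - δ') i - (δ - δ') j) := by
    rw [Finset.mul_sum]
    refine Finset.sum_le_sum fun i _ => ?_
    rw [Finset.mul_sum]
    refine Finset.sum_le_sum fun j _ => ?_
    have h2 := hφ.mul_self_le i j (δ' i - δ' j) (δ i - δ j)
    have e : (δ - δ') i - (δ - δ') j = (δ i - δ j) - (δ' i - δ' j) := by
      simp only [Pi.sub_apply]; ring
    rw [e]
    have h3 : ω / 3 * ((δ i - δ j) - (δ' i - δ' j)) ^ 2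
        ≤ w i j / 3 * ((δ i - δ j) - (δ' i - δ' j)) ^ 2 :=
      mul_le_mul_of_nonneg_right (by linarith [hω i j]) (sq_nonneg _)
    have h4 := mul_le_mul_of_nonneg_left (h3.trans h2) (ha i j)
    calc _ = a i j * (ω / 3 * ((δ i - δ j) - (δ' i - δ' j)) ^ 2) := by ring
      _ ≤ _ := h4
      _ = _ := by ring
  linarith

/-- Stability: two centred potentials differ by at most a multiple of the difference of their
flows. -/
lemma l2_sub_le_of_flow (hφ : IsLink w φ) {ω μ : ℝ} (hω0 : 0 < ω) (hω : ∀ i j, ω ≤ w i j)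
    (hμ : 0 < μ) (hG : IsGapGraph a μ) {δ δ' : V → ℝ}
    (hδ : ∑ i, δ i = 0) (hδ' : ∑ i, δ' i = 0) :
    l2 (δ - δ') ≤ 6 / (ω * μ) * l2 (flow a φ δ - flow a φ δ') := by
  have h1 := energy_le hφ hω hG.nonneg hG.symm δ δ'
  have h2 := hG.gap (δ - δ') (by simp [hδ, hδ'])
  rw [← l2_sq] at h2
  have h3 : ω / 6 * (μ * l2 (δ - δ') ^ 2) ≤ l2 (δ - δ') * l2 (flow a φ δ - flow a φ δ') :=
    le_trans (mul_le_mul_of_nonneg_left h2 (by positivity)) (h1.trans (sum_mul_le_l2 _ _))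
  rcases (l2_nonneg (δ - δ')).eq_or_lt with h0 | h0
  · rw [← h0]
    exact mul_nonneg (by positivity) (l2_nonneg _)
  · have h4 : ω * μ / 6 * l2 (δ - δ') ≤ l2 (flow a φ δ - flow a φ δ') := by
      refine le_of_mul_le_mul_left ?_ h0
      calc _ = ω / 6 * (μ * l2 (δ - δ') ^ 2) := by ring
        _ ≤ _ := h3
    rw [div_mul_eq_mul_div, le_div_iff₀ (by positivity)]
    linarith

/-- A Lipschitz and strongly monotone vector field has a zero: a small step against the field is
a contraction. -/
lemma exists_zero_of_strongly_monotone {E : Type*} [NormedAddCommGroup E] [InnerProductSpace ℝ E]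
    [CompleteSpace E] {G : E → E} {m K : ℝ} (hm : 0 < m)
    (hmono : ∀ x y, m * ‖x - y‖ ^ 2 ≤ inner ℝ (G x - G y) (x - y))
    (hlip : ∀ x y, ‖G x - G y‖ ≤ K * ‖x - y‖) : ∃ x, G x = 0 := by
  set K' := max K 0 + m with hK'
  have hK'm : m ≤ K' := by simp [hK']
  have hK'0 : 0 < K' := lt_of_lt_of_le hm hK'm
  have hlip' : ∀ x y, ‖G x - G y‖ ≤ K' * ‖x - y‖ := fun x y =>
    (hlip x y).trans (mul_le_mul_of_nonneg_right
      (by rw [hK']; linarith [le_max_left K 0]) (norm_nonneg _))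
  set τ := m / K' ^ 2 with hτ
  have hτ0 : 0 < τ := by positivity
  set q := √(1 - m ^ 2 / K' ^ 2) with hq
  have hq1 : q < 1 := by
    rw [hq, Real.sqrt_lt' one_pos]
    have : 0 < m ^ 2 / K' ^ 2 := by positivity
    linarith
  have hrad : 0 ≤ 1 - m ^ 2 / K' ^ 2 := by
    have : m ^ 2 / K' ^ 2 ≤ 1 := by
      rw [div_le_one (by positivity)]
      exact pow_le_pow_left₀ hm.le hK'm 2
    linarith
  have hcontr : ContractingWith ⟨q, Real.sqrt_nonneg _⟩ (fun x => x - τ • G x) := by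
    refine ⟨hq1, LipschitzWith.of_dist_le_mul fun x y => ?_⟩
    rw [dist_eq_norm, dist_eq_norm]
    change _ ≤ q * ‖x - y‖
    refine le_of_sq_le_sq ?_ (by positivity)
    have e : x - τ • G x - (y - τ • G y) = (x - y) - τ • (G x - G y) := by
      rw [smul_sub]; abel
    rw [e, norm_sub_sq_real, inner_smul_right, norm_smul, mul_pow, mul_pow, hq,
      Real.sq_sqrt hrad, real_inner_comm]
    have h1 := mul_le_mul_of_nonneg_left (hmono x y) hτ0.le
    have h2 := pow_le_pow_left₀ (norm_nonneg _) (hlip' x y) 2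
    have h3 : ‖τ‖ ^ 2 = τ ^ 2 := by simp
    have h4 := mul_le_mul_of_nonneg_left h2 (sq_nonneg τ)
    have h5 : τ ^ 2 * (K' * ‖x - y‖) ^ 2 = τ * (m * ‖x - y‖ ^ 2) := by
      rw [hτ]; field_simp
    have h6 : m ^ 2 / K' ^ 2 * ‖x - y‖ ^ 2 = τ * (m * ‖x - y‖ ^ 2) := by
      rw [hτ]; field_simp
    rw [h3]
    nlinarith
  refine ⟨hcontr.fixedPoint, ?_⟩
  have hfix : hcontr.fixedPoint - τ • G hcontr.fixedPoint = hcontr.fixedPoint :=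
    hcontr.fixedPoint_isFixedPt
  have : τ • G hcontr.fixedPoint = 0 := by
    have := sub_eq_self.mp hfix
    exact this
  exact (smul_eq_zero.mp this).resolve_left hτ0.ne'

/-- The flow equation has a centred solution for every source of total mass `0`. Adding the sum of
the coordinates to the field makes it strongly monotone on the whole space. -/
lemma exists_isSol (hφ : IsLink w φ) {ω μ : ℝ} (hω0 : 0 < ω) (hω : ∀ i j, ω ≤ w i j)
    (hμ : 0 < μ) (hG : IsGapGraph a μ) {ξ : V → ℝ} (hξ : ∑ i, ξ i = 0) :
    ∃ δ, IsSol a φ ξ δ := by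
  cases isEmpty_or_nonempty V
  · exact ⟨0, by simp, fun i => isEmptyElim i⟩
  have hw : ∀ i j, 0 ≤ w i j := fun i j => hω0.le.trans (hω i j)
  set n : ℝ := (Fintype.card V : ℝ) with hn
  have hn1 : 1 ≤ n := by
    rw [hn]; exact_mod_cast Fintype.card_pos (α := V)
  set G : EuclideanSpace ℝ V → EuclideanSpace ℝ V := fun x =>
    WithLp.toLp 2 (fun i => flow a φ x i - ξ i + ∑ k, x k) with hGdef
  have hGsub : ∀ x y : EuclideanSpace ℝ V, G x - G y = WithLp.toLp 2
      (fun i => (flow a φ x i - flow a φ y i) + ∑ k, (x - y) k) := by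
    intro x y
    ext i
    simp [hGdef]
    ring
  set B := ∑ i, ∑ j, a i j * (6 * w i j) with hB
  have hlip : ∀ x y, ‖G x - G y‖ ≤ (√n * (B + n)) * ‖x - y‖ := by
    intro x y
    have hxy : ∀ i, |(x - y) i| ≤ ‖x - y‖ := fun i => by
      have := PiLp.norm_apply_le (x - y) i
      simpa using this
    rw [hGsub, mul_assoc]
    refine l2_le_sqrt_card_mul (fun i => ?_) ?_
    · refine (abs_add_le _ _).trans ?_
      rw [add_mul]
      refine add_le_add ?_ ?_
      · have h1 : |flow a φ x i - flow a φ y i| ≤ ∑ j, a i j * (6 * w i j) * ‖x - y‖ := by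
          rw [flow, flow, ← Finset.sum_sub_distrib]
          refine (Finset.abs_sum_le_sum_abs _ _).trans (Finset.sum_le_sum fun j _ => ?_)
          rw [← mul_sub, abs_mul, abs_of_nonneg (hG.nonneg i j), mul_assoc]
          refine mul_le_mul_of_nonneg_left ?_ (hG.nonneg i j)
          refine (hφ.abs_sub_le hw i j _ _).trans ?_
          have h2 : |x i - x j - (y i - y j)| ≤ 2 * ‖x - y‖ := by
            have e : x i - x j - (y i - y j) = (x - y) i - (x - y) j := by simp; ring
            rw [e]
            refine (abs_sub _ _).trans ?_
            linarith [hxy i, hxy j]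
          calc _ ≤ 3 * w i j * (2 * ‖x - y‖) :=
                mul_le_mul_of_nonneg_left h2 (by linarith [hw i j])
            _ = _ := by ring
        refine h1.trans ?_
        rw [← Finset.sum_mul]
        refine mul_le_mul_of_nonneg_right ?_ (norm_nonneg _)
        exact Finset.single_le_sum (f := fun i => ∑ j, a i j * (6 * w i j))
          (fun i _ => Finset.sum_nonneg fun j _ => mul_nonneg (hG.nonneg i j) (by linarith [hw i j]))
          (Finset.mem_univ i)
      · refine (Finset.abs_sum_le_sum_abs _ _).trans ?_
        refine (Finset.sum_le_sum fun k _ => hxy k).trans ?_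
        simp [hn]
    · have : 0 ≤ B := Finset.sum_nonneg fun i _ => Finset.sum_nonneg fun j _ =>
        mul_nonneg (hG.nonneg i j) (by linarith [hw i j])
      positivity
  set m := min (ω / 6 * μ) 1 with hm
  have hm0 : 0 < m := lt_min (by positivity) one_pos
  have hmono : ∀ x y, m * ‖x - y‖ ^ 2 ≤ inner ℝ (G x - G y) (x - y) := by
    intro x y
    set D : V → ℝ := (WithLp.ofLp x) - (WithLp.ofLp y) with hD
    have hnorm : ‖x - y‖ ^ 2 = ∑ i, D i ^ 2 := by
      rw [EuclideanSpace.norm_sq_eq]; simp [hD]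
    set s := ∑ i, D i with hs
    have hinner : inner ℝ (G x - G y) (x - y)
        = ∑ i, D i * (flow a φ x i - flow a φ y i) + s ^ 2 := by
      rw [hGsub, PiLp.inner_apply]
      simp only [RCLike.inner_apply, conj_trivial]
      have : ∀ i, (x - y) i = D i := fun i => rfl
      simp only [this, mul_add, Finset.sum_add_distrib, ← Finset.sum_mul]
      rw [← hs]; ring
    rw [hnorm, hinner]
    have h1 := energy_le hφ hω hG.nonneg hG.symm x y
    have h2 := hG.gap (fun i => D i - s / n) (by
      simp only [Finset.sum_sub_distrib, Finset.sum_const, Finset.card_univ, nsmul_eq_mul]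
      rw [← hs, ← hn]; field_simp; ring)
    have h3 : ∑ i, (D i - s / n) ^ 2 = ∑ i, D i ^ 2 - s ^ 2 / n := by
      have : ∀ i, (D i - s / n) ^ 2 = D i ^ 2 - 2 * (s / n) * D i + (s / n) ^ 2 :=
        fun i => by ring
      simp only [this, Finset.sum_add_distrib, Finset.sum_sub_distrib, ← Finset.mul_sum,
        Finset.sum_const, Finset.card_univ, nsmul_eq_mul]
      rw [← hs, ← hn]; field_simp; ring
    have h4 : ∀ i j, D i - s / n - (D j - s / n) = D i - D j := fun i j => by ring
    simp only [h4] at h2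
    rw [h3] at h2
    have h5 : 0 ≤ ∑ i, D i ^ 2 - s ^ 2 / n := by
      rw [← h3]; exact Finset.sum_nonneg fun i _ => sq_nonneg _
    have h6 := mul_le_mul_of_nonneg_left h2 (by positivity : 0 ≤ ω / 6)
    have h7 : m * (∑ i, D i ^ 2 - s ^ 2 / n) ≤ ω / 6 * μ * (∑ i, D i ^ 2 - s ^ 2 / n) :=
      mul_le_mul_of_nonneg_right (min_le_left _ _) h5
    have h8 : m * (s ^ 2 / n) ≤ s ^ 2 := by
      have e1 : s ^ 2 / n ≤ s ^ 2 := div_le_self (sq_nonneg _) hn1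
      have e2 : 0 ≤ s ^ 2 / n := by positivity
      calc m * (s ^ 2 / n) ≤ 1 * (s ^ 2 / n) := mul_le_mul_of_nonneg_right (min_le_right _ _) e2
        _ ≤ _ := by linarith
    change ω / 6 * ∑ i, ∑ j, a i j * (D i - D j) ^ 2 ≤ ∑ i, D i * _ at h1
    nlinarith
  obtain ⟨x, hx⟩ := exists_zero_of_strongly_monotone hm0 hmono hlip
  have hxi : ∀ i, flow a φ x i - ξ i + ∑ k, x k = 0 := fun i => by
    have := congrArg (fun z : EuclideanSpace ℝ V => z i) hx
    simpa [hGdef] using this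
  have hsum : ∑ k, x k = 0 := by
    have h1 : ∑ i, (flow a φ x i - ξ i + ∑ k, x k) = 0 :=
      Finset.sum_eq_zero fun i _ => hxi i
    rw [Finset.sum_add_distrib, Finset.sum_sub_distrib, sum_flow hφ hG.symm, hξ] at h1
    simp only [Finset.sum_const, Finset.card_univ, nsmul_eq_mul, ← hn] at h1
    have : n * ∑ k, x k = 0 := by linarith
    exact (mul_eq_zero.mp this).resolve_left (by linarith)
  exact ⟨x, hsum, fun i => by have := hxi i; rw [hsum] at this; linarith⟩

end Flow

/-! ### The logistic link -/

section Logistic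

open Real

/-- The derivative `σ (1 - σ)` of the logistic function. -/
def sigmoidDeriv (x : ℝ) : ℝ := sigmoid x * (1 - sigmoid x)

lemma sigmoidDeriv_pos (x : ℝ) : 0 < sigmoidDeriv x :=
  mul_pos (sigmoid_pos x) (by linarith [sigmoid_lt_one x])

lemma sigmoidDeriv_neg (x : ℝ) : sigmoidDeriv (-x) = sigmoidDeriv x := by
  simp only [sigmoidDeriv, sigmoid_neg]; ring

lemma sigmoidDeriv_le (x : ℝ) : sigmoidDeriv x ≤ 1 / 4 := by
  unfold sigmoidDeriv
  nlinarith [sq_nonneg (sigmoid x - 1 / 2)]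

lemma sigmoidDeriv_add_le_of_nonneg (x : ℝ) {t : ℝ} (ht : 0 ≤ t) :
    sigmoidDeriv (x + t) ≤ exp t * sigmoidDeriv x := by
  have h1 : sigmoid (x + t) ≤ exp t * sigmoid x := by
    rw [sigmoid_def, sigmoid_def, ← div_eq_mul_inv, inv_eq_one_div, div_le_div_iff₀ (by positivity)
      (by positivity), neg_add, exp_add]
    have : exp t * exp (-t) = 1 := by rw [← exp_add]; simp
    have h2 : 1 ≤ exp t := one_le_exp ht
    nlinarith [exp_pos (-x)]
  have h2 : 1 - sigmoid (x + t) ≤ 1 - sigmoid x := by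
    linarith [sigmoid_monotone (by linarith : x ≤ x + t)]
  unfold sigmoidDeriv
  rw [← mul_assoc]
  exact mul_le_mul h1 h2 (by linarith [sigmoid_lt_one (x + t)])
    (mul_nonneg (exp_pos _).le (sigmoid_nonneg _))

lemma sigmoidDeriv_add_le (x t : ℝ) : sigmoidDeriv (x + t) ≤ exp |t| * sigmoidDeriv x := by
  rcases le_total 0 t with h | h
  · rw [abs_of_nonneg h]; exact sigmoidDeriv_add_le_of_nonneg x h
  · rw [abs_of_nonpos h, ← sigmoidDeriv_neg, ← sigmoidDeriv_neg x, neg_add]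
    exact sigmoidDeriv_add_le_of_nonneg (-x) (by linarith)

lemma le_sigmoidDeriv_add (x t : ℝ) : exp (-|t|) * sigmoidDeriv x ≤ sigmoidDeriv (x + t) := by
  have h := sigmoidDeriv_add_le (x + t) (-t)
  rw [abs_neg, add_neg_cancel_right] at h
  have h1 := mul_le_mul_of_nonneg_left h (exp_pos (-|t|)).le
  rwa [← mul_assoc, ← exp_add, neg_add_cancel, exp_zero, one_mul] at h1

lemma exp_neg_abs_mul_le_sigmoidDeriv (x : ℝ) : exp (-|x|) / 4 ≤ sigmoidDeriv x := by
  have h := le_sigmoidDeriv_add 0 x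
  rw [zero_add] at h
  have : sigmoidDeriv 0 = 1 / 4 := by norm_num [sigmoidDeriv, sigmoid_zero]
  rw [this] at h
  linarith

/-- The mean value theorem for the logistic function, the base point being `x`. -/
lemma exists_sigmoid_sub_eq (x c c' : ℝ) :
    ∃ r, r ∈ Set.uIcc c' c ∧ sigmoid (x + c) - sigmoid (x + c') = sigmoidDeriv (x + r) * (c - c') := by
  have key : ∀ u v : ℝ, u < v → ∃ r, r ∈ Set.uIcc u v ∧
      sigmoid (x + v) - sigmoid (x + u) = sigmoidDeriv (x + r) * (v - u) := by
    intro u v h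
    obtain ⟨r, hr, he⟩ := exists_hasDerivAt_eq_slope (fun t => sigmoid (x + t))
      (fun t => sigmoidDeriv (x + t)) h
      ((continuous_sigmoid.comp (continuous_const.add continuous_id)).continuousOn)
      (fun t _ => (hasDerivAt_sigmoid (x + t)).comp_const_add x t)
    refine ⟨r, Set.Icc_subset_uIcc (Set.Ioo_subset_Icc_self hr), ?_⟩
    rw [he]
    field_simp [sub_ne_zero.mpr h.ne']
  rcases lt_trichotomy c' c with h | h | h
  · exact key c' c h
  · subst h; exact ⟨c', by simp, by simp⟩
  · obtain ⟨r, hr, he⟩ := key c c' h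
    exact ⟨r, by rwa [Set.uIcc_comm], by linarith⟩

/-- Truncation to `[-1, 1]`. -/
def truncate (t : ℝ) : ℝ := max (-1) (min 1 t)

lemma truncate_mono : Monotone truncate := fun s t h => by unfold truncate; gcongr

lemma sub_truncate_mono {s t : ℝ} (h : s ≤ t) : s - truncate s ≤ t - truncate t := by
  unfold truncate
  rcases max_cases (-1) (min 1 s) with h1 | h1 <;> rcases max_cases (-1) (min 1 t) with h2 | h2 <;>
    rcases min_cases 1 s with h3 | h3 <;> rcases min_cases 1 t with h4 | h4 <;> linarith

lemma abs_truncate_le_one (t : ℝ) : |truncate t| ≤ 1 :=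
  abs_le.mpr ⟨le_max_left _ _, max_le (by norm_num) (min_le_left _ _)⟩

lemma truncate_neg (t : ℝ) : truncate (-t) = -truncate t := by
  unfold truncate
  rw [← min_neg_neg, ← max_neg_neg, neg_neg, max_min_distrib_left]
  norm_num

lemma truncate_of_abs_le {t : ℝ} (h : |t| ≤ 1) : truncate t = t := by
  obtain ⟨h1, h2⟩ := abs_le.mp h
  rw [truncate, min_eq_right h2, max_eq_right h1]

lemma abs_truncate_le (t : ℝ) : |truncate t| ≤ |t| := by
  rcases le_total |t| 1 with h | h
  · rw [truncate_of_abs_le h]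
  · exact (abs_truncate_le_one t).trans h

variable {V : Type*}

/-- The Hessian weights of the logistic loss at the scores `s`. -/
def logisticWeight (s : V → ℝ) (i j : V) : ℝ := sigmoidDeriv (s i - s j)

/-- The increment of the logistic function at `s i - s j`, continued linearly with slope
`logisticWeight s i j` beyond increments of size `1`; this keeps the slopes comparable to the
weights on the whole line. -/
def logisticLink (s : V → ℝ) (i j : V) (t : ℝ) : ℝ :=
  sigmoid (s i - s j + truncate t) - sigmoid (s i - s j) + logisticWeight s i j * (t - truncate t)

lemma logisticWeight_pos (s : V → ℝ) (i j : V) : 0 < logisticWeight s i j := sigmoidDeriv_pos _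

lemma logisticWeight_symm (s : V → ℝ) (i j : V) : logisticWeight s i j = logisticWeight s j i := by
  rw [logisticWeight, ← sigmoidDeriv_neg, neg_sub, logisticWeight]

lemma exp_abs_le_three {r : ℝ} (h : |r| ≤ 1) : exp |r| ≤ 3 :=
  (exp_le_exp.mpr h).trans (by linarith [exp_one_lt_d9])

lemma isLink_logisticLink (s : V → ℝ) : IsLink (logisticWeight s) (logisticLink s) where
  zero i j := by simp [logisticLink, truncate_of_abs_le]
  antisymm i j t := by
    simp only [logisticLink, truncate_neg]
    rw [logisticWeight_symm s j i, ← neg_sub (s i) (s j), ← neg_add, sigmoid_neg, sigmoid_neg]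
    ring
  lower i j t t' h := by
    obtain ⟨r, hr, he⟩ := exists_sigmoid_sub_eq (s i - s j) (truncate t') (truncate t)
    have hc := truncate_mono h
    have hr1 : |r| ≤ 1 := by
      rw [Set.uIcc_of_le hc] at hr
      have h1 := abs_le.mp (abs_truncate_le_one t)
      have h2 := abs_le.mp (abs_truncate_le_one t')
      exact abs_le.mpr ⟨by linarith [hr.1], by linarith [hr.2]⟩
    have hlow : logisticWeight s i j / 3 ≤ sigmoidDeriv (s i - s j + r) := by
      refine le_trans ?_ (le_sigmoidDeriv_add _ r)
      rw [exp_neg, ← div_eq_inv_mul]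
      exact div_le_div_of_nonneg_left (logisticWeight_pos s i j).le (exp_pos _) (exp_abs_le_three hr1)
    have h1 := mul_le_mul_of_nonneg_right hlow (sub_nonneg.2 hc)
    have h2 := mul_nonneg (logisticWeight_pos s i j).le (sub_nonneg.2 (sub_truncate_mono h))
    simp only [logisticLink]
    nlinarith
  upper i j t t' h := by
    obtain ⟨r, hr, he⟩ := exists_sigmoid_sub_eq (s i - s j) (truncate t') (truncate t)
    have hc := truncate_mono h
    have hr1 : |r| ≤ 1 := by
      rw [Set.uIcc_of_le hc] at hr
      have h1 := abs_le.mp (abs_truncate_le_one t)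
      have h2 := abs_le.mp (abs_truncate_le_one t')
      exact abs_le.mpr ⟨by linarith [hr.1], by linarith [hr.2]⟩
    have hup : sigmoidDeriv (s i - s j + r) ≤ 3 * logisticWeight s i j :=
      (sigmoidDeriv_add_le _ r).trans (mul_le_mul_of_nonneg_right (exp_abs_le_three hr1)
        (logisticWeight_pos s i j).le)
    have h1 := mul_le_mul_of_nonneg_right hup (sub_nonneg.2 hc)
    have h2 := mul_nonneg (logisticWeight_pos s i j).le (sub_nonneg.2 (sub_truncate_mono h))
    simp only [logisticLink]
    nlinarith

/-- The logistic link agrees with its linearization up to a term of second order that is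
proportional to the weight; thus a factor `κ` is not lost in the remainder. -/
lemma abs_logisticLink_sub_le (s : V → ℝ) (i j : V) (t : ℝ) :
    |logisticLink s i j t - linearLink (logisticWeight s) i j t| ≤ 2 * logisticWeight s i j * t ^ 2 := by
  set c := truncate t with hc
  obtain ⟨r, hr, he⟩ := exists_sigmoid_sub_eq (s i - s j) c 0
  rw [add_zero, sub_zero] at he
  have hrc : |r| ≤ |c| := by
    have := Set.abs_sub_left_of_mem_uIcc hr
    simpa using this
  have hc1 : |c| ≤ 1 := abs_truncate_le_one t
  have hw := logisticWeight_pos s i j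
  have e : logisticLink s i j t - linearLink (logisticWeight s) i j t
      = (sigmoidDeriv (s i - s j + r) - logisticWeight s i j) * c := by
    simp only [logisticLink, linearLink, ← hc, he]; ring
  have h1 : |sigmoidDeriv (s i - s j + r) - logisticWeight s i j|
      ≤ 2 * |r| * logisticWeight s i j := by
    have hu := sigmoidDeriv_add_le (s i - s j) r
    have hl := le_sigmoidDeriv_add (s i - s j) r
    change _ ≤ _ * logisticWeight s i j at hu
    change _ * logisticWeight s i j ≤ _ at hl
    have e1 := abs_le.mp (abs_exp_sub_one_le (x := |r|) (by rw [abs_abs]; exact hrc.trans hc1))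
    have e2 := add_one_le_exp (-|r|)
    rw [abs_abs] at e1
    refine abs_le.mpr ⟨?_, ?_⟩
    · nlinarith [abs_nonneg r]
    · nlinarith
  rw [e, abs_mul]
  have hct : |c| * |c| ≤ t ^ 2 := by
    rw [← sq_abs t, sq]
    exact mul_self_le_mul_self (abs_nonneg _) (abs_truncate_le t)
  calc _ ≤ (2 * |r| * logisticWeight s i j) * |c| := mul_le_mul_of_nonneg_right h1 (abs_nonneg _)
    _ ≤ (2 * |c| * logisticWeight s i j) * |c| := by gcongr
    _ = 2 * logisticWeight s i j * (|c| * |c|) := by ring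
    _ ≤ _ := mul_le_mul_of_nonneg_left hct (by positivity)

lemma logisticLink_of_abs_le (s : V → ℝ) (i j : V) {t : ℝ} (h : |t| ≤ 1) :
    logisticLink s i j t = sigmoid (s i - s j + t) - sigmoid (s i - s j) := by
  simp [logisticLink, truncate_of_abs_le h]

end Logistic

/-! ### Leave-one-out analysis on a regular configuration -/

section LeaveOneOut

variable {V : Type*} {w a z : V → V → ℝ} {φ : V → V → ℝ → ℝ}

lemma IsLink.abs_sub_le_of_le (hφ : IsLink w φ) (hw0 : ∀ i j, 0 ≤ w i j)
    (hw : ∀ i j, w i j ≤ 1 / 4) (i j : V) (s t : ℝ) : |φ i j t - φ i j s| ≤ 3 / 4 * |t - s| :=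
  (hφ.abs_sub_le hw0 i j s t).trans
    (mul_le_mul_of_nonneg_right (by linarith [hw i j]) (abs_nonneg _))

variable [Fintype V]

/-- The net noise at each vertex. -/
def noise (a z : V → V → ℝ) (i : V) : ℝ := ∑ j, a i j * z i j

lemma sum_noise (hs : ∀ i j, a i j = a j i) (hz : ∀ i j, z j i = -z i j) :
    ∑ i, noise a z i = 0 := by
  simpa [noise] using sum_mul_sum_antisymm (f := fun i j => a i j * z i j)
    (fun i j => by simp only [hs j i, hz i j]; ring) (fun _ => 1)

variable [DecidableEq V]

/-- The edge weights with the row and column of `m` replaced by their mean `p`. -/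
def looGraph (p : ℝ) (a : V → V → ℝ) (m i j : V) : ℝ :=
  if i = j then 0 else if i = m ∨ j = m then p else a i j

/-- The net noise at each vertex without the comparisons that involve `m`. -/
def looNoise (a z : V → V → ℝ) (m i : V) : ℝ :=
  ∑ j, if i = m ∨ j = m then 0 else a i j * z i j

/-- The Bernstein-type bound for the fluctuation, around its mean, of the sum of `v` over the
neighbours of `m`. -/
def RowConcentrated (p A b sn : ℝ) (a : V → V → ℝ) (m : V) (v : V → ℝ) : Prop :=
  |∑ j ∈ Finset.univ.erase m, (a m j - p) * v j| ≤ 10 * (A * b / sn * l2 v + b ^ 2 * ‖v‖)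

/-- A comparison graph `a`, Hessian weights `w` and noises `z` for which degrees, noises and
spectral gaps have their typical sizes. With `n` vertices, edge probability `p` and `L` comparisons
per edge, the parameters stand for `A = √(n p)`, `b = √(log n)`, `sn = √n` and
`r = √(log n / (n p L))`; the weights lie between `1 / (4 κ)` and `1 / 4`. -/
structure Regular (g κ p A b r sn : ℝ) (a z w : V → V → ℝ) : Prop where
  sqrt_card : √(Fintype.card V) = sn
  a_nonneg : ∀ i j, 0 ≤ a i j
  a_le_one : ∀ i j, a i j ≤ 1
  a_diag : ∀ i, a i i = 0
  z_symm : ∀ i j, z j i = -z i j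
  w_symm : ∀ i j, w i j = w j i
  le_w : ∀ i j, 1 / (4 * κ) ≤ w i j
  w_le : ∀ i j, w i j ≤ 1 / 4
  abs_z_le : ∀ i j, |z i j| ≤ 25 * (A * r)
  abs_noise_le : ∀ i, |noise a z i| ≤ 25 * (A ^ 2 * r)
  deg_le : ∀ i, ∑ j, a i j ≤ 2 * A ^ 2
  le_wdeg : ∀ i, p / 2 * ∑ j ∈ Finset.univ.erase i, w i j ≤ ∑ j, a i j * w i j
  gap : IsGapGraph a (24 * A ^ 2 / g)
  gap_loo : ∀ m, IsGapGraph (looGraph p a m) (24 * A ^ 2 / g)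

/-- Admissible parameters: the three combinations that have to be small are at most
`1 / (10000 g)`. -/
structure Admissible (g κ p A b r sn : ℝ) : Prop where
  one_le_g : 1 ≤ g
  one_le_κ : 1 ≤ κ
  A_pos : 0 < A
  b_ge : 7 / 10 ≤ b
  b_le : b ≤ A
  r_pos : 0 < r
  A_le : A ≤ sn
  two_le : 2 ≤ sn ^ 2
  p_eq : p = A ^ 2 / sn ^ 2
  small₁ : 10000 * g * (κ * b / A) ≤ 1
  small₂ : 10000 * g * (κ / A) ≤ 1
  small₃ : 10000 * g * (κ * b ^ 2 / A ^ 2) ≤ 1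

variable {g κ p A b r sn : ℝ}

lemma Admissible.sn_pos (h : Admissible g κ p A b r sn) : 0 < sn := h.A_pos.trans_le h.A_le

lemma Admissible.p_pos (h : Admissible g κ p A b r sn) : 0 < p := by
  have := h.sn_pos; have := h.A_pos; rw [h.p_eq]; positivity

lemma Admissible.p_le_one (h : Admissible g κ p A b r sn) : p ≤ 1 := by
  have := h.sn_pos
  rw [h.p_eq, div_le_one (by positivity)]
  exact pow_le_pow_left₀ h.A_pos.le h.A_le 2

lemma Regular.w_nonneg (hp : Admissible g κ p A b r sn) (h : Regular g κ p A b r sn a z w)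
    (i j : V) : 0 ≤ w i j :=
  le_trans (by have := hp.one_le_κ; positivity) (h.le_w i j)

/-- Stability of the flow equation on a regular configuration. -/
lemma Regular.l2_sub_le (hp : Admissible g κ p A b r sn) (h : Regular g κ p A b r sn a z w)
    (hφ : IsLink w φ) {δ δ' : V → ℝ} (hδ : ∑ i, δ i = 0) (hδ' : ∑ i, δ' i = 0) :
    l2 (δ - δ') ≤ g * κ / A ^ 2 * l2 (flow a φ δ - flow a φ δ') := by
  have h1 := hp.one_le_κ
  have h2 := hp.one_le_g
  have h3 := hp.A_pos
  have := l2_sub_le_of_flow hφ (ω := 1 / (4 * κ)) (μ := 24 * A ^ 2 / g) (by positivity) h.le_w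
    (by positivity) h.gap hδ hδ'
  convert this using 2
  field_simp
  norm_num

lemma sum_looNoise (hs : ∀ i j, a i j = a j i) (hz : ∀ i j, z j i = -z i j) (m : V) :
    ∑ i, looNoise a z m i = 0 := by
  simpa [looNoise] using sum_mul_sum_antisymm
    (f := fun i j => if i = m ∨ j = m then 0 else a i j * z i j)
    (fun i j => by
      simp only [hs j i, hz i j, or_comm (a := j = m)]
      split_ifs <;> ring) (fun _ => 1)

lemma Regular.exists_sol (hp : Admissible g κ p A b r sn) (h : Regular g κ p A b r sn a z w)
    (hφ : IsLink w φ) : ∃ δ, IsSol a φ (noise a z) δ := by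
  have h1 := hp.one_le_κ
  have h2 := hp.one_le_g
  have h3 := hp.A_pos
  exact exists_isSol hφ (ω := 1 / (4 * κ)) (by positivity) h.le_w (by positivity) h.gap
    (sum_noise h.gap.symm h.z_symm)

lemma Regular.exists_looSol (hp : Admissible g κ p A b r sn) (h : Regular g κ p A b r sn a z w)
    (hφ : IsLink w φ) (m : V) : ∃ δ, IsSol (looGraph p a m) φ (looNoise a z m) δ := by
  have h1 := hp.one_le_κ
  have h2 := hp.one_le_g
  have h3 := hp.A_pos
  exact exists_isSol hφ (ω := 1 / (4 * κ)) (by positivity) h.le_w (by positivity) (h.gap_loo m)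
    (sum_looNoise h.gap.symm h.z_symm m)

/-- Euclidean bound for the solution, by comparison with the zero potential. -/
lemma Regular.l2_sol_le (hp : Admissible g κ p A b r sn) (h : Regular g κ p A b r sn a z w)
    (hφ : IsLink w φ) {δ : V → ℝ} (hδ : IsSol a φ (noise a z) δ) :
    l2 δ ≤ 25 * g * κ * r * sn := by
  have h1 := hp.one_le_κ
  have h2 := hp.one_le_g
  have h3 := hp.A_pos
  have h4 := hp.r_pos
  have hst := h.l2_sub_le hp hφ hδ.1 (δ' := 0) (by simp)
  have e : flow a φ δ - flow a φ 0 = noise a z := by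
    funext i
    rw [Pi.sub_apply, hδ.2]
    simp [flow, hφ.zero]
  rw [e, sub_zero] at hst
  have hn := l2_le_sqrt_card_mul (f := noise a z) h.abs_noise_le (by positivity)
  rw [h.sqrt_card] at hn
  calc l2 δ ≤ g * κ / A ^ 2 * (sn * (25 * (A ^ 2 * r))) :=
        hst.trans (mul_le_mul_of_nonneg_left hn (by positivity))
    _ = _ := by field_simp

/-- The Euclidean norm of a row of the graph. -/
lemma Regular.l2_row_le (hp : Admissible g κ p A b r sn) (h : Regular g κ p A b r sn a z w)
    (m : V) : l2 (a m) ≤ 3 / 2 * A := by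
  have h3 := hp.A_pos
  refine l2_le_of_sum_sq_le (by positivity) ?_
  calc ∑ j, a m j ^ 2 ≤ ∑ j, a m j := Finset.sum_le_sum fun j _ => by
        nlinarith [h.a_nonneg m j, h.a_le_one m j]
    _ ≤ 2 * A ^ 2 := h.deg_le m
    _ ≤ _ := by nlinarith [sq_nonneg A]

lemma sum_erase_eq_of_diag (m : V) {f : V → ℝ} (hf : f m = 0) :
    ∑ j ∈ Finset.univ.erase m, f j = ∑ j, f j := by
  rw [← Finset.add_sum_erase _ _ (Finset.mem_univ m), hf, zero_add]

/-- Replacing the row of `m` by its mean changes the flow only through the row and the column of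
`m`. -/
lemma flow_sub_looGraph (hφ : IsLink w φ) (m : V) (δ : V → ℝ) (i : V) :
    flow a φ δ i - flow (looGraph p a m) φ δ i = if i = m
      then ∑ j ∈ Finset.univ.erase m, (a m j - p) * φ m j (δ m - δ j)
      else (a i m - p) * φ i m (δ i - δ m) := by
  have h0 : flow a φ δ i - flow (looGraph p a m) φ δ i
      = ∑ j, (a i j - looGraph p a m i j) * φ i j (δ i - δ j) := by
    rw [flow, flow, ← Finset.sum_sub_distrib]
    exact Finset.sum_congr rfl fun j _ => by ring
  rw [h0]
  split_ifs with him
  · subst him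
    have hii : (a i i - looGraph p a i i i) * φ i i (δ i - δ i) = 0 := by
      simp [hφ.zero]
    rw [← sum_erase_eq_of_diag i hii]
    refine Finset.sum_congr rfl fun j hj => ?_
    have : i ≠ j := (Finset.ne_of_mem_erase hj).symm
    simp [looGraph, this]
  · rw [Finset.sum_eq_single m]
    · simp [looGraph, him]
    · intro j _ hj
      by_cases hij : i = j
      · subst hij; simp [hφ.zero]
      · simp [looGraph, hij, him, hj]
    · intro hm; exact absurd (Finset.mem_univ m) hm

lemma noise_sub_looNoise (m i : V) :
    noise a z i - looNoise a z m i = if i = m then noise a z m else a i m * z i m := by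
  split_ifs with him
  · subst him; simp [looNoise]
  · have : ∀ j, (if i = m ∨ j = m then 0 else a i j * z i j)
        = a i j * z i j - if j = m then a i j * z i j else 0 := fun j => by
      by_cases hj : j = m <;> simp [him, hj]
    simp only [noise, looNoise, this, Finset.sum_sub_distrib]
    simp

/-- The leave-one-out solution is close to the solution in Euclidean norm. -/
lemma Regular.l2_sub_looSol_le (hp : Admissible g κ p A b r sn)
    (h : Regular g κ p A b r sn a z w) (hφ : IsLink w φ) {m : V} {δ δ' : V → ℝ}
    (hδ : IsSol a φ (noise a z) δ) (hδ' : IsSol (looGraph p a m) φ (looNoise a z m) δ')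
    (hrow : RowConcentrated p A b sn a m (fun j => φ m j (δ' m - δ' j))) :
    l2 (δ - δ') ≤ 126 * g * κ * r + 70 * g * (κ * b / A) * ‖δ‖ := by
  have h1 := hp.one_le_κ
  have h2 := hp.one_le_g
  have h3 := hp.A_pos
  have h4 := hp.r_pos
  have hb := hp.b_ge
  have hbA := hp.b_le
  have hsn := hp.sn_pos
  have hw0 := h.w_nonneg hp
  set M' := ‖δ'‖ with hM'
  have hM0 : 0 ≤ M' := norm_nonneg _
  have hdiff : ∀ i j, |φ i j (δ' i - δ' j)| ≤ 3 / 2 * M' := fun i j => by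
    have e1 := hφ.abs_sub_le_of_le hw0 h.w_le i j 0 (δ' i - δ' j)
    rw [hφ.zero, sub_zero, sub_zero] at e1
    have e2 := abs_sub (δ' i) (δ' j)
    have e3 := abs_apply_le_norm δ' i
    have e4 := abs_apply_le_norm δ' j
    linarith
  set f₁ : V → ℝ := fun i => a m i * (25 * (A * r)) with hf₁
  set f₂ : V → ℝ := fun i => if i = m then 0 else (a i m - p) * φ i m (δ' i - δ' m) with hf₂
  set X := ∑ j ∈ Finset.univ.erase m, (a m j - p) * φ m j (δ' m - δ' j) with hX
  set f₃ : V → ℝ := fun i => if i = m then noise a z m - X else 0 with hf₃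
  set f₀ : V → ℝ := fun i => if i = m then 0 else a i m * z i m with hf₀
  have hdecomp : flow a φ δ - flow a φ δ' = f₀ - f₂ + f₃ := by
    funext i
    have e1 := flow_sub_looGraph (a := a) (p := p) hφ m δ' i
    have e2 := noise_sub_looNoise (a := a) (z := z) m i
    rw [hδ'.2 i] at e1
    simp only [Pi.sub_apply, Pi.add_apply, hδ.2 i, hf₀, hf₂, hf₃]
    split_ifs at e1 e2 ⊢ with him
    · linarith
    · linarith
  have hl0 : l2 f₀ ≤ 38 * (A ^ 2 * r) := by
    have e1 : l2 f₀ ≤ l2 f₁ := l2_mono fun i => by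
      simp only [hf₀, hf₁]
      split_ifs with him
      · rw [abs_zero]; exact abs_nonneg _
      · rw [abs_mul, abs_mul, abs_of_nonneg (h.a_nonneg i m), abs_of_nonneg (h.a_nonneg m i),
          h.gap.symm i m, abs_of_pos (by positivity : 0 < 25 * (A * r))]
        exact mul_le_mul_of_nonneg_left (h.abs_z_le i m) (h.a_nonneg m i)
    have e2 : l2 f₁ = 25 * (A * r) * l2 (a m) := by
      have := l2_const_mul (25 * (A * r)) (a m)
      rw [abs_of_pos (by positivity)] at this
      rw [← this, hf₁]
      congr 1; funext i; ring
    have e3 := mul_le_mul_of_nonneg_left (h.l2_row_le hp m) (by positivity : 0 ≤ 25 * (A * r))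
    have e4 : 0 ≤ A ^ 2 * r := by positivity
    nlinarith
  have hl2 : l2 f₂ ≤ 3 * A * M' := by
    refine l2_le_of_sum_sq_le (by positivity) ?_
    have e1 : ∀ i, f₂ i ^ 2 ≤ (a m i + p) * (3 / 2 * M') ^ 2 := fun i => by
      simp only [hf₂]
      have e0 := h.a_nonneg m i
      have e00 := hp.p_pos
      split_ifs with him
      · have : 0 ≤ (a m i + p) * (3 / 2 * M') ^ 2 := by positivity
        simpa using this
      · rw [mul_pow]
        refine mul_le_mul ?_ ?_ (sq_nonneg _) (by positivity)
        · rw [h.gap.symm i m]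
          nlinarith [h.a_le_one m i, hp.p_le_one]
        · exact sq_le_sq' (by linarith [(abs_le.mp (hdiff i m)).1]) (abs_le.mp (hdiff i m)).2
    have e2 : ∑ _i : V, p = A ^ 2 := by
      rw [Finset.sum_const, Finset.card_univ, nsmul_eq_mul, hp.p_eq]
      have : (Fintype.card V : ℝ) = sn ^ 2 := by
        rw [← h.sqrt_card, Real.sq_sqrt (by positivity)]
      rw [this]; field_simp
    calc ∑ i, f₂ i ^ 2 ≤ ∑ i, (a m i + p) * (3 / 2 * M') ^ 2 := Finset.sum_le_sum fun i _ => e1 i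
      _ = (∑ i, a m i + A ^ 2) * (3 / 2 * M') ^ 2 := by
          rw [← Finset.sum_mul, Finset.sum_add_distrib, e2]
      _ ≤ (3 * A ^ 2) * (3 / 2 * M') ^ 2 := by
          refine mul_le_mul_of_nonneg_right ?_ (sq_nonneg _)
          linarith [h.deg_le m]
      _ ≤ (3 * A * M') ^ 2 := by nlinarith [sq_nonneg (A * M')]
  have hl3 : l2 f₃ ≤ 25 * (A ^ 2 * r) + 30 * (A * b * M') := by
    have e1 : l2 f₃ = |noise a z m - X| := by
      have : l2 f₃ ^ 2 = |noise a z m - X| ^ 2 := by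
        rw [l2_sq, Finset.sum_eq_single m]
        · simp [hf₃]
        · intro j _ hj; simp [hf₃, hj]
        · intro hm; exact absurd (Finset.mem_univ m) hm
      exact (pow_left_inj₀ (l2_nonneg _) (abs_nonneg _) two_ne_zero).mp this
    have e2 : l2 (fun j => φ m j (δ' m - δ' j)) ≤ sn * (3 / 2 * M') := by
      rw [← h.sqrt_card]
      exact l2_le_sqrt_card_mul (fun j => hdiff m j) (by positivity)
    have e3 : ‖fun j => φ m j (δ' m - δ' j)‖ ≤ 3 / 2 * M' :=
      (pi_norm_le_iff_of_nonneg (by positivity)).mpr fun j => hdiff m j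
    have e4 : |X| ≤ 30 * (A * b * M') := by
      refine le_trans hrow ?_
      have e5 := mul_le_mul_of_nonneg_left e2 (by positivity : 0 ≤ A * b / sn)
      have e6 := mul_le_mul_of_nonneg_left e3 (by positivity : 0 ≤ b ^ 2)
      have e7 : A * b / sn * (sn * (3 / 2 * M')) = 3 / 2 * (A * b * M') := by field_simp
      have e8 : b ^ 2 * (3 / 2 * M') ≤ 3 / 2 * (A * b * M') := by
        have := mul_le_mul_of_nonneg_right hbA (by positivity : 0 ≤ b * M')
        nlinarith
      linarith
    rw [e1]
    refine (abs_sub _ _).trans (add_le_add (h.abs_noise_le m) e4)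
  have hst := h.l2_sub_le hp hφ hδ.1 hδ'.1
  rw [hdecomp] at hst
  have htot : l2 (f₀ - f₂ + f₃) ≤ 63 * (A ^ 2 * r) + 35 * (A * b * M') := by
    have e1 := l2_add_le (f₀ - f₂) f₃
    have e2 := CARE.l2_sub_le f₀ f₂
    have e3 : 3 * A * M' ≤ 5 * (A * b * M') := by
      nlinarith [mul_le_mul_of_nonneg_right hb (by positivity : 0 ≤ A * M')]
    linarith
  have hmain : l2 (δ - δ') ≤ 63 * g * κ * r + 35 * g * (κ * b / A) * M' := by
    refine hst.trans ((mul_le_mul_of_nonneg_left htot (by positivity)).trans (le_of_eq ?_))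
    field_simp
  have hM : M' ≤ ‖δ‖ + l2 (δ - δ') := by
    have e1 : δ' = δ - (δ - δ') := by abel
    have e2 := norm_sub_le δ (δ - δ')
    rw [← e1] at e2
    linarith [norm_le_l2 (δ - δ')]
  have hs := hp.small₁
  set q := g * (κ * b / A) with hq
  have hq0 : 0 ≤ q := by positivity
  have hM'' := mul_le_mul_of_nonneg_left hM hq0
  have hl := l2_nonneg (δ - δ')
  have : q * l2 (δ - δ') ≤ 1 / 10000 * l2 (δ - δ') :=
    mul_le_mul_of_nonneg_right (by rw [hq]; linarith) hl
  have e1 : 35 * g * (κ * b / A) * M' = 35 * (q * M') := by rw [hq]; ring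
  have e2 : 70 * g * (κ * b / A) * ‖δ‖ = 70 * (q * ‖δ‖) := by rw [hq]; ring
  have e3 : 0 ≤ q * ‖δ‖ := mul_nonneg hq0 (norm_nonneg _)
  rw [e1] at hmain
  rw [e2]
  have e4 : 0 ≤ g * κ * r := by positivity
  nlinarith

/-- The total weight of a row is at least of order `n / κ`. -/
lemma Admissible.le_sum_w (hp : Admissible g κ p A b r sn) (hcard : √(Fintype.card V) = sn)
    (hw : ∀ i j, 1 / (4 * κ) ≤ w i j) (m : V) :
    sn ^ 2 / (8 * κ) ≤ ∑ j ∈ Finset.univ.erase m, w m j := by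
  have h1 := hp.one_le_κ
  have hc : (Fintype.card V : ℝ) = sn ^ 2 := by
    rw [← hcard, Real.sq_sqrt (by positivity)]
  have e1 : ∑ _j ∈ Finset.univ.erase m, 1 / (4 * κ) ≤ ∑ j ∈ Finset.univ.erase m, w m j :=
    Finset.sum_le_sum fun j _ => hw m j
  have hpos : 1 ≤ Fintype.card V := Fintype.card_pos_iff.mpr ⟨m⟩
  rw [Finset.sum_const, Finset.card_erase_of_mem (Finset.mem_univ m), Finset.card_univ,
    nsmul_eq_mul, Nat.cast_sub hpos, hc, Nat.cast_one] at e1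
  refine le_trans ?_ e1
  rw [div_le_iff₀ (by positivity)]
  have : (sn ^ 2 - 1) * (1 / (4 * κ)) * (8 * κ) = 2 * (sn ^ 2 - 1) := by field_simp; ring
  rw [this]
  linarith [hp.two_le]

/-- Row estimate: a quantity bounded, in units of the weighted degree of `m`, by a mean term and
by fluctuations. The mean term costs only `√κ`, because the weights are at most `1 / 4`. -/
lemma Regular.row_bound (hp : Admissible g κ p A b r sn) (h : Regular g κ p A b r sn a z w)
    {m : V} {c : ℝ} {v x : V → ℝ} {R : ℝ} (hc : 0 ≤ c) (hvx : ∀ j, |v j| ≤ c * w m j * |x j|)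
    (hrow : RowConcentrated p A b sn a m v) {y : ℝ}
    (hy : (∑ j, a m j * w m j) * |y| ≤ |∑ j, a m j * v j| + R) (hR : 0 ≤ R) :
    |y| ≤ 4 * c * √κ * (l2 x / sn) + 40 * c * (κ * b ^ 2 / A ^ 2) * ‖x‖
      + 16 * (κ / A ^ 2) * R := by
  have h1 := hp.one_le_κ
  have h2 := hp.one_le_g
  have h3 := hp.A_pos
  have hb := hp.b_ge
  have hsn := hp.sn_pos
  have hp0 := hp.p_pos
  have hw0 := h.w_nonneg hp
  set k := √κ with hk
  have hk1 : 1 ≤ k := Real.one_le_sqrt.mpr h1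
  have hk2 : k ^ 2 = κ := Real.sq_sqrt (by linarith)
  set W := ∑ j ∈ Finset.univ.erase m, w m j with hW
  have hWlow : sn ^ 2 / (8 * κ) ≤ W := hp.le_sum_w h.sqrt_card h.le_w m
  have hW0 : 0 < W := lt_of_lt_of_le (by positivity) hWlow
  set S := √W with hS
  have hS0 : 0 < S := Real.sqrt_pos.mpr hW0
  have hS2 : S ^ 2 = W := Real.sq_sqrt hW0.le
  have hSlow : sn / (3 * k) ≤ S := by
    refine Real.le_sqrt_of_sq_le (le_trans ?_ hWlow)
    rw [div_pow, mul_pow, hk2]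
    exact div_le_div_of_nonneg_left (by positivity) (by positivity) (by nlinarith)
  have hv4 : ∀ j, |v j| ≤ |c / 4 * x j| := fun j => by
    rw [abs_mul, abs_of_nonneg (by positivity : 0 ≤ c / 4)]
    refine (hvx j).trans (mul_le_mul_of_nonneg_right ?_ (abs_nonneg _))
    nlinarith [h.w_le m j]
  have hl2v : l2 v ≤ c / 4 * l2 x := by
    have := l2_const_mul (c / 4) x
    rw [abs_of_nonneg (by positivity)] at this
    rw [← this]
    exact l2_mono hv4
  have hnv : ‖v‖ ≤ c / 4 * ‖x‖ := by
    refine (pi_norm_le_iff_of_nonneg (by positivity)).mpr fun j => ?_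
    refine (hv4 j).trans ?_
    rw [abs_mul, abs_of_nonneg (by positivity : 0 ≤ c / 4)]
    exact mul_le_mul_of_nonneg_left (abs_apply_le_norm x j) (by positivity)
  have hmean : |∑ j ∈ Finset.univ.erase m, v j| ≤ c * (S / 2) * l2 x := by
    set w' : V → ℝ := fun j => if j = m then 0 else w m j with hw'
    have e1 : |∑ j ∈ Finset.univ.erase m, v j| ≤ c * ∑ j, |w' j| * |x j| := by
      refine (Finset.abs_sum_le_sum_abs _ _).trans ?_
      rw [Finset.mul_sum, ← sum_erase_eq_of_diag m (f := fun j => c * (|w' j| * |x j|))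
        (by simp [hw'])]
      refine Finset.sum_le_sum fun j hj => ?_
      have hne := Finset.ne_of_mem_erase hj
      refine (hvx j).trans (le_of_eq ?_)
      simp only [hw', hne, if_false, abs_of_nonneg (hw0 m j)]
      ring
    have e2 : l2 w' ≤ S / 2 := by
      refine l2_le_of_sum_sq_le (by positivity) ?_
      rw [div_pow, hS2, ← sum_erase_eq_of_diag m (f := fun j => w' j ^ 2) (by simp [hw']), hW,
        Finset.sum_div]
      refine Finset.sum_le_sum fun j hj => ?_
      have hne := Finset.ne_of_mem_erase hj
      simp only [hw', hne, if_false]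
      nlinarith [h.w_le m j, hw0 m j]
    refine e1.trans ?_
    rw [mul_assoc]
    exact mul_le_mul_of_nonneg_left ((sum_abs_mul_abs_le_l2 _ _).trans
      (mul_le_mul_of_nonneg_right e2 (l2_nonneg _))) hc
  have hsum : |∑ j, a m j * v j| ≤ p * (c * (S / 2) * l2 x)
      + 10 * (A * b / sn * (c / 4 * l2 x) + b ^ 2 * (c / 4 * ‖x‖)) := by
    have e1 : ∑ j, a m j * v j = p * ∑ j ∈ Finset.univ.erase m, v j
        + ∑ j ∈ Finset.univ.erase m, (a m j - p) * v j := by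
      rw [← sum_erase_eq_of_diag m (f := fun j => a m j * v j) (by simp [h.a_diag m]),
        Finset.mul_sum, ← Finset.sum_add_distrib]
      exact Finset.sum_congr rfl fun j _ => by ring
    rw [e1]
    refine (abs_add_le _ _).trans (add_le_add ?_ (le_trans hrow ?_))
    · rw [abs_mul, abs_of_pos hp0]
      exact mul_le_mul_of_nonneg_left hmean hp0.le
    · gcongr
  have hD : p / 2 * S ^ 2 * |y| ≤ p * (c * (S / 2) * l2 x)
      + 10 * (A * b / sn * (c / 4 * l2 x) + b ^ 2 * (c / 4 * ‖x‖)) + R := by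
    refine le_trans ?_ (hy.trans (add_le_add_left hsum R))
    rw [hS2]
    exact mul_le_mul_of_nonneg_right (h.le_wdeg m) (abs_nonneg _)
  have hlx := l2_nonneg x
  have hdiv : |y| ≤ c * (l2 x / S) + 2 / (p * S ^ 2) *
      (10 * (A * b / sn * (c / 4 * l2 x) + b ^ 2 * (c / 4 * ‖x‖)) + R) := by
    have e1 : c * (l2 x / S) + 2 / (p * S ^ 2) *
      (10 * (A * b / sn * (c / 4 * l2 x) + b ^ 2 * (c / 4 * ‖x‖)) + R)
      = (p * (c * (S / 2) * l2 x)
      + 10 * (A * b / sn * (c / 4 * l2 x) + b ^ 2 * (c / 4 * ‖x‖)) + R) / (p / 2 * S ^ 2) := by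
      field_simp; ring
    rw [e1, le_div_iff₀ (by positivity)]
    linarith
  have hpS : 2 / (p * S ^ 2) ≤ 16 * (κ / A ^ 2) := by
    have e1 : A ^ 2 / (8 * κ) ≤ p * S ^ 2 := by
      rw [hS2, hp.p_eq]
      have := mul_le_mul_of_nonneg_left hWlow (by positivity : 0 ≤ A ^ 2 / sn ^ 2)
      refine le_trans (le_of_eq ?_) this
      field_simp
    calc 2 / (p * S ^ 2) ≤ 2 / (A ^ 2 / (8 * κ)) :=
          div_le_div_of_nonneg_left (by norm_num) (by positivity) e1
      _ = _ := by field_simp; norm_num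
  have hSinv : l2 x / S ≤ 3 * k * (l2 x / sn) := by
    calc l2 x / S ≤ l2 x / (sn / (3 * k)) :=
          div_le_div_of_nonneg_left hlx (by positivity) hSlow
      _ = _ := by field_simp
  have hs := hp.small₁
  have hs' : 10000 * (κ * b / A) ≤ 1 := by
    have : 0 ≤ κ * b / A := by positivity
    nlinarith
  have hlast : 16 * (κ / A ^ 2) * (10 * (A * b / sn * (c / 4 * l2 x)))
      ≤ c * k * (l2 x / sn) := by
    have e1 : 16 * (κ / A ^ 2) * (10 * (A * b / sn * (c / 4 * l2 x)))
        = 40 * (κ * b / A) * (c * (l2 x / sn)) := by field_simp; ring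
    rw [e1]
    have e2 : 0 ≤ c * (l2 x / sn) := by positivity
    calc _ ≤ k * (c * (l2 x / sn)) := mul_le_mul_of_nonneg_right (by linarith) e2
      _ = _ := by ring
  have hfin := mul_le_mul_of_nonneg_right hpS
    (by positivity : 0 ≤ 10 * (A * b / sn * (c / 4 * l2 x) + b ^ 2 * (c / 4 * ‖x‖)) + R)
  have hc3 := mul_le_mul_of_nonneg_left hSinv hc
  calc |y| ≤ c * (3 * k * (l2 x / sn)) + 16 * (κ / A ^ 2) *
      (10 * (A * b / sn * (c / 4 * l2 x) + b ^ 2 * (c / 4 * ‖x‖)) + R) := by linarith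
    _ = c * (3 * k * (l2 x / sn)) + 16 * (κ / A ^ 2) * (10 * (A * b / sn * (c / 4 * l2 x)))
        + 40 * c * (κ * b ^ 2 / A ^ 2) * ‖x‖ + 16 * (κ / A ^ 2) * R := by field_simp; ring
    _ ≤ _ := by linarith

end LeaveOneOut

/-! ### Sup-norm bounds for the solutions and for their difference -/

section SupNorm

variable {V : Type*} [Fintype V] {g κ p A b r sn : ℝ} {w a z : V → V → ℝ}
  {φ : V → V → ℝ → ℝ}

lemma norm_le_add_l2_sub (x y : V → ℝ) : ‖y‖ ≤ ‖x‖ + l2 (x - y) := by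
  have e2 := norm_sub_le x (x - y)
  rw [sub_sub_cancel] at e2
  linarith [norm_le_l2 (x - y)]

lemma l2_le_add_l2_sub (x y : V → ℝ) : l2 y ≤ l2 x + l2 (x - y) := by
  have e2 := l2_sub_le x (x - y)
  rwa [sub_sub_cancel] at e2

/-- The nonlinear and the linear solutions satisfy the same linear equation up to the quadratic
remainder of the link. -/
lemma flow_linear_sub {δ δb ξ : V → ℝ} (hδ : IsSol a φ ξ δ) (hδb : IsSol a (linearLink w) ξ δb)
    (i : V) : flow a (linearLink w) (δ - δb) i
      = -∑ j, a i j * (φ i j (δ i - δ j) - linearLink w i j (δ i - δ j)) := by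
  have e1 := hδ.2 i
  have e2 := hδb.2 i
  simp only [flow] at e1 e2 ⊢
  rw [← Finset.sum_neg_distrib]
  have : ∑ j, a i j * linearLink w i j ((δ - δb) i - (δ - δb) j)
      - ∑ j, -(a i j * (φ i j (δ i - δ j) - linearLink w i j (δ i - δ j)))
      = ∑ j, a i j * φ i j (δ i - δ j) - ∑ j, a i j * linearLink w i j (δb i - δb j) := by
    rw [← Finset.sum_sub_distrib, ← Finset.sum_sub_distrib]
    refine Finset.sum_congr rfl fun j _ => ?_
    simp only [linearLink, Pi.sub_apply]
    ring
  linarith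

variable [DecidableEq V]

/-- The Cauchy–Schwarz inequality for the sum over the neighbours of `m`. -/
lemma Regular.sum_row_mul_abs_le (hp : Admissible g κ p A b r sn)
    (h : Regular g κ p A b r sn a z w) (m : V) (x : V → ℝ) :
    ∑ j, a m j * |x j| ≤ 3 / 2 * A * l2 x := by
  refine le_trans (le_of_eq ?_) ((sum_abs_mul_abs_le_l2 (a m) x).trans
    (mul_le_mul_of_nonneg_right (h.l2_row_le hp m) (l2_nonneg _)))
  exact Finset.sum_congr rfl fun j _ => by rw [abs_of_nonneg (h.a_nonneg m j)]

/-- The mean term of `Regular.row_bound` is dominated by the Cauchy–Schwarz bound for the sum over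
the row, because `√κ ≤ κ` and `A ≤ sn`. -/
lemma Admissible.sqrt_div_le (hp : Admissible g κ p A b r sn) {T : ℝ} (hT : 0 ≤ T) :
    √κ * (T / sn) ≤ κ / A * T := by
  have h1 := hp.one_le_κ
  have h3 := hp.A_pos
  have e : √κ ≤ κ := Real.sqrt_le_iff.mpr ⟨by linarith, by nlinarith⟩
  calc √κ * (T / sn) ≤ κ * (T / A) :=
        mul_le_mul e (div_le_div_of_nonneg_left hT h3 hp.A_le) (by have := hp.sn_pos; positivity)
          (by linarith)
    _ = _ := by ring

/-- Sup-norm bound for the solution of the flow equation: in the equation of the row `m` the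
solution is replaced by the leave-one-out solution, which is independent of that row. -/
lemma Regular.norm_sol_le (hp : Admissible g κ p A b r sn) (h : Regular g κ p A b r sn a z w)
    (hφ : IsLink w φ) {δ : V → ℝ} {δ' : V → V → ℝ} (hδ : IsSol a φ (noise a z) δ)
    (hδ' : ∀ m, IsSol (looGraph p a m) φ (looNoise a z m) (δ' m))
    (hrow₁ : ∀ m, RowConcentrated p A b sn a m (fun j => φ m j (δ' m m - δ' m j)))
    (hrow₂ : ∀ m, RowConcentrated p A b sn a m (fun j => φ m j (-δ' m j))) :
    ‖δ‖ ≤ 2500 * g * (κ * √κ * r) := by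
  have h1 := hp.one_le_κ
  have h2 := hp.one_le_g
  have h3 := hp.A_pos
  have h4 := hp.r_pos
  have hsn := hp.sn_pos
  have hw0 := h.w_nonneg hp
  set k := √κ with hk
  have hk1 : 1 ≤ k := Real.one_le_sqrt.mpr h1
  set M := ‖δ‖ with hM
  have hM0 : 0 ≤ M := norm_nonneg _
  have hm : ∀ m, |δ m| ≤ 2300 * g * (κ * k * r) + 1 / 20 * M := by
    intro m
    set T := l2 (δ - δ' m) with hT
    have hT0 : 0 ≤ T := l2_nonneg _
    have hTle : T ≤ 126 * g * κ * r + 70 * g * (κ * b / A) * M :=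
      h.l2_sub_looSol_le hp hφ hδ (hδ' m) (hrow₁ m)
    have hl2 := h.l2_sol_le hp hφ hδ
    set D := ∑ j, a m j * w m j with hD
    have hD0 : 0 ≤ D := Finset.sum_nonneg fun j _ => mul_nonneg (h.a_nonneg m j) (hw0 m j)
    have hlow : D * |δ m / 3| ≤ |∑ j, a m j * (φ m j (δ m - δ' m j) - φ m j (-δ' m j))| := by
      rw [abs_div, abs_of_pos (by norm_num : (0 : ℝ) < 3)]
      rcases le_total 0 (δ m) with hs | hs
      · refine le_trans ?_ (le_abs_self _)
        rw [abs_of_nonneg hs, hD, Finset.sum_mul]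
        refine Finset.sum_le_sum fun j _ => ?_
        have := mul_le_mul_of_nonneg_left
          (hφ.lower m j (-δ' m j) (δ m - δ' m j) (by linarith)) (h.a_nonneg m j)
        refine le_trans (le_of_eq ?_) this
        ring
      · refine le_trans ?_ (neg_le_abs _)
        rw [abs_of_nonpos hs, hD, Finset.sum_mul, ← Finset.sum_neg_distrib]
        refine Finset.sum_le_sum fun j _ => ?_
        have := mul_le_mul_of_nonneg_left
          (hφ.lower m j (δ m - δ' m j) (-δ' m j) (by linarith)) (h.a_nonneg m j)
        refine le_trans (le_of_eq ?_) (this.trans (le_of_eq ?_))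
        · ring
        · ring
    have hsplit : ∑ j, a m j * (φ m j (δ m - δ' m j) - φ m j (-δ' m j))
        = noise a z m + ∑ j, a m j * (φ m j (δ m - δ' m j) - φ m j (δ m - δ j))
          - ∑ j, a m j * φ m j (-δ' m j) := by
      rw [← hδ.2 m, flow, ← Finset.sum_add_distrib, ← Finset.sum_sub_distrib]
      exact Finset.sum_congr rfl fun j _ => by ring
    have hpert : |∑ j, a m j * (φ m j (δ m - δ' m j) - φ m j (δ m - δ j))| ≤ 9 / 8 * A * T := by
      refine (Finset.abs_sum_le_sum_abs _ _).trans ?_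
      have e1 : ∑ j, |a m j * (φ m j (δ m - δ' m j) - φ m j (δ m - δ j))|
          ≤ ∑ j, 3 / 4 * (a m j * |(δ - δ' m) j|) := by
        refine Finset.sum_le_sum fun j _ => ?_
        rw [abs_mul, abs_of_nonneg (h.a_nonneg m j)]
        have e2 := hφ.abs_sub_le_of_le hw0 h.w_le m j (δ m - δ j) (δ m - δ' m j)
        have e3 : δ m - δ' m j - (δ m - δ j) = (δ - δ' m) j := by simp
        rw [e3] at e2
        have := mul_le_mul_of_nonneg_left e2 (h.a_nonneg m j)
        linarith
      refine e1.trans ?_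
      rw [← Finset.mul_sum]
      have := h.sum_row_mul_abs_le hp m (δ - δ' m)
      rw [← hT] at this
      linarith
    have hy : D * |δ m / 3| ≤ |∑ j, a m j * φ m j (-δ' m j)|
        + (25 * (A ^ 2 * r) + 9 / 8 * A * T) := by
      rw [hsplit] at hlow
      have e1 := abs_sub (noise a z m + ∑ j, a m j * (φ m j (δ m - δ' m j) - φ m j (δ m - δ j)))
        (∑ j, a m j * φ m j (-δ' m j))
      have e2 := abs_add_le (noise a z m)
        (∑ j, a m j * (φ m j (δ m - δ' m j) - φ m j (δ m - δ j)))
      linarith [h.abs_noise_le m]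
    have hrb := h.row_bound hp (c := 3) (x := δ' m) (by norm_num) (fun j => by
      simpa using hφ.abs_le hw0 m j (-δ' m j)) (hrow₂ m) hy (by positivity)
    rw [abs_div, abs_of_pos (by norm_num : (0 : ℝ) < 3), ← hk] at hrb
    have e1 : l2 (δ' m) / sn ≤ 25 * g * κ * r + T / sn := by
      have e0 := l2_le_add_l2_sub δ (δ' m)
      rw [div_le_iff₀ hsn, add_mul, div_mul_cancel₀ _ hsn.ne']
      linarith only [e0, hl2, hT]
    have e2 : k * (T / sn) ≤ κ / A * T := hp.sqrt_div_le hT0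
    have e3 : ‖δ' m‖ ≤ M + T := norm_le_add_l2_sub δ (δ' m)
    have hs1 : g * (κ * b / A) ≤ 1 / 10000 := by linarith [hp.small₁]
    have hs2 : κ / A ≤ 1 / 10000 := by
      have := hp.small₂
      have : 0 ≤ κ / A := by positivity
      nlinarith
    have hs3 : κ * b ^ 2 / A ^ 2 ≤ 1 / 10000 := by
      have := hp.small₃
      have : 0 ≤ κ * b ^ 2 / A ^ 2 := by positivity
      nlinarith
    have f1 : k * (l2 (δ' m) / sn) ≤ 25 * g * (κ * k * r) + 1 / 10000 * T := by
      calc _ ≤ k * (25 * g * κ * r + T / sn) := mul_le_mul_of_nonneg_left e1 (by linarith)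
        _ = 25 * g * (κ * k * r) + k * (T / sn) := by ring
        _ ≤ _ := by linarith [mul_le_mul_of_nonneg_right hs2 hT0]
    have f2 : κ * b ^ 2 / A ^ 2 * ‖δ' m‖ ≤ 1 / 10000 * (M + T) :=
      mul_le_mul hs3 e3 (norm_nonneg _) (by norm_num)
    have f3 : 16 * (κ / A ^ 2) * (25 * (A ^ 2 * r) + 9 / 8 * A * T)
        ≤ 400 * (κ * r) + 18 / 10000 * T := by
      have : 16 * (κ / A ^ 2) * (25 * (A ^ 2 * r) + 9 / 8 * A * T)
        = 400 * (κ * r) + 18 * (κ / A * T) := by field_simp; ring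
      rw [this]
      linarith [mul_le_mul_of_nonneg_right hs2 hT0]
    have f4 : κ * r ≤ g * (κ * k * r) := by
      have : 1 * 1 ≤ g * k := mul_le_mul h2 hk1 (by norm_num) (by linarith)
      have := mul_le_mul_of_nonneg_right this (by positivity : 0 ≤ κ * r)
      linarith only [this]
    have f5 : g * κ * r ≤ g * (κ * k * r) := by
      have := mul_le_mul_of_nonneg_right hk1 (by positivity : 0 ≤ g * κ * r)
      linarith only [this]
    have f6 : 70 * g * (κ * b / A) * M ≤ 70 * (1 / 10000) * M := by
      have := mul_le_mul_of_nonneg_right hs1 hM0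
      linarith only [this]
    linarith only [hrb, f1, f2, f3, f4, f5, f6, hTle, hM0, hT0]
  have : M ≤ 2300 * g * (κ * k * r) + 1 / 20 * M :=
    (pi_norm_le_iff_of_nonneg (by positivity)).mpr hm
  linarith [(by positivity : 0 ≤ g * (κ * k * r))]

/-- Schur's test for the graph. -/
lemma Regular.l2_sum_row_le (h : Regular g κ p A b r sn a z w) (x : V → ℝ) :
    l2 (fun i => ∑ j, a i j * x j) ≤ 2 * A ^ 2 * l2 x := by
  have hl := l2_nonneg x
  refine l2_le_of_sum_sq_le (by positivity) ?_
  have e1 : ∀ i, (∑ j, a i j * x j) ^ 2 ≤ 2 * A ^ 2 * ∑ j, a i j * x j ^ 2 := fun i => by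
    have := Finset.sum_mul_sq_le_sq_mul_sq Finset.univ (fun j => √(a i j))
      (fun j => √(a i j) * x j)
    have e2 : ∀ j, √(a i j) * (√(a i j) * x j) = a i j * x j := fun j => by
      rw [← mul_assoc, Real.mul_self_sqrt (h.a_nonneg i j)]
    have e3 : ∀ j, (√(a i j) * x j) ^ 2 = a i j * x j ^ 2 := fun j => by
      rw [mul_pow, Real.sq_sqrt (h.a_nonneg i j)]
    simp only [e2, e3, Real.sq_sqrt (h.a_nonneg i _)] at this
    refine this.trans (mul_le_mul_of_nonneg_right (h.deg_le i) ?_)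
    exact Finset.sum_nonneg fun j _ => mul_nonneg (h.a_nonneg i j) (sq_nonneg _)
  calc ∑ i, (∑ j, a i j * x j) ^ 2 ≤ ∑ i, 2 * A ^ 2 * ∑ j, a i j * x j ^ 2 :=
        Finset.sum_le_sum fun i _ => e1 i
    _ = 2 * A ^ 2 * ∑ j, (∑ i, a j i) * x j ^ 2 := by
        rw [← Finset.mul_sum, Finset.sum_comm]
        congr 1
        refine Finset.sum_congr rfl fun j _ => ?_
        rw [Finset.sum_mul]
        exact Finset.sum_congr rfl fun i _ => by rw [h.gap.symm i j]
    _ ≤ 2 * A ^ 2 * ∑ j, 2 * A ^ 2 * x j ^ 2 := by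
        refine mul_le_mul_of_nonneg_left (Finset.sum_le_sum fun j _ => ?_) (by positivity)
        exact mul_le_mul_of_nonneg_right (h.deg_le j) (sq_nonneg _)
    _ = _ := by rw [← Finset.mul_sum, ← l2_sq]; ring

/-- Euclidean bound for the difference of the nonlinear and the linear solution. -/
lemma Regular.l2_sub_linear_le (hp : Admissible g κ p A b r sn)
    (h : Regular g κ p A b r sn a z w)
    (hquad : ∀ i j t, |φ i j t - linearLink w i j t| ≤ 2 * w i j * t ^ 2) {δ δb : V → ℝ}
    (hδ : IsSol a φ (noise a z) δ) (hδb : IsSol a (linearLink w) (noise a z) δb) :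
    l2 (δ - δb) ≤ 4 * g * κ * (‖δ‖ * l2 δ) := by
  have h1 := hp.one_le_κ
  have h2 := hp.one_le_g
  have h3 := hp.A_pos
  have hw0 := h.w_nonneg hp
  have hlin := isLink_linearLink hw0 h.w_symm
  have hst := h.l2_sub_le hp hlin (δ := δ - δb) (δ' := 0) (by simp [hδ.1, hδb.1]) (by simp)
  have e0 : flow a (linearLink w) 0 = 0 := by funext i; simp [flow, linearLink]
  rw [e0, sub_zero, sub_zero] at hst
  set M := ‖δ‖ with hM
  have hterm : ∀ i j, |φ i j (δ i - δ j) - linearLink w i j (δ i - δ j)|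
      ≤ M * (|δ i| + |δ j|) := fun i j => by
    refine (hquad i j _).trans ?_
    have e1 := abs_sub (δ i) (δ j)
    have e2 := abs_apply_le_norm δ i
    have e3 := abs_apply_le_norm δ j
    rw [← sq_abs]
    have e4 : |δ i - δ j| ^ 2 ≤ (2 * M) * (|δ i| + |δ j|) := by
      rw [sq]
      exact mul_le_mul (by linarith) e1 (abs_nonneg _) (by positivity)
    have e5 := mul_le_mul (by linarith [h.w_le i j] : 2 * w i j ≤ 1 / 2) e4 (sq_nonneg _)
      (by norm_num)
    linarith
  have hflow : l2 (flow a (linearLink w) (δ - δb)) ≤ M * (4 * A ^ 2 * l2 δ) := by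
    set f₁ : V → ℝ := fun i => 2 * A ^ 2 * |δ i| with hf₁
    set f₂ : V → ℝ := fun i => ∑ j, a i j * |δ j| with hf₂
    have hf₂0 : ∀ i, 0 ≤ f₂ i := fun i =>
      Finset.sum_nonneg fun j _ => mul_nonneg (h.a_nonneg i j) (abs_nonneg _)
    have e1 : l2 (flow a (linearLink w) (δ - δb)) ≤ l2 (fun i => M * (f₁ + f₂) i) := by
      refine l2_mono fun i => ?_
      rw [flow_linear_sub hδ hδb, abs_neg]
      refine le_trans ?_ (le_abs_self _)
      refine (Finset.abs_sum_le_sum_abs _ _).trans ?_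
      calc _ ≤ ∑ j, a i j * (M * (|δ i| + |δ j|)) := by
            refine Finset.sum_le_sum fun j _ => ?_
            rw [abs_mul, abs_of_nonneg (h.a_nonneg i j)]
            exact mul_le_mul_of_nonneg_left (hterm i j) (h.a_nonneg i j)
        _ = M * ((∑ j, a i j) * |δ i| + f₂ i) := by
            rw [hf₂, Finset.sum_mul, ← Finset.sum_add_distrib, Finset.mul_sum]
            exact Finset.sum_congr rfl fun j _ => by ring
        _ ≤ _ := by
            refine mul_le_mul_of_nonneg_left ?_ (norm_nonneg _)
            simp only [Pi.add_apply, hf₁]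
            have := mul_le_mul_of_nonneg_right (h.deg_le i) (abs_nonneg (δ i))
            linarith
    rw [l2_const_mul, abs_of_nonneg (norm_nonneg _)] at e1
    refine e1.trans (mul_le_mul_of_nonneg_left ?_ (norm_nonneg _))
    refine (l2_add_le _ _).trans ?_
    have e2 : l2 f₁ = 2 * A ^ 2 * l2 δ := by
      rw [hf₁, l2_const_mul, l2_abs, abs_of_pos (by positivity)]
    have e3 : l2 f₂ ≤ 2 * A ^ 2 * l2 δ := by
      have := h.l2_sum_row_le (fun j => |δ j|)
      rwa [l2_abs] at this
    linarith
  refine hst.trans ((mul_le_mul_of_nonneg_left hflow (by positivity)).trans (le_of_eq ?_))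
  field_simp

/-- Sup-norm bound for the difference of the nonlinear and the linear solution, in terms of the
sizes of both solutions and of their leave-one-out perturbations. -/
lemma Regular.abs_sub_linear_le (hp : Admissible g κ p A b r sn)
    (h : Regular g κ p A b r sn a z w)
    (hquad : ∀ i j t, |φ i j t - linearLink w i j t| ≤ 2 * w i j * t ^ 2) {δ δb x y : V → ℝ}
    (hδ : IsSol a φ (noise a z) δ) (hδb : IsSol a (linearLink w) (noise a z) δb) (m : V)
    (hrow : RowConcentrated p A b sn a m (fun j => w m j * (x - y) j)) :
    |δ m - δb m| ≤ 8 * ‖δ‖ ^ 2 + 4 * √κ * (l2 (δ - δb) / sn)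
      + 11 * (κ / A) * (l2 (δ - x) + l2 (δb - y))
      + 40 * (κ * b ^ 2 / A ^ 2) * (‖δ‖ + ‖δb‖ + (l2 (δ - x) + l2 (δb - y))) := by
  have h1 := hp.one_le_κ
  have h3 := hp.A_pos
  have hsn := hp.sn_pos
  have hw0 := h.w_nonneg hp
  set T := l2 (δ - x) + l2 (δb - y) with hT
  have hT0 : 0 ≤ T := add_nonneg (l2_nonneg _) (l2_nonneg _)
  set M := ‖δ‖ with hM
  have hM0 : 0 ≤ M := norm_nonneg _
  set u := δ - δb with hu
  set u' := x - y with hu'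
  have huu : l2 (u - u') ≤ T := by
    have : u - u' = (δ - x) - (δb - y) := by rw [hu, hu']; abel
    rw [this]
    exact CARE.l2_sub_le _ _
  set D := ∑ j, a m j * w m j with hD
  have hD0 : 0 ≤ D := Finset.sum_nonneg fun j _ => mul_nonneg (h.a_nonneg m j) (hw0 m j)
  have heq : D * u m = ∑ j, a m j * (w m j * u' j) + ∑ j, a m j * (w m j * (u - u') j)
      - ∑ j, a m j * (φ m j (δ m - δ j) - linearLink w m j (δ m - δ j)) := by
    have e1 := flow_linear_sub hδ hδb m
    rw [← hu] at e1
    have e2 : flow a (linearLink w) u m = D * u m - (∑ j, a m j * (w m j * u' j)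
        + ∑ j, a m j * (w m j * (u - u') j)) := by
      rw [flow, hD, Finset.sum_mul, ← Finset.sum_add_distrib, ← Finset.sum_sub_distrib]
      refine Finset.sum_congr rfl fun j _ => ?_
      simp only [linearLink, Pi.sub_apply]
      ring
    linarith
  have hrem : |∑ j, a m j * (φ m j (δ m - δ j) - linearLink w m j (δ m - δ j))|
      ≤ D * (8 * M ^ 2) := by
    refine (Finset.abs_sum_le_sum_abs _ _).trans ?_
    rw [hD, Finset.sum_mul]
    refine Finset.sum_le_sum fun j _ => ?_
    rw [abs_mul, abs_of_nonneg (h.a_nonneg m j), mul_assoc]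
    refine mul_le_mul_of_nonneg_left ((hquad m j _).trans ?_) (h.a_nonneg m j)
    have e1 := abs_sub (δ m) (δ j)
    have e2 := abs_apply_le_norm δ m
    have e3 := abs_apply_le_norm δ j
    have e4 : (δ m - δ j) ^ 2 ≤ (2 * M) ^ 2 := by
      rw [← sq_abs]
      exact pow_le_pow_left₀ (abs_nonneg _) (by linarith) 2
    have := mul_le_mul_of_nonneg_left e4 (by linarith [hw0 m j] : 0 ≤ 2 * w m j)
    linarith
  have hpert : |∑ j, a m j * (w m j * (u - u') j)| ≤ 2 / 5 * A * T := by
    refine (Finset.abs_sum_le_sum_abs _ _).trans ?_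
    calc _ ≤ ∑ j, 1 / 4 * (a m j * |(u - u') j|) := by
          refine Finset.sum_le_sum fun j _ => ?_
          rw [abs_mul, abs_of_nonneg (h.a_nonneg m j), abs_mul, abs_of_nonneg (hw0 m j)]
          have := mul_le_mul_of_nonneg_right (h.w_le m j) (abs_nonneg ((u - u') j))
          have := mul_le_mul_of_nonneg_left this (h.a_nonneg m j)
          linarith
      _ ≤ _ := by
          rw [← Finset.mul_sum]
          have e1 := h.sum_row_mul_abs_le hp m (u - u')
          have e2 := mul_le_mul_of_nonneg_left huu (by positivity : 0 ≤ 3 / 2 * A)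
          nlinarith [mul_nonneg h3.le hT0]
  have hy : D * |max (|u m| - 8 * M ^ 2) 0| ≤ |∑ j, a m j * (w m j * u' j)| + 2 / 5 * A * T := by
    rw [abs_of_nonneg (le_max_right _ _), mul_max_of_nonneg _ _ hD0, mul_zero]
    refine max_le ?_ (by positivity)
    have e1 : D * |u m| ≤ |∑ j, a m j * (w m j * u' j)| + 2 / 5 * A * T + D * (8 * M ^ 2) := by
      rw [← abs_of_nonneg hD0, ← abs_mul, heq, abs_of_nonneg hD0]
      refine (abs_sub _ _).trans (add_le_add ((abs_add_le _ _).trans ?_) hrem)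
      exact add_le_add le_rfl hpert
    linarith
  have hrb := h.row_bound hp (c := 1) (x := u') (by norm_num) (fun j => by
    rw [abs_mul, abs_of_nonneg (hw0 m j), one_mul]) hrow hy (by positivity)
  have hle : |u m| - 8 * M ^ 2 ≤ |max (|u m| - 8 * M ^ 2) 0| :=
    (le_max_left _ _).trans (le_abs_self _)
  have e1 : √κ * (l2 u' / sn) ≤ √κ * (l2 u / sn) + κ / A * T := by
    have e2 : l2 u' / sn ≤ l2 u / sn + T / sn := by
      rw [← add_div]
      refine div_le_div_of_nonneg_right ?_ hsn.le
      linarith [l2_le_add_l2_sub u u']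
    have e3 := hp.sqrt_div_le hT0
    have := mul_le_mul_of_nonneg_left e2 (Real.sqrt_nonneg κ)
    linarith
  have e2 : ‖u'‖ ≤ M + ‖δb‖ + T := by
    have e6 := norm_le_add_l2_sub u u'
    have e7 := norm_sub_le δ δb
    linarith only [e6, e7, huu]
  have e3 := mul_le_mul_of_nonneg_left e2 (by positivity : 0 ≤ 40 * (κ * b ^ 2 / A ^ 2))
  have e4 : 16 * (κ / A ^ 2) * (2 / 5 * A * T) ≤ 7 * (κ / A * T) := by
    have : 16 * (κ / A ^ 2) * (2 / 5 * A * T) = 32 / 5 * (κ / A * T) := by field_simp; ring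
    rw [this]
    linarith [(by positivity : 0 ≤ κ / A * T)]
  have e5 : u m = δ m - δb m := rfl
  rw [← e5]
  linarith only [hrb, hle, e1, e3, e4]

/-- The row bounds needed for the leave-one-out solutions of the link `φ`, of the linear link, and
for their difference. -/
structure LooConcentrated (p A b sn : ℝ) (a w : V → V → ℝ) (φ : V → V → ℝ → ℝ) (δ' δb' : V → ℝ)
    (m : V) : Prop where
  diff : RowConcentrated p A b sn a m (fun j => φ m j (δ' m - δ' j))
  neg : RowConcentrated p A b sn a m (fun j => φ m j (-δ' j))
  diff_linear : RowConcentrated p A b sn a m (fun j => linearLink w m j (δb' m - δb' j))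
  neg_linear : RowConcentrated p A b sn a m (fun j => linearLink w m j (-δb' j))
  sub : RowConcentrated p A b sn a m (fun j => w m j * (δ' - δb') j)

/-- The solution of the nonlinear equation is small, and its distance to the solution of the
linearized equation is of second order, in the Euclidean and in the sup norm. -/
lemma Regular.newton_error (hp : Admissible g κ p A b r sn) (h : Regular g κ p A b r sn a z w)
    (hφ : IsLink w φ)
    (hquad : ∀ i j t, |φ i j t - linearLink w i j t| ≤ 2 * w i j * t ^ 2) {δ δb : V → ℝ}
    {δ' δb' : V → V → ℝ}
    (hδ : IsSol a φ (noise a z) δ) (hδb : IsSol a (linearLink w) (noise a z) δb)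
    (hδ' : ∀ m, IsSol (looGraph p a m) φ (looNoise a z m) (δ' m))
    (hδb' : ∀ m, IsSol (looGraph p a m) (linearLink w) (looNoise a z m) (δb' m))
    (hrow : ∀ m, LooConcentrated p A b sn a w φ (δ' m) (δb' m) m) :
    ‖δ‖ ≤ 2500 * g * (κ * √κ * r) ∧
    l2 (δ - δb) ≤ 10 ^ 8 * g ^ 3 * (κ ^ 4 * r ^ 2 * sn) ∧
    ‖δ - δb‖ ≤ 10 ^ 8 * g ^ 3 * (κ ^ 4 * (r ^ 2 + r / A + r * b ^ 2 / A ^ 2)) := by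
  have h1 := hp.one_le_κ
  have h2 := hp.one_le_g
  have h3 := hp.A_pos
  have h4 := hp.r_pos
  have hb := hp.b_ge
  have hsn := hp.sn_pos
  have hw0 := h.w_nonneg hp
  have hlin := isLink_linearLink hw0 h.w_symm
  set k := √κ with hk
  have hk1 : 1 ≤ k := Real.one_le_sqrt.mpr h1
  have hk2 : k ^ 2 = κ := Real.sq_sqrt (by linarith)
  have hkκ : k ≤ κ := by nlinarith
  set m₀ := 2500 * g * (κ * k * r) with hm₀
  have hm₀0 : 0 ≤ m₀ := by positivity
  have hM : ‖δ‖ ≤ m₀ := h.norm_sol_le hp hφ hδ hδ' (fun m => (hrow m).diff) (fun m => (hrow m).neg)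
  have hMb : ‖δb‖ ≤ m₀ := h.norm_sol_le hp hlin hδb hδb' (fun m => (hrow m).diff_linear)
    (fun m => (hrow m).neg_linear)
  have hl2u : l2 (δ - δb) ≤ 250000 * g ^ 3 * (κ ^ 3 * k * r ^ 2 * sn) := by
    refine (h.l2_sub_linear_le hp hquad hδ hδb).trans ?_
    have := mul_le_mul hM (h.l2_sol_le hp hφ hδ) (l2_nonneg _) hm₀0
    refine (mul_le_mul_of_nonneg_left this (by positivity)).trans (le_of_eq ?_)
    rw [hm₀]; ring
  refine ⟨hM, hl2u.trans ?_, ?_⟩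
  · have e1 : κ ^ 3 * k * r ^ 2 * sn ≤ κ ^ 4 * r ^ 2 * sn := by
      have := mul_le_mul_of_nonneg_left hkκ (by positivity : 0 ≤ κ ^ 3 * r ^ 2 * sn)
      nlinarith
    calc _ ≤ 250000 * g ^ 3 * (κ ^ 4 * r ^ 2 * sn) := mul_le_mul_of_nonneg_left e1 (by positivity)
      _ ≤ _ := mul_le_mul_of_nonneg_right (by nlinarith [pow_pos (by linarith : 0 < g) 3])
        (by positivity)
  · refine (pi_norm_le_iff_of_nonneg (by positivity)).mpr fun m => ?_
    have hmain := h.abs_sub_linear_le hp hquad hδ hδb m (hrow m).sub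
    set T := l2 (δ - δ' m) + l2 (δb - δb' m) with hT
    have hT0 : 0 ≤ T := add_nonneg (l2_nonneg _) (l2_nonneg _)
    have hs1 : g * (κ * b / A) ≤ 1 / 10000 := by linarith [hp.small₁]
    have hTle : T ≤ 252 * g * κ * r + 140 * g * (κ * b / A) * m₀ := by
      have e1 := h.l2_sub_looSol_le hp hφ hδ (hδ' m) (hrow m).diff
      have e2 := h.l2_sub_looSol_le hp hlin hδb (hδb' m) (hrow m).diff_linear
      have e0 : 0 ≤ 70 * g * (κ * b / A) := by positivity
      have e3 := mul_le_mul_of_nonneg_left hM e0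
      have e4 := mul_le_mul_of_nonneg_left hMb e0
      linarith
    -- Every term is compared with one of `κ⁴ r²`, `κ⁴ r / A` and `κ⁴ r b² / A²`.
    set X := κ ^ 4 * r ^ 2 with hX
    set Y := κ ^ 4 * (r / A) with hY
    set Z := κ ^ 4 * (r * b ^ 2 / A ^ 2) with hZ
    have hX0 : 0 ≤ X := by positivity
    have hY0 : 0 ≤ Y := by positivity
    have hZ0 : 0 ≤ Z := by positivity
    have hg1 : g ≤ g ^ 3 := by
      simpa using pow_le_pow_right₀ h2 (by norm_num : 1 ≤ 3)
    have hg2 : g ^ 2 ≤ g ^ 3 := pow_le_pow_right₀ h2 (by norm_num)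
    have hκ34 : κ ^ 3 ≤ κ ^ 4 := pow_le_pow_right₀ h1 (by norm_num)
    have hκ24 : κ ^ 2 ≤ κ ^ 4 := pow_le_pow_right₀ h1 (by norm_num)
    have hkκ3 : κ ^ 3 * k ≤ κ ^ 4 := by
      have := mul_le_mul_of_nonneg_left hkκ (by positivity : 0 ≤ κ ^ 3)
      linarith only [this]
    have hkκ2 : κ ^ 2 * k ≤ κ ^ 4 := by
      have := mul_le_mul_of_nonneg_left hkκ (by positivity : 0 ≤ κ ^ 2)
      linarith only [this, hκ34]
    have t1 : 8 * ‖δ‖ ^ 2 ≤ 5 * 10 ^ 7 * g ^ 3 * X := by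
      have e1 : ‖δ‖ ^ 2 ≤ m₀ ^ 2 := pow_le_pow_left₀ (norm_nonneg _) hM 2
      have e2 : m₀ ^ 2 = 6250000 * g ^ 2 * (κ ^ 3 * r ^ 2) := by
        rw [hm₀]
        calc (2500 * g * (κ * k * r)) ^ 2 = 6250000 * g ^ 2 * (κ ^ 2 * k ^ 2 * r ^ 2) := by ring
          _ = _ := by rw [hk2]; ring
      have e3 : κ ^ 3 * r ^ 2 ≤ X := mul_le_mul_of_nonneg_right hκ34 (sq_nonneg _)
      have e4 : g ^ 2 * (κ ^ 3 * r ^ 2) ≤ g ^ 3 * X :=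
        mul_le_mul hg2 e3 (by positivity) (by positivity)
      linarith only [e1, e2, e4]
    have t2 : 4 * k * (l2 (δ - δb) / sn) ≤ 10 ^ 6 * g ^ 3 * X := by
      have e1 : l2 (δ - δb) / sn ≤ 250000 * g ^ 3 * (κ ^ 3 * k * r ^ 2) := by
        rw [div_le_iff₀ hsn]
        linarith only [hl2u]
      have e2 := mul_le_mul_of_nonneg_left e1 (by positivity : 0 ≤ 4 * k)
      refine e2.trans (le_of_eq ?_)
      calc 4 * k * (250000 * g ^ 3 * (κ ^ 3 * k * r ^ 2))
          = 10 ^ 6 * g ^ 3 * (κ ^ 3 * k ^ 2 * r ^ 2) := by ring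
        _ = _ := by rw [hk2, hX]; ring
    have t3 : κ / A * T ≤ 252 * g ^ 3 * Y + 525000 * g ^ 3 * Z := by
      have e1 := mul_le_mul_of_nonneg_left hTle (by positivity : 0 ≤ κ / A)
      have e2 : κ / A * (252 * g * κ * r + 140 * g * (κ * b / A) * m₀)
          = 252 * g * (κ ^ 2 * (r / A)) + 350000 * g ^ 2 * (κ ^ 3 * k * (r * b / A ^ 2)) := by
        rw [hm₀]; field_simp; ring
      have e3 : g * (κ ^ 2 * (r / A)) ≤ g ^ 3 * Y :=
        mul_le_mul hg1 (mul_le_mul_of_nonneg_right hκ24 (by positivity)) (by positivity)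
          (by positivity)
      have e4 : r * b / A ^ 2 ≤ 3 / 2 * (r * b ^ 2 / A ^ 2) := by
        have : b ≤ 3 / 2 * b ^ 2 := by nlinarith
        calc r * b / A ^ 2 ≤ r * (3 / 2 * b ^ 2) / A ^ 2 := by gcongr
          _ = _ := by ring
      have e5 : κ ^ 3 * k * (r * b / A ^ 2) ≤ 3 / 2 * Z := by
        calc _ ≤ κ ^ 4 * (3 / 2 * (r * b ^ 2 / A ^ 2)) :=
              mul_le_mul hkκ3 e4 (by positivity) (by positivity)
          _ = _ := by rw [hZ]; ring
      have e6 : g ^ 2 * (κ ^ 3 * k * (r * b / A ^ 2)) ≤ g ^ 3 * (3 / 2 * Z) :=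
        mul_le_mul hg2 e5 (by positivity) (by positivity)
      linarith only [e1, e2, e3, e6]
    have t4 : κ * b ^ 2 / A ^ 2 * (‖δ‖ + ‖δb‖ + T) ≤ 6000 * g ^ 3 * Z := by
      have e1 : ‖δ‖ + ‖δb‖ + T ≤ 5400 * g * (κ * k * r) := by
        have e2 : 140 * g * (κ * b / A) * m₀ ≤ 140 * (1 / 10000) * m₀ := by
          have := mul_le_mul_of_nonneg_right hs1 hm₀0
          linarith only [this]
        have e3 : g * κ * r ≤ g * (κ * k * r) := by
          have := mul_le_mul_of_nonneg_right hk1 (by positivity : 0 ≤ g * κ * r)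
          linarith only [this]
        have e4 : 0 ≤ g * (κ * k * r) := by positivity
        linarith only [hM, hMb, hTle, e2, e3, e4, hm₀]
      have e2 := mul_le_mul_of_nonneg_left e1 (by positivity : 0 ≤ κ * b ^ 2 / A ^ 2)
      have e3 : κ * b ^ 2 / A ^ 2 * (5400 * g * (κ * k * r))
          = 5400 * (g * (κ ^ 2 * k * (r * b ^ 2 / A ^ 2))) := by ring
      have e4 : g * (κ ^ 2 * k * (r * b ^ 2 / A ^ 2)) ≤ g ^ 3 * Z :=
        mul_le_mul hg1 (mul_le_mul_of_nonneg_right hkκ2 (by positivity)) (by positivity)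
          (by positivity)
      linarith only [e2, e3, e4, (by positivity : 0 ≤ g ^ 3 * Z)]
    have hfin : 10 ^ 8 * g ^ 3 * (κ ^ 4 * (r ^ 2 + r / A + r * b ^ 2 / A ^ 2))
        = 10 ^ 8 * (g ^ 3 * X) + 10 ^ 8 * (g ^ 3 * Y) + 10 ^ 8 * (g ^ 3 * Z) := by
      rw [hX, hY, hZ]; ring
    have hgX : 0 ≤ g ^ 3 * X := by positivity
    have hgY : 0 ≤ g ^ 3 * Y := by positivity
    have hgZ : 0 ≤ g ^ 3 * Z := by positivity
    rw [hfin, Real.norm_eq_abs, Pi.sub_apply]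
    linarith only [hmain, t1, t2, t3, t4, hgX, hgY, hgZ]

end SupNorm

/-! ### Concentration for independent Boolean variables, conditionally on the other variables -/

section Concentration

variable {Ω : Type*} [MeasurableSpace Ω] {P : Measure Ω} [IsProbabilityMeasure P]

/-- The indicator of `true`, as a real number. -/
def boolVal (b : Bool) : ℝ := if b then 1 else 0

lemma boolVal_nonneg (b : Bool) : 0 ≤ boolVal b := by unfold boolVal; split_ifs <;> norm_num

lemma boolVal_le_one (b : Bool) : boolVal b ≤ 1 := by unfold boolVal; split_ifs <;> norm_num

lemma measurable_boolVal : Measurable boolVal := measurable_from_top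

/-- The variance proxy is twice the success probability, hence of the order `p` for sparse
variables, where Hoeffding's lemma would give a constant. -/
lemma mgf_bool_le {X : Ω → Bool} (hX : Measurable X) {t : ℝ} (ht : |t| ≤ 1) :
    mgf (fun ω => boolVal (X ω) - P.real {ω | X ω = true}) P t
      ≤ Real.exp (t ^ 2 * P.real {ω | X ω = true}) := by
  set μ := P.real {ω | X ω = true} with hμ
  have hμ0 : 0 ≤ μ := measureReal_nonneg
  have hμ1 : μ ≤ 1 := measureReal_le_one
  have hms : MeasurableSet {ω | X ω = true} := hX (measurableSet_singleton true)
  have e1 : mgf (fun ω => boolVal (X ω) - μ) P t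
      = Real.exp (-(t * μ)) + (Real.exp (t * (1 - μ)) - Real.exp (-(t * μ))) * μ := by
    have : ∀ ω, Real.exp (t * (boolVal (X ω) - μ)) = Real.exp (-(t * μ))
        + {ω | X ω = true}.indicator (fun _ => Real.exp (t * (1 - μ)) - Real.exp (-(t * μ))) ω := by
      intro ω
      by_cases h : X ω = true
      · simp [boolVal, h]
      · simp [boolVal, h]
    simp only [mgf, this]
    rw [integral_add (integrable_const _) ((integrable_const _).indicator hms),
      integral_indicator_const _ hms]
    simp [← hμ, mul_comm]
  have habs : |t| * μ ≤ 1 := mul_le_one₀ ht hμ0 hμ1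
  have e2 := abs_le.mp (Real.abs_exp_sub_one_sub_id_le (x := -(t * μ)) (by
    rw [abs_neg, abs_mul, abs_of_nonneg hμ0]; exact habs))
  have e3 := abs_le.mp (Real.abs_exp_sub_one_sub_id_le (x := t * (1 - μ)) (by
    rw [abs_mul, abs_of_nonneg (by linarith : 0 ≤ 1 - μ)]
    exact mul_le_one₀ ht (by linarith) (by linarith)))
  rw [e1]
  have e4 : Real.exp (-(t * μ)) + (Real.exp (t * (1 - μ)) - Real.exp (-(t * μ))) * μ
      ≤ 1 + t ^ 2 * (μ * (1 - μ)) := by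
    have f1 := mul_le_mul_of_nonneg_left e2.2 (by linarith : 0 ≤ 1 - μ)
    have f2 := mul_le_mul_of_nonneg_left e3.2 hμ0
    nlinarith
  have e5 := Real.add_one_le_exp (t ^ 2 * μ)
  nlinarith [mul_nonneg (sq_nonneg t) (sq_nonneg μ)]

variable {J : Type*} [Fintype J]

/-- One-sided Chernoff bound for weighted sums of independent centred Boolean variables. -/
lemma chernoff_bool {X : J → Ω → Bool} (hind : iIndepFun X P) (hX : ∀ j, Measurable (X j))
    (c : J → ℝ) {v lam t : ℝ} (hlam : 0 ≤ lam) (hc : ∀ j, lam * |c j| ≤ 1)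
    (hv : ∀ j, P.real {ω | X j ω = true} ≤ v) :
    P.real {ω | t ≤ ∑ j, c j * (boolVal (X j ω) - P.real {ω | X j ω = true})}
      ≤ Real.exp (-lam * t + lam ^ 2 * v * ∑ j, c j ^ 2) := by
  set Z : J → Ω → ℝ := fun j ω => c j * (boolVal (X j ω) - P.real {ω | X j ω = true}) with hZ
  have hZm : ∀ j, Measurable (Z j) := fun j =>
    ((measurable_boolVal.comp (hX j)).sub_const _).const_mul _
  have hZi : iIndepFun Z P := hind.comp
    (fun j b => c j * (boolVal b - P.real {ω | X j ω = true})) (fun j => measurable_from_top)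
  have hbd : ∀ ω, |∑ j, Z j ω| ≤ ∑ j, |c j| := fun ω => by
    refine (Finset.abs_sum_le_sum_abs _ _).trans (Finset.sum_le_sum fun j _ => ?_)
    simp only [hZ, abs_mul]
    refine mul_le_of_le_one_right (abs_nonneg _) (abs_le.mpr ⟨?_, ?_⟩)
    · linarith [boolVal_nonneg (X j ω), measureReal_le_one (μ := P) (s := {ω | X j ω = true})]
    · linarith [boolVal_le_one (X j ω), measureReal_nonneg (μ := P) (s := {ω | X j ω = true})]
  have hsm : Measurable (fun ω => ∑ j, Z j ω) := Finset.measurable_sum _ fun j _ => hZm j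
  have hint : Integrable (fun ω => Real.exp (lam * ∑ j, Z j ω)) P := by
    refine integrable_exp_mul_of_mem_Icc (a := -∑ j, |c j|) (b := ∑ j, |c j|) hsm.aemeasurable ?_
    exact ae_of_all _ fun ω => abs_le.mp (hbd ω)
  have h1 := measure_ge_le_exp_mul_mgf (X := fun ω => ∑ j, Z j ω) t hlam hint
  refine h1.trans ?_
  have h2 : mgf (fun ω => ∑ j, Z j ω) P lam = ∏ j, mgf (Z j) P lam := by
    have := hZi.mgf_sum (t := lam) hZm Finset.univ
    rw [← this]
    congr 1
    funext ω
    simp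
  rw [h2, Real.exp_add]
  refine mul_le_mul_of_nonneg_left ?_ (Real.exp_pos _).le
  rw [Finset.mul_sum, Real.exp_sum]
  refine Finset.prod_le_prod (fun j _ => mgf_nonneg) fun j _ => ?_
  have h3 : mgf (Z j) P lam
      = mgf (fun ω => boolVal (X j ω) - P.real {ω | X j ω = true}) P (c j * lam) :=
    mgf_const_mul (c j)
  rw [h3]
  refine (mgf_bool_le (hX j) ?_).trans (Real.exp_le_exp.mpr ?_)
  · rw [abs_mul, abs_of_nonneg hlam, mul_comm]; exact hc j
  · have := mul_le_mul_of_nonneg_left (hv j) (sq_nonneg (c j * lam))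
    linarith

/-- Bernstein's inequality, with deviations on the scale of `ℓ` standard deviations and an
exceptional probability `2 exp (-9 ℓ)`. -/
lemma bernstein_bool {X : J → Ω → Bool} (hind : iIndepFun X P) (hX : ∀ j, Measurable (X j))
    (c : J → ℝ) {v ℓ : ℝ} (hℓ : 0 < ℓ) (hv0 : 0 ≤ v) (hv : ∀ j, P.real {ω | X j ω = true} ≤ v) :
    P.real {ω | 10 * (√(v * ℓ) * l2 c + ℓ * ‖c‖)
        < |∑ j, c j * (boolVal (X j ω) - P.real {ω | X j ω = true})|}
      ≤ 2 * Real.exp (-9 * ℓ) := by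
  set τ := √(v / ℓ) * l2 c + ‖c‖ with hτ
  have hl := l2_nonneg c
  have hτ0 : 0 ≤ τ := by positivity
  have hτℓ : ℓ * τ = √(v * ℓ) * l2 c + ℓ * ‖c‖ := by
    have : √(v * ℓ) = ℓ * √(v / ℓ) := by
      rw [← Real.sqrt_sq hℓ.le, ← Real.sqrt_mul (sq_nonneg _), Real.sqrt_sq hℓ.le]
      congr 1; field_simp
    rw [hτ, this]; ring
  rw [← hτℓ]
  rcases hτ0.eq_or_lt with h0 | hpos
  · have hc0 : ‖c‖ = 0 := by
      have : 0 ≤ √(v / ℓ) * l2 c := by positivity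
      linarith [norm_nonneg c]
    have hc : c = 0 := norm_eq_zero.mp hc0
    simp only [← h0, hc]
    simp only [Pi.zero_apply, zero_mul, Finset.sum_const_zero, abs_zero, mul_zero, lt_self_iff_false,
      Set.ofPred_false, measureReal_empty]
    positivity
  · have key : ∀ d : J → ℝ, (∀ j, |d j| = |c j|) →
        P.real {ω | 10 * (ℓ * τ) ≤ ∑ j, d j * (boolVal (X j ω) - P.real {ω | X j ω = true})}
          ≤ Real.exp (-9 * ℓ) := by
      intro d hd
      refine (chernoff_bool hind hX d (lam := 1 / τ) (by positivity) (fun j => ?_) hv).trans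
        (Real.exp_le_exp.mpr ?_)
      · rw [one_div, inv_mul_le_iff₀ hpos, mul_one, hd, hτ]
        have := abs_apply_le_norm c j
        have : 0 ≤ √(v / ℓ) * l2 c := by positivity
        linarith
      · have e1 : ∑ j, d j ^ 2 = l2 c ^ 2 := by
          rw [l2_sq]; exact Finset.sum_congr rfl fun j _ => by rw [← sq_abs, hd, sq_abs]
        have e2 : v / ℓ * l2 c ^ 2 ≤ τ ^ 2 := by
          have : (√(v / ℓ) * l2 c) ^ 2 ≤ τ ^ 2 :=
            pow_le_pow_left₀ (by positivity) (by rw [hτ]; linarith [norm_nonneg c]) 2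
          rwa [mul_pow, Real.sq_sqrt (by positivity)] at this
        have e3 : (1 / τ) ^ 2 * v * l2 c ^ 2 ≤ ℓ := by
          have : (1 / τ) ^ 2 * v * l2 c ^ 2 = ℓ * ((v / ℓ * l2 c ^ 2) / τ ^ 2) := by
            field_simp
          rw [this]
          exact mul_le_of_le_one_right hℓ.le ((div_le_one (by positivity)).mpr e2)
        have e4 : -(1 / τ) * (10 * (ℓ * τ)) = -10 * ℓ := by field_simp
        rw [e1, e4]
        linarith
    have hsub : {ω | 10 * (ℓ * τ) < |∑ j, c j * (boolVal (X j ω) - P.real {ω | X j ω = true})|}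
        ⊆ {ω | 10 * (ℓ * τ) ≤ ∑ j, c j * (boolVal (X j ω) - P.real {ω | X j ω = true})}
        ∪ {ω | 10 * (ℓ * τ) ≤ ∑ j, (-c) j * (boolVal (X j ω) - P.real {ω | X j ω = true})} := by
      intro ω hω
      rw [Set.mem_ofPred_eq] at hω
      rcases lt_abs.mp hω with h | h
      · exact Or.inl h.le
      · refine Or.inr ?_
        simp only [Set.mem_ofPred_eq, Pi.neg_apply, neg_mul, Finset.sum_neg_distrib]
        exact h.le
    refine (measureReal_mono hsub).trans ((measureReal_union_le _ _).trans ?_)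
    linarith [key c fun _ => rfl, key (-c) fun j => by simp]

variable {ι : Type*} [Fintype ι] [DecidableEq ι]

/-- Freezing: an event that depends on the variables in `S` (second argument) and on those
outside of `S` (first argument) is as unlikely as it is with the latter fixed. -/
lemma measureReal_le_of_frozen {X : ι → Ω → Bool} (hind : iIndepFun X P)
    (hX : ∀ k, Measurable (X k)) (S : Finset ι) (bad : (ι → Bool) → (ι → Bool) → Prop)
    (hdep₁ : ∀ z z' x, (∀ k ∉ S, z k = z' k) → (bad z x ↔ bad z' x))
    (hdep₂ : ∀ z x x', (∀ k ∈ S, x k = x' k) → (bad z x ↔ bad z x')) {ε : ℝ}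
    (hε : ∀ z, P.real {ω | bad z (fun k => X k ω)} ≤ ε) :
    P.real {ω | bad (fun k => X k ω) (fun k => X k ω)} ≤ ε := by
  set F : Ω → (S → Bool) := fun ω k => X k ω with hF
  set G : Ω → ((Sᶜ : Finset ι) → Bool) := fun ω k => X k ω with hG
  have hFm : Measurable F := measurable_pi_lambda _ fun k => hX k
  have hGm : Measurable G := measurable_pi_lambda _ fun k => hX k
  have hFG : IndepFun F G P := hind.indepFun_finset S Sᶜ disjoint_compl_right hX
  set ext : ((Sᶜ : Finset ι) → Bool) → ι → Bool := fun z k =>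
    if h : k ∈ Sᶜ then z ⟨k, h⟩ else false with hext
  set ext' : (S → Bool) → ι → Bool := fun x k => if h : k ∈ S then x ⟨k, h⟩ else false with hext'
  have hpiece : ∀ z, {ω | bad (fun k => X k ω) (fun k => X k ω)} ∩ G ⁻¹' {z}
      = F ⁻¹' {x | bad (ext z) (ext' x)} ∩ G ⁻¹' {z} := by
    intro z
    ext ω
    simp only [Set.mem_inter_iff, Set.mem_ofPred_eq, Set.mem_preimage, Set.mem_singleton_iff,
      and_congr_left_iff]
    intro hz
    rw [hdep₁ (fun k => X k ω) (ext z) _ (fun k hk => by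
        simp [hext, ← hz, hG, hk]),
      hdep₂ (ext z) (fun k => X k ω) (ext' (F ω)) (fun k hk => by simp [hext', hF, hk])]
  have hF' : ∀ z, F ⁻¹' {x | bad (ext z) (ext' x)} = {ω | bad (ext z) (fun k => X k ω)} := by
    intro z
    ext ω
    simp only [Set.mem_ofPred_eq, Set.mem_preimage]
    exact hdep₂ (ext z) _ _ (fun k hk => by simp [hext', hF, hk])
  have hsum : ∑ z, P.real (G ⁻¹' {z}) = 1 := by
    rw [sum_measureReal_preimage_singleton (μ := P) Finset.univ
        (f := G) (fun z _ => hGm (measurableSet_singleton z))]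
    simp
  have hcover : {ω | bad (fun k => X k ω) (fun k => X k ω)}
      ⊆ ⋃ z ∈ (Finset.univ : Finset ((Sᶜ : Finset ι) → Bool)),
        ({ω | bad (fun k => X k ω) (fun k => X k ω)} ∩ G ⁻¹' {z}) := by
    intro ω hω
    simp only [Finset.mem_univ, Set.iUnion_true, Set.mem_iUnion]
    exact ⟨G ω, hω, rfl⟩
  calc P.real {ω | bad (fun k => X k ω) (fun k => X k ω)}
      ≤ ∑ z, P.real ({ω | bad (fun k => X k ω) (fun k => X k ω)} ∩ G ⁻¹' {z}) :=
        (measureReal_mono hcover (measure_ne_top P _)).trans (measureReal_biUnion_finset_le _ _)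
    _ = ∑ z, P.real {ω | bad (ext z) (fun k => X k ω)} * P.real (G ⁻¹' {z}) := by
        refine Finset.sum_congr rfl fun z _ => ?_
        rw [hpiece z, ← hF' z]
        simp only [measureReal_def]
        rw [hFG.measure_inter_preimage_eq_mul _ _ (MeasurableSet.of_discrete)
          (measurableSet_singleton z), ENNReal.toReal_mul]
    _ ≤ ∑ z, ε * P.real (G ⁻¹' {z}) := Finset.sum_le_sum fun z _ =>
        mul_le_mul_of_nonneg_right (hε _) measureReal_nonneg
    _ = ε := by rw [← Finset.mul_sum, hsum, mul_one]

/-- Bernstein's inequality conditionally on the variables that are not summed: the coefficients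
may depend on them. -/
lemma bernstein_frozen {X : ι → Ω → Bool} (hind : iIndepFun X P) (hX : ∀ k, Measurable (X k))
    {idx : J → ι} (hidx : Function.Injective idx) (c : (ι → Bool) → J → ℝ)
    (hc : ∀ z z', (∀ k, (∀ j, k ≠ idx j) → z k = z' k) → c z = c z') {v ℓ : ℝ} (hℓ : 0 < ℓ)
    (hv0 : 0 ≤ v) (hv : ∀ j, P.real {ω | X (idx j) ω = true} ≤ v) :
    P.real {ω | 10 * (√(v * ℓ) * l2 (c fun k => X k ω) + ℓ * ‖c fun k => X k ω‖)
        < |∑ j, c (fun k => X k ω) j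
          * (boolVal (X (idx j) ω) - P.real {ω | X (idx j) ω = true})|}
      ≤ 2 * Real.exp (-9 * ℓ) := by
  refine measureReal_le_of_frozen hind hX (Finset.univ.image idx)
    (fun z x => 10 * (√(v * ℓ) * l2 (c z) + ℓ * ‖c z‖)
      < |∑ j, c z j * (boolVal (x (idx j)) - P.real {ω | X (idx j) ω = true})|) ?_ ?_ ?_
  · intro z z' x hz
    have : c z = c z' := hc z z' fun k hk => hz k (by
      simp only [Finset.mem_image, Finset.mem_univ, true_and, not_exists]
      exact fun j hj => hk j hj.symm)
    rw [this]
  · intro z x x' hx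
    have : ∀ j, x (idx j) = x' (idx j) := fun j => hx _ (Finset.mem_image_of_mem _ (Finset.mem_univ j))
    simp only [this]
  · intro z
    exact bernstein_bool (hind.precomp hidx) (fun j => hX _) (c z) hℓ hv0 hv

end Concentration

/-! ### Typical configurations of the comparison graph and of the outcomes -/

section Configurations

variable {n L : ℕ}

/-- The index set of all the random variables: one edge indicator for each pair, and `L` outcomes
for each pair. -/
abbrev Idx (n L : ℕ) : Type := Pair n ⊕ (Pair n × Fin L)

/-- The pair formed by two distinct items, in either order. -/
def pairOf (i j : Fin n) (h : i ≠ j) : Pair n :=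
  if hji : j < i then ⟨(i, j), hji⟩ else ⟨(j, i), lt_of_le_of_ne (not_lt.mp hji) h⟩

lemma pairOf_of_lt {i j : Fin n} (h : j < i) : pairOf i j h.ne' = ⟨(i, j), h⟩ := dif_pos h

lemma pairOf_comm (i j : Fin n) (h : i ≠ j) : pairOf i j h = pairOf j i h.symm := by
  rcases lt_or_gt_of_ne h with hij | hij
  · rw [pairOf_of_lt hij, pairOf, dif_neg hij.not_gt]
  · rw [pairOf_of_lt hij, pairOf, dif_neg hij.not_gt]

lemma pairOf_eq {i j i' j' : Fin n} {h : i ≠ j} {h' : i' ≠ j'} (he : pairOf i j h = pairOf i' j' h') :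
    (i = i' ∧ j = j') ∨ (i = j' ∧ j = i') := by
  unfold pairOf at he
  split_ifs at he <;> simp only [Subtype.mk.injEq, Prod.mk.injEq] at he <;> tauto

/-- The edge indicator of two items, as a real number. -/
def adj (z : Idx n L → Bool) (i j : Fin n) : ℝ :=
  if h : i = j then 0 else boolVal (z (Sum.inl (pairOf i j h)))

/-- The sign that turns an outcome of the pair of `i` and `j` into an outcome in favour of `i`. -/
def orient (i j : Fin n) : ℝ := if j < i then 1 else -1

/-- The centred mean outcome of a pair under the scores `s`. -/
def pairDev (s : Fin n → ℝ) (z : Idx n L → Bool) (q : Pair n) : ℝ :=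
  meanOutcome (fun q l => z (Sum.inr (q, l))) q - Real.sigmoid (s q.1.1 - s q.1.2)

/-- The centred mean outcome of the comparisons of `i` with `j`, in favour of `i`. -/
def dev (s : Fin n → ℝ) (z : Idx n L → Bool) (i j : Fin n) : ℝ :=
  if h : i = j then 0 else orient i j * pairDev s z (pairOf i j h)

lemma abs_orient (i j : Fin n) : |orient i j| = 1 := by unfold orient; split_ifs <;> simp

lemma orient_symm {i j : Fin n} (h : i ≠ j) : orient j i = -orient i j := by
  unfold orient
  rcases lt_or_gt_of_ne h with hij | hij <;> simp [hij, hij.not_gt]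

lemma adj_self (z : Idx n L → Bool) (i : Fin n) : adj z i i = 0 := by simp [adj]

lemma adj_of_ne (z : Idx n L → Bool) {i j : Fin n} (h : i ≠ j) :
    adj z i j = boolVal (z (Sum.inl (pairOf i j h))) := dif_neg h

lemma adj_nonneg (z : Idx n L → Bool) (i j : Fin n) : 0 ≤ adj z i j := by
  unfold adj; split_ifs
  · exact le_rfl
  · exact boolVal_nonneg _

lemma adj_le_one (z : Idx n L → Bool) (i j : Fin n) : adj z i j ≤ 1 := by
  unfold adj; split_ifs
  · exact zero_le_one
  · exact boolVal_le_one _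

lemma adj_symm (z : Idx n L → Bool) (i j : Fin n) : adj z i j = adj z j i := by
  by_cases h : i = j
  · rw [h]
  · rw [adj_of_ne z h, adj_of_ne z (Ne.symm h), pairOf_comm]

lemma dev_symm (s : Fin n → ℝ) (z : Idx n L → Bool) (i j : Fin n) : dev s z j i = -dev s z i j := by
  by_cases h : i = j
  · subst h; simp [dev]
  · rw [dev, dev, dif_neg h, dif_neg (Ne.symm h), orient_symm h, pairOf_comm i j]; ring

lemma meanOutcome_eq (y : Pair n → Fin L → Bool) (q : Pair n) :
    meanOutcome y q = ∑ l, (1 / (L : ℝ)) * boolVal (y q l) := by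
  rw [meanOutcome, Finset.sum_div]
  exact Finset.sum_congr rfl fun l _ => by rw [boolVal]; ring

lemma pairDev_eq_sum (hL : 1 ≤ L) (s : Fin n → ℝ) (z : Idx n L → Bool) (q : Pair n) :
    pairDev s z q = ∑ l, (1 / (L : ℝ)) *
      (boolVal (z (Sum.inr (q, l))) - Real.sigmoid (s q.1.1 - s q.1.2)) := by
  have hL' : (L : ℝ) ≠ 0 := by positivity
  rw [pairDev, meanOutcome_eq]
  simp only [mul_sub, Finset.sum_sub_distrib, Finset.sum_const, Finset.card_univ, Fintype.card_fin,
    nsmul_eq_mul]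
  field_simp

lemma abs_pairDev_le_one (hL : 1 ≤ L) (s : Fin n → ℝ) (z : Idx n L → Bool) (q : Pair n) :
    |pairDev s z q| ≤ 1 := by
  have hL' : (0 : ℝ) < L := by positivity
  rw [pairDev_eq_sum hL]
  refine (Finset.abs_sum_le_sum_abs _ _).trans ?_
  calc _ ≤ ∑ _l : Fin L, 1 / (L : ℝ) := by
        refine Finset.sum_le_sum fun l _ => ?_
        rw [abs_mul, abs_of_pos (by positivity : 0 < 1 / (L : ℝ))]
        refine mul_le_of_le_one_right (by positivity) (abs_le.mpr ⟨?_, ?_⟩)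
        · linarith [boolVal_nonneg (z (Sum.inr (q, l))), Real.sigmoid_le_one (s q.1.1 - s q.1.2)]
        · linarith [boolVal_le_one (z (Sum.inr (q, l))), Real.sigmoid_nonneg (s q.1.1 - s q.1.2)]
    _ = 1 := by simp; field_simp

/-- Two configurations agree off the row `m` if they differ at most in the edges at `m`. -/
def AgreeOffRow (m : Fin n) (z z' : Idx n L → Bool) : Prop :=
  ∀ k, (∀ (j : Fin n) (h : m ≠ j), k ≠ Sum.inl (pairOf m j h)) → z k = z' k

lemma AgreeOffRow.adj_eq {m : Fin n} {z z' : Idx n L → Bool} (h : AgreeOffRow m z z')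
    {i j : Fin n} (hi : i ≠ m) (hj : j ≠ m) : adj z i j = adj z' i j := by
  by_cases hij : i = j
  · simp [adj, hij]
  · rw [adj_of_ne z hij, adj_of_ne z' hij, h]
    intro j' hj' he
    rcases pairOf_eq (Sum.inl_injective he) with h' | h'
    · exact hi h'.1
    · exact hj h'.2

lemma AgreeOffRow.looGraph_eq {m : Fin n} {z z' : Idx n L → Bool} (h : AgreeOffRow m z z') (p : ℝ) :
    looGraph p (adj z) m = looGraph p (adj z') m := by
  funext i j
  unfold looGraph
  split_ifs with h1 h2
  · rfl
  · rfl
  · push Not at h2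
    exact h.adj_eq h2.1 h2.2

lemma AgreeOffRow.dev_eq {m : Fin n} {z z' : Idx n L → Bool} (h : AgreeOffRow m z z')
    (s : Fin n → ℝ) : dev s z = dev s z' := by
  have : (fun (q : Pair n) l => z (Sum.inr (q, l))) = fun q l => z' (Sum.inr (q, l)) := by
    funext q l
    exact h _ fun j hj => Sum.inr_ne_inl
  funext i j
  simp only [dev, pairDev, this]

lemma AgreeOffRow.looNoise_eq {m : Fin n} {z z' : Idx n L → Bool} (h : AgreeOffRow m z z')
    (s : Fin n → ℝ) : looNoise (adj z) (dev s z) m = looNoise (adj z') (dev s z') m := by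
  funext i
  unfold looNoise
  refine Finset.sum_congr rfl fun j _ => ?_
  split_ifs with h2
  · rfl
  · push Not at h2
    rw [h.adj_eq h2.1 h2.2, h.dev_eq]

/-- The leave-one-out solution of a configuration. -/
def looSol (p : ℝ) (s : Fin n → ℝ) (φ : Fin n → Fin n → ℝ → ℝ) (z : Idx n L → Bool) (m : Fin n) :
    Fin n → ℝ :=
  sol (looGraph p (adj z) m) φ (looNoise (adj z) (dev s z) m)

lemma AgreeOffRow.looSol_eq {m : Fin n} {z z' : Idx n L → Bool} (h : AgreeOffRow m z z') (p : ℝ)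
    (s : Fin n → ℝ) (φ : Fin n → Fin n → ℝ → ℝ) : looSol p s φ z m = looSol p s φ z' m := by
  rw [looSol, looSol, h.looGraph_eq, h.looNoise_eq]

/-- The configurations with the typical behaviour of degrees, noises, cuts and leave-one-out
fluctuations. -/
structure GoodConfig (p A b sn : ℝ) (s : Fin n → ℝ) (z : Idx n L → Bool) : Prop where
  row_one : ∀ m, RowConcentrated p A b sn (adj z) m (fun _ => 1)
  row_weight : ∀ m, RowConcentrated p A b sn (adj z) m
    (fun j => if j = m then 0 else logisticWeight s m j)
  row_loo : ∀ m, LooConcentrated p A b sn (adj z) (logisticWeight s) (logisticLink s)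
    (looSol p s (logisticLink s) z m) (looSol p s (linearLink (logisticWeight s)) z m) m
  noise_le : ∀ m, |noise (adj z) (dev s z) m|
    ≤ 10 * (b * (√(∑ j, adj z m j) / √L) + b ^ 2 * (1 / L))
  pairDev_le : ∀ q, |pairDev s z q| ≤ 10 * (b * (1 / √L) + b ^ 2 * (1 / L))
  cut_le : ∀ (m : Fin n) (S : Finset (Fin n)), 2 * S.card ≤ n →
    p / 2 * (S.card * (insert m S)ᶜ.card) ≤ ∑ i ∈ S, ∑ j ∈ (insert m S)ᶜ, adj z i j

end Configurations

/-! ### Typical configurations have overwhelming probability -/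

section Typical

variable {n d L : ℕ} {Ω : Type*} [MeasurableSpace Ω] {P : Measure Ω}
  {x : Fin n → EuclideanSpace ℝ (Fin d)} {bstar : Param n d} {p A b sn : ℝ}
  {E : Pair n → Ω → Bool} {Y : Pair n → Fin L → Ω → Bool}

/-- The configuration of a sample point. -/
def config (E : Pair n → Ω → Bool) (Y : Pair n → Fin L → Ω → Bool) (ω : Ω) : Idx n L → Bool :=
  fun k => Sum.elim E (fun r : Pair n × Fin L => Y r.1 r.2) k ω

lemma IsSample.measurable (hS : IsSample P x bstar p E Y) (k : Idx n L) :
    Measurable (Sum.elim E (fun r : Pair n × Fin L => Y r.1 r.2) k) := by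
  cases k with
  | inl q => exact hS.measurable_edge q
  | inr r => exact hS.measurable_outcome r.1 r.2

lemma IsSample.prob_inr (hS : IsSample P x bstar p E Y) (q : Pair n) (l : Fin L) :
    P.real {ω | Sum.elim E (fun r : Pair n × Fin L => Y r.1 r.2) (Sum.inr (q, l)) ω = true}
      = Real.sigmoid (score x bstar q.1.1 - score x bstar q.1.2) := by
  have := hS.prob_outcome q l
  simp only [Sum.elim_inr]
  rw [this, Real.sigmoid_def, neg_sub, Real.exp_sub]
  have h1 := Real.exp_pos (score x bstar q.1.1)
  have h2 := Real.exp_pos (score x bstar q.1.2)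
  field_simp

variable [IsProbabilityMeasure P]

/-- The sum over the row `m` of the graph is concentrated, for coefficients that do not depend on
that row. -/
lemma IsSample.prob_row (hS : IsSample P x bstar p E Y) (hA : 0 < A) (hb : 0 < b) (hsn : 0 < sn)
    (hp : p = A ^ 2 / sn ^ 2) (m : Fin n) (v : (Idx n L → Bool) → Fin n → ℝ)
    (hv : ∀ z z', AgreeOffRow m z z' → v z = v z') :
    P.real {ω | ¬RowConcentrated p A b sn (adj (config E Y ω)) m (v (config E Y ω))}
      ≤ 2 * Real.exp (-9 * b ^ 2) := by
  have hp0 : 0 ≤ p := by rw [hp]; positivity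
  have hne : ∀ j : ↥(Finset.univ.erase m), m ≠ j := fun j => (Finset.ne_of_mem_erase j.2).symm
  set idx : ↥(Finset.univ.erase m) → Idx n L := fun j => Sum.inl (pairOf m j (hne j)) with hidx
  have hinj : Function.Injective idx := by
    intro j j' h
    rcases pairOf_eq (Sum.inl_injective h) with h' | h'
    · exact Subtype.ext h'.2
    · exact absurd h'.1 (hne j')
  have hB := bernstein_frozen hS.indep hS.measurable hinj (fun z j => v z j)
    (fun z z' h => by
      have := hv z z' fun k hk => h k fun j => hk j (hne j)
      rw [this]) (v := p) (ℓ := b ^ 2) (by positivity) hp0 (fun j => (hS.prob_edge _).le)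
  refine (measureReal_mono ?_).trans hB
  intro ω hω
  rw [Set.mem_ofPred_eq, RowConcentrated, not_le] at hω
  rw [Set.mem_ofPred_eq]
  change _ * (√(p * b ^ 2) * l2 (fun j : ↥(Finset.univ.erase m) => v (config E Y ω) j)
    + b ^ 2 * ‖fun j : ↥(Finset.univ.erase m) => v (config E Y ω) j‖) < _
  set u := v (config E Y ω) with hu
  have e1 : √(p * b ^ 2) = A * b / sn := by
    rw [hp, ← div_pow, ← mul_pow, Real.sqrt_sq (by positivity)]
    ring
  have e2 : l2 (fun j : ↥(Finset.univ.erase m) => u j) ≤ l2 u := by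
    refine l2_le_of_sum_sq_le (l2_nonneg _) ?_
    rw [l2_sq, Finset.sum_coe_sort (Finset.univ.erase m) (fun j => u j ^ 2)]
    exact Finset.sum_le_sum_of_subset_of_nonneg (Finset.subset_univ _) fun _ _ _ => sq_nonneg _
  have e3 : ‖fun j : ↥(Finset.univ.erase m) => u j‖ ≤ ‖u‖ :=
    (pi_norm_le_iff_of_nonneg (norm_nonneg _)).mpr fun j => norm_le_pi_norm u j
  have e4 : ∑ j : ↥(Finset.univ.erase m), u j
      * (boolVal (Sum.elim E (fun r : Pair n × Fin L => Y r.1 r.2) (idx j) ω)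
        - P.real {ω | Sum.elim E (fun r : Pair n × Fin L => Y r.1 r.2) (idx j) ω = true})
      = ∑ j ∈ Finset.univ.erase m, (adj (config E Y ω) m j - p) * u j := by
    rw [← Finset.sum_coe_sort (Finset.univ.erase m) (fun j => (adj (config E Y ω) m j - p) * u j)]
    refine Finset.sum_congr rfl fun j _ => ?_
    rw [adj_of_ne _ (hne j)]
    have : P.real {ω | Sum.elim E (fun r : Pair n × Fin L => Y r.1 r.2) (idx j) ω = true} = p :=
      hS.prob_edge _
    rw [this, mul_comm]
    rfl
  rw [e1]
  change _ < |∑ j : ↥(Finset.univ.erase m), u j * _|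
  rw [e4]
  refine lt_of_le_of_lt ?_ hω
  gcongr

/-- The mean outcome of a pair is close to its expectation. -/
lemma IsSample.prob_pairDev (hS : IsSample P x bstar p E Y) (hL : 1 ≤ L) (hb : 0 < b)
    (q : Pair n) :
    P.real {ω | ¬|pairDev (score x bstar) (config E Y ω) q|
      ≤ 10 * (b * (1 / √L) + b ^ 2 * (1 / L))} ≤ 2 * Real.exp (-9 * b ^ 2) := by
  have hL' : (0 : ℝ) < L := by positivity
  have hinj : Function.Injective (fun l : Fin L => (Sum.inr (q, l) : Idx n L)) := by
    intro l l' h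
    exact (Prod.mk.inj (Sum.inr_injective h)).2
  have hB := bernstein_frozen hS.indep hS.measurable hinj (fun _ _ => 1 / (L : ℝ))
    (fun z z' h => rfl) (v := 1) (ℓ := b ^ 2) (by positivity) zero_le_one
    (fun j => measureReal_le_one)
  refine (measureReal_mono ?_).trans hB
  intro ω hω
  rw [Set.mem_ofPred_eq, not_le] at hω
  rw [Set.mem_ofPred_eq]
  have e1 : l2 (fun _ : Fin L => 1 / (L : ℝ)) ≤ 1 / √L := by
    refine l2_le_of_sum_sq_le (by positivity) ?_
    rw [Finset.sum_const, Finset.card_univ, Fintype.card_fin, nsmul_eq_mul, div_pow, div_pow,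
      Real.sq_sqrt hL'.le]
    apply le_of_eq; field_simp
  have e2 : ‖fun _ : Fin L => 1 / (L : ℝ)‖ ≤ 1 / L :=
    (pi_norm_le_iff_of_nonneg (by positivity)).mpr fun l => by
      rw [Real.norm_eq_abs, abs_of_pos (by positivity)]
  have e3 : √(1 * b ^ 2) = b := by rw [one_mul, Real.sqrt_sq hb.le]
  rw [e3]
  simp only [hS.prob_inr]
  rw [pairDev_eq_sum hL] at hω
  refine lt_of_le_of_lt ?_ hω
  gcongr

/-- The net noise at a vertex, given the graph. -/
lemma IsSample.prob_noise (hS : IsSample P x bstar p E Y) (hL : 1 ≤ L) (hb : 0 < b) (m : Fin n) :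
    P.real {ω | ¬|noise (adj (config E Y ω)) (dev (score x bstar) (config E Y ω)) m|
      ≤ 10 * (b * (√(∑ j, adj (config E Y ω) m j) / √L) + b ^ 2 * (1 / L))}
      ≤ 2 * Real.exp (-9 * b ^ 2) := by
  have hL' : (0 : ℝ) < L := by positivity
  have hne : ∀ j : ↥(Finset.univ.erase m), m ≠ j := fun j => (Finset.ne_of_mem_erase j.2).symm
  set idx : ↥(Finset.univ.erase m) × Fin L → Idx n L :=
    fun r => Sum.inr (pairOf m r.1 (hne r.1), r.2) with hidx
  have hinj : Function.Injective idx := by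
    intro r r' h
    obtain ⟨h1, h2⟩ := Prod.mk.inj (Sum.inr_injective h)
    rcases pairOf_eq h1 with h' | h'
    · exact Prod.ext (Subtype.ext h'.2) h2
    · exact absurd h'.1 (hne r'.1)
  have hB := bernstein_frozen hS.indep hS.measurable hinj
    (fun z r => adj z m r.1 * orient m r.1 * (1 / (L : ℝ)))
    (fun z z' h => by
      funext r
      rw [adj_of_ne z (hne r.1), adj_of_ne z' (hne r.1), h _ fun j => Sum.inl_ne_inr])
    (v := 1) (ℓ := b ^ 2) (by positivity) zero_le_one (fun j => measureReal_le_one)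
  refine (measureReal_mono ?_).trans hB
  intro ω hω
  rw [Set.mem_ofPred_eq, not_le] at hω
  rw [Set.mem_ofPred_eq]
  set z := config E Y ω with hz
  change _ * (√(1 * b ^ 2) * l2 (fun r : ↥(Finset.univ.erase m) × Fin L =>
      adj z m r.1 * orient m r.1 * (1 / (L : ℝ)))
    + b ^ 2 * ‖fun r : ↥(Finset.univ.erase m) × Fin L =>
      adj z m r.1 * orient m r.1 * (1 / (L : ℝ))‖)
    < |∑ r : ↥(Finset.univ.erase m) × Fin L, adj z m r.1 * orient m r.1 * (1 / (L : ℝ)) * _|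
  have hdeg0 : 0 ≤ ∑ j, adj z m j := Finset.sum_nonneg fun j _ => adj_nonneg z m j
  have e1 : l2 (fun r : ↥(Finset.univ.erase m) × Fin L =>
      adj z m r.1 * orient m r.1 * (1 / (L : ℝ))) ≤ √(∑ j, adj z m j) / √L := by
    refine l2_le_of_sum_sq_le (by positivity) ?_
    rw [div_pow, Real.sq_sqrt hdeg0, Real.sq_sqrt hL'.le, Fintype.sum_prod_type]
    have f1 : ∀ j : ↥(Finset.univ.erase m), ∑ _l : Fin L,
        (adj z m j * orient m j * (1 / (L : ℝ))) ^ 2 ≤ adj z m j / L := fun j => by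
      rw [Finset.sum_const, Finset.card_univ, Fintype.card_fin, nsmul_eq_mul, mul_pow, mul_pow,
        ← sq_abs (orient m j), abs_orient]
      have : (L : ℝ) * (adj z m j ^ 2 * 1 ^ 2 * (1 / L) ^ 2) = adj z m j ^ 2 / L := by
        field_simp
      rw [this]
      refine div_le_div_of_nonneg_right ?_ hL'.le
      nlinarith [adj_nonneg z m j, adj_le_one z m j]
    refine (Finset.sum_le_sum fun j _ => f1 j).trans ?_
    rw [← Finset.sum_div, Finset.sum_coe_sort (Finset.univ.erase m) (fun j => adj z m j),
      sum_erase_eq_of_diag m (f := fun j => adj z m j) (adj_self z m)]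
  have e2 : ‖fun r : ↥(Finset.univ.erase m) × Fin L =>
      adj z m r.1 * orient m r.1 * (1 / (L : ℝ))‖ ≤ 1 / L :=
    (pi_norm_le_iff_of_nonneg (by positivity)).mpr fun r => by
      rw [Real.norm_eq_abs, abs_mul, abs_mul, abs_orient, abs_of_nonneg (adj_nonneg z _ _), mul_one,
        abs_of_pos (by positivity : 0 < 1 / (L : ℝ))]
      exact mul_le_of_le_one_left (by positivity) (adj_le_one z _ _)
  have e3 : √(1 * b ^ 2) = b := by rw [one_mul, Real.sqrt_sq hb.le]
  have e4 : noise (adj z) (dev (score x bstar) z) m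
      = ∑ r : ↥(Finset.univ.erase m) × Fin L, adj z m r.1 * orient m r.1 * (1 / (L : ℝ))
        * (boolVal (Sum.elim E (fun r : Pair n × Fin L => Y r.1 r.2) (idx r) ω)
          - P.real {ω | Sum.elim E (fun r : Pair n × Fin L => Y r.1 r.2) (idx r) ω = true}) := by
    rw [noise, ← sum_erase_eq_of_diag m
      (f := fun j => adj z m j * dev (score x bstar) z m j) (by simp [adj_self]),
      Fintype.sum_prod_type, ← Finset.sum_coe_sort]
    refine Finset.sum_congr rfl fun j _ => ?_
    rw [dev, dif_neg (hne j), pairDev_eq_sum hL, Finset.mul_sum, Finset.mul_sum]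
    refine Finset.sum_congr rfl fun l _ => ?_
    rw [hidx]
    simp only [hS.prob_inr]
    rw [hz, config]
    ring
  rw [e3]
  rw [e4] at hω
  refine lt_of_le_of_lt ?_ hω
  gcongr

/-- Every cut is large, up to a probability that beats the number of cuts. -/
lemma IsSample.prob_cut (hS : IsSample P x bstar p E Y) (hsn : 0 < sn) (hn : sn ^ 2 = n)
    (hp : p = A ^ 2 / sn ^ 2) (hAb : 512 * b ^ 2 ≤ A ^ 2) (hn4 : 4 ≤ n) (m : Fin n)
    (S : Finset (Fin n)) (hcard : 2 * S.card ≤ n) :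
    P.real {ω | ¬p / 2 * (S.card * (insert m S)ᶜ.card)
      ≤ ∑ i ∈ S, ∑ j ∈ (insert m S)ᶜ, adj (config E Y ω) i j} ≤ Real.exp (-8 * b ^ 2) ^ S.card := by
  have hp0 : 0 ≤ p := by rw [hp]; positivity
  set T := (insert m S)ᶜ with hT
  have hne : ∀ r : ↥S × ↥T, (r.1 : Fin n) ≠ r.2 := fun r h => by
    have h1 : (r.2 : Fin n) ∉ insert m S := Finset.mem_compl.mp r.2.2
    exact h1 (Finset.mem_insert_of_mem (h ▸ r.1.2))
  set idx : ↥S × ↥T → Idx n L := fun r => Sum.inl (pairOf r.1 r.2 (hne r)) with hidx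
  have hinj : Function.Injective idx := by
    intro r r' h
    rcases pairOf_eq (Sum.inl_injective h) with h' | h'
    · exact Prod.ext (Subtype.ext h'.1) (Subtype.ext h'.2)
    · exact absurd h'.1 (hne (r.1, r'.2))
  have hB := chernoff_bool (hS.indep.precomp hinj) (fun r => hS.measurable _) (fun _ => -1)
    (v := p) (lam := 1 / 4) (t := p / 2 * (S.card * T.card)) (by norm_num) (by norm_num)
    (fun r => (hS.prob_edge _).le)
  refine (measureReal_mono ?_).trans (hB.trans ?_)
  · intro ω hω
    rw [Set.mem_ofPred_eq, not_le] at hω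
    rw [Set.mem_ofPred_eq]
    have e1 : ∀ r : ↥S × ↥T, P.real {ω | Sum.elim E (fun r : Pair n × Fin L => Y r.1 r.2)
        (idx r) ω = true} = p := fun r => hS.prob_edge _
    simp only [e1]
    have e2 : ∑ r : ↥S × ↥T, -1 * (boolVal (Sum.elim E (fun r : Pair n × Fin L => Y r.1 r.2)
        (idx r) ω) - p) = p * (S.card * T.card) - ∑ i ∈ S, ∑ j ∈ T, adj (config E Y ω) i j := by
      have e3 : ∑ i ∈ S, ∑ j ∈ T, adj (config E Y ω) i j
          = ∑ r : ↥S × ↥T, adj (config E Y ω) r.1 r.2 := by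
        rw [Fintype.sum_prod_type, ← Finset.sum_coe_sort]
        refine Finset.sum_congr rfl fun i _ => ?_
        rw [← Finset.sum_coe_sort]
      have e4 : p * (S.card * T.card) = ∑ _r : ↥S × ↥T, p := by
        simp; ring
      rw [e3, e4, ← Finset.sum_sub_distrib]
      refine Finset.sum_congr rfl fun r _ => ?_
      rw [adj_of_ne _ (hne r)]
      change -1 * (boolVal (config E Y ω (idx r)) - p) = _
      rw [hidx]
      ring
    rw [e2]
    linarith
  · rw [← Real.exp_nat_mul]
    refine Real.exp_le_exp.mpr ?_
    have hTc : (n : ℝ) / 4 ≤ T.card := by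
      have h1 : n ≤ T.card + S.card + 1 := by
        have h2 := Finset.card_compl (insert m S)
        rw [Fintype.card_fin, ← hT] at h2
        have h3 := Finset.card_insert_le m S
        omega
      have h4 : n ≤ 4 * T.card := by omega
      have : (n : ℝ) ≤ 4 * T.card := by exact_mod_cast h4
      linarith
    have e1 : ∑ _r : ↥S × ↥T, (-1 : ℝ) ^ 2 = S.card * T.card := by simp
    rw [e1]
    have e2 : p * n = A ^ 2 := by
      rw [hp, ← hn]; field_simp
    have e3 : p * (S.card * (n / 4)) ≤ p * (S.card * T.card) := by gcongr
    have e4 : p * (S.card * (n / 4)) = A ^ 2 * S.card / 4 := by rw [← e2]; ring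
    have e5 := mul_le_mul_of_nonneg_right hAb (Nat.cast_nonneg (α := ℝ) S.card)
    linarith

/-- The union bound over all nonempty vertex sets, grouped by their size. -/
lemma sum_pow_card_le {y : ℝ} (hy : 0 ≤ y) (hny : n * y ≤ 1) :
    ∑ S : Finset (Fin n), (if S = ∅ then 0 else y ^ S.card) ≤ 2 * (n * y) := by
  have h1 : ∑ S : Finset (Fin n), y ^ S.card = (y + 1) ^ n := by
    have := Fin.sum_pow_mul_eq_add_pow (n := n) y 1
    simpa using this
  have h2 : ∑ S : Finset (Fin n), (if S = ∅ then 0 else y ^ S.card) = (y + 1) ^ n - 1 := by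
    rw [← h1, eq_sub_iff_add_eq]
    have : (1 : ℝ) = ∑ S : Finset (Fin n), if S = ∅ then 1 else 0 := by simp
    rw [this, ← Finset.sum_add_distrib]
    refine Finset.sum_congr rfl fun S _ => ?_
    split_ifs with h
    · simp [h]
    · simp
  rw [h2]
  have h3 : (y + 1) ^ n ≤ Real.exp (n * y) := by
    rw [Real.exp_nat_mul]
    exact pow_le_pow_left₀ (by linarith) (Real.add_one_le_exp y) n
  have h4 : 0 ≤ n * y := by positivity
  have h5 := abs_le.mp (Real.abs_exp_sub_one_sub_id_le (x := n * y) (by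
    rw [abs_of_nonneg h4]; exact hny))
  nlinarith

/-- Typical configurations have probability at least `1 - 22 n⁻⁵`. -/
lemma IsSample.prob_goodConfig (hS : IsSample P x bstar p E Y) (hL : 1 ≤ L) (hA : 0 < A)
    (hb : 0 < b) (hsn : 0 < sn) (hn : sn ^ 2 = n) (hbn : b ^ 2 = Real.log n)
    (hp : p = A ^ 2 / sn ^ 2) (hAb : 512 * b ^ 2 ≤ A ^ 2) (hn4 : 4 ≤ n) :
    P.real {ω | ¬GoodConfig p A b sn (score x bstar) (config E Y ω)} ≤ 22 / (n : ℝ) ^ 5 := by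
  set s := score x bstar with hs
  set N : ℝ := (n : ℝ) with hN
  have hN1 : 1 ≤ N := by rw [hN]; exact_mod_cast (by omega : 1 ≤ n)
  have hN0 : 0 < N := by linarith
  have hexp : ∀ k : ℕ, Real.exp (-(k : ℝ) * b ^ 2) = 1 / N ^ k := fun k => by
    rw [hbn, neg_mul, Real.exp_neg, Real.exp_nat_mul, Real.exp_log hN0, one_div]
  have h9 : Real.exp (-9 * b ^ 2) = 1 / N ^ 9 := by exact_mod_cast hexp 9
  have h8 : Real.exp (-8 * b ^ 2) = 1 / N ^ 8 := by exact_mod_cast hexp 8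
  set φ := logisticLink s with hφ
  set w := logisticWeight s with hw
  set Z := config E Y with hZ
  -- The coefficient families of the row sums.
  set fam : Fin n → Fin 7 → (Idx n L → Bool) → Fin n → ℝ := fun m =>
    ![fun _ _ => 1, fun _ j => if j = m then 0 else w m j,
      fun z j => φ m j (looSol p s φ z m m - looSol p s φ z m j),
      fun z j => φ m j (-looSol p s φ z m j),
      fun z j => linearLink w m j (looSol p s (linearLink w) z m m - looSol p s (linearLink w) z m j),
      fun z j => linearLink w m j (-looSol p s (linearLink w) z m j),
      fun z j => w m j * (looSol p s φ z m - looSol p s (linearLink w) z m) j] with hfam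
  have hfam_dep : ∀ m t z z', AgreeOffRow m z z' → fam m t z = fam m t z' := by
    intro m t z z' h
    have h1 := h.looSol_eq p s φ
    have h2 := h.looSol_eq p s (linearLink w)
    fin_cases t <;> simp [hfam, h1, h2]
  set B₁ : Fin n × Fin 7 → Set Ω := fun r =>
    {ω | ¬RowConcentrated p A b sn (adj (Z ω)) r.1 (fam r.1 r.2 (Z ω))} with hB₁
  set B₂ : Fin n → Set Ω := fun m => {ω | ¬|noise (adj (Z ω)) (dev s (Z ω)) m|
    ≤ 10 * (b * (√(∑ j, adj (Z ω) m j) / √L) + b ^ 2 * (1 / L))} with hB₂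
  set B₃ : Pair n → Set Ω := fun q => {ω | ¬|pairDev s (Z ω) q|
    ≤ 10 * (b * (1 / √L) + b ^ 2 * (1 / L))} with hB₃
  set B₄ : Fin n × Finset (Fin n) → Set Ω := fun r => {ω | ¬(2 * r.2.card ≤ n →
    p / 2 * (r.2.card * (insert r.1 r.2)ᶜ.card)
      ≤ ∑ i ∈ r.2, ∑ j ∈ (insert r.1 r.2)ᶜ, adj (Z ω) i j)} with hB₄
  have hsub : {ω | ¬GoodConfig p A b sn s (Z ω)}
      ⊆ ((⋃ r, B₁ r) ∪ (⋃ m, B₂ m)) ∪ ((⋃ q, B₃ q) ∪ (⋃ r, B₄ r)) := by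
    intro ω hω
    by_contra hout
    rw [Set.mem_ofPred_eq] at hω
    simp only [Set.mem_union, Set.mem_iUnion, not_or, not_exists] at hout
    obtain ⟨⟨o1, o2⟩, o3, o4⟩ := hout
    have c1 : ∀ m t, RowConcentrated p A b sn (adj (Z ω)) m (fam m t (Z ω)) := fun m t => by
      have := o1 (m, t)
      simpa only [hB₁, Set.mem_ofPred_eq, not_not] using this
    refine hω ⟨fun m => c1 m 0, fun m => c1 m 1,
      fun m => ⟨c1 m 2, c1 m 3, c1 m 4, c1 m 5, c1 m 6⟩, fun m => ?_, fun q => ?_, fun m S => ?_⟩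
    · have := o2 m
      simpa only [hB₂, Set.mem_ofPred_eq, not_not] using this
    · have := o3 q
      simpa only [hB₃, Set.mem_ofPred_eq, not_not] using this
    · have := o4 (m, S)
      simpa only [hB₄, Set.mem_ofPred_eq, not_not] using this
  have p1 : P.real (⋃ r, B₁ r) ≤ N * 7 * (2 * (1 / N ^ 9)) := by
    refine (measureReal_iUnion_fintype_le _).trans ((Finset.sum_le_sum fun r _ => ?_).trans
      (b := ∑ _r : Fin n × Fin 7, 2 * (1 / N ^ 9)) (le_of_eq ?_))
    · rw [← h9]
      exact hS.prob_row hA hb hsn hp r.1 (fam r.1 r.2) (hfam_dep r.1 r.2)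
    · rw [Finset.sum_const, Finset.card_univ, Fintype.card_prod, Fintype.card_fin, Fintype.card_fin,
        nsmul_eq_mul]
      push_cast
      rfl
  have p2 : P.real (⋃ m, B₂ m) ≤ N * (2 * (1 / N ^ 9)) := by
    refine (measureReal_iUnion_fintype_le _).trans ((Finset.sum_le_sum fun m _ => ?_).trans
      (b := ∑ _m : Fin n, 2 * (1 / N ^ 9)) (le_of_eq ?_))
    · rw [← h9]
      exact hS.prob_noise hL hb m
    · rw [Finset.sum_const, Finset.card_univ, Fintype.card_fin, nsmul_eq_mul]
  have p3 : P.real (⋃ q, B₃ q) ≤ N ^ 2 * (2 * (1 / N ^ 9)) := by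
    refine (measureReal_iUnion_fintype_le _).trans ((Finset.sum_le_sum fun q _ => ?_).trans
      (b := ∑ _q : Pair n, 2 * (1 / N ^ 9)) ?_)
    · rw [← h9]
      exact hS.prob_pairDev hL hb q
    · rw [Finset.sum_const, Finset.card_univ, nsmul_eq_mul]
      refine mul_le_mul_of_nonneg_right ?_ (by positivity)
      have := Fintype.card_subtype_le (fun q : Fin n × Fin n => q.2 < q.1)
      rw [Fintype.card_prod, Fintype.card_fin] at this
      rw [hN, sq]
      exact_mod_cast this
  have p4 : P.real (⋃ r, B₄ r) ≤ N * (2 * (N * (1 / N ^ 8))) := by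
    refine (measureReal_iUnion_fintype_le _).trans ((Finset.sum_le_sum fun r _ => ?_).trans
      (b := ∑ r : Fin n × Finset (Fin n), if r.2 = ∅ then 0 else (1 / N ^ 8) ^ r.2.card) ?_)
    · by_cases hr : r.2 = ∅
      · have : B₄ r = ∅ := by
          rw [Set.eq_empty_iff_forall_notMem]
          intro ω hω
          simp [hB₄, hr] at hω
        simp [this, hr]
      · rw [if_neg hr, ← h8]
        by_cases hc : 2 * r.2.card ≤ n
        · refine (measureReal_mono ?_).trans (hS.prob_cut hsn hn hp hAb hn4 r.1 r.2 hc)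
          intro ω hω
          rw [hB₄, Set.mem_ofPred_eq] at hω
          rw [Set.mem_ofPred_eq]
          exact fun h => hω fun _ => h
        · have : B₄ r = ∅ := by
            rw [Set.eq_empty_iff_forall_notMem]
            intro ω hω
            rw [hB₄, Set.mem_ofPred_eq] at hω
            exact hω fun h => absurd h hc
          rw [this, measureReal_empty]
          positivity
    · rw [Fintype.sum_prod_type]
      change ∑ _m : Fin n, ∑ S : Finset (Fin n), (if S = ∅ then 0 else (1 / N ^ 8) ^ S.card) ≤ _
      rw [Finset.sum_const, Finset.card_univ, Fintype.card_fin, nsmul_eq_mul]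
      refine mul_le_mul_of_nonneg_left (sum_pow_card_le (by positivity) ?_) hN0.le
      rw [← hN, mul_one_div, div_le_one (by positivity)]
      calc N = N ^ 1 := (pow_one N).symm
        _ ≤ N ^ 8 := pow_le_pow_right₀ hN1 (by norm_num)
  have hfin : P.real {ω | ¬GoodConfig p A b sn s (Z ω)} ≤ N * 7 * (2 * (1 / N ^ 9))
      + N * (2 * (1 / N ^ 9)) + (N ^ 2 * (2 * (1 / N ^ 9)) + N * (2 * (N * (1 / N ^ 8)))) := by
    refine (measureReal_mono hsub).trans ((measureReal_union_le _ _).trans (add_le_add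
      ((measureReal_union_le _ _).trans (add_le_add p1 p2))
      ((measureReal_union_le _ _).trans (add_le_add p3 p4))))
  refine hfin.trans ?_
  have q1 : N * (1 / N ^ 9) ≤ 1 / N ^ 5 := by
    have : N * (1 / N ^ 9) = 1 / N ^ 8 := by field_simp
    rw [this]
    exact one_div_le_one_div_of_le (by positivity) (pow_le_pow_right₀ hN1 (by norm_num))
  have q2 : N ^ 2 * (1 / N ^ 9) ≤ 1 / N ^ 5 := by
    have : N ^ 2 * (1 / N ^ 9) = 1 / N ^ 7 := by field_simp
    rw [this]
    exact one_div_le_one_div_of_le (by positivity) (pow_le_pow_right₀ hN1 (by norm_num))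
  have q3 : N * (N * (1 / N ^ 8)) ≤ 1 / N ^ 5 := by
    have : N * (N * (1 / N ^ 8)) = 1 / N ^ 6 := by field_simp
    rw [this]
    exact one_div_le_one_div_of_le (by positivity) (pow_le_pow_right₀ hN1 (by norm_num))
  have q4 : 22 / N ^ 5 = 22 * (1 / N ^ 5) := by ring
  have q5 : 0 ≤ 1 / N ^ 5 := by positivity
  rw [q4]
  linarith only [q1, q2, q3, q5]

end Typical

/-! ### Typical configurations are regular -/

section Regularity

/-- The spectral gap from the cuts, in the form used by `Regular`; `4608 = 24 * 192`, where
`A² / 192 = (A² / 4)² / (4 * 3 A²)` is the bound of Cheeger's inequality. -/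
lemma isGapGraph_of_cuts {V : Type*} [Fintype V] [DecidableEq V] {a : V → V → ℝ} {A g : ℝ}
    (hA : 0 < A) (hg : 4608 ≤ g) (ha : ∀ i j, 0 ≤ a i j) (hsymm : ∀ i j, a i j = a j i)
    (hdeg : ∀ i, ∑ j, a i j ≤ 3 * A ^ 2)
    (hcut : ∀ S : Finset V, 2 * S.card ≤ Fintype.card V →
      A ^ 2 / 4 * S.card ≤ ∑ i ∈ S, ∑ j ∈ Sᶜ, a i j) : IsGapGraph a (24 * A ^ 2 / g) where
  nonneg := ha
  symm := hsymm
  gap z hz := by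
    have h1 := spectral_gap_of_cuts ha hsymm (by positivity) hdeg (by positivity) hcut z hz
    have h2 : 0 ≤ ∑ i, z i ^ 2 := Finset.sum_nonneg fun i _ => sq_nonneg _
    have h3 : 24 * A ^ 2 / g ≤ A ^ 2 / 192 := by
      rw [div_le_div_iff₀ (by linarith) (by norm_num)]
      nlinarith [sq_nonneg A]
    refine (mul_le_mul_of_nonneg_right h3 h2).trans ?_
    have h4 : A ^ 2 * (A ^ 2 / 192 * ∑ i, z i ^ 2)
        ≤ A ^ 2 * ∑ i, ∑ j, a i j * (z i - z j) ^ 2 := by linarith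
    exact le_of_mul_le_mul_left h4 (by positivity)

variable {n L : ℕ} {g κ p A b r sn : ℝ} {s : Fin n → ℝ} {z : Idx n L → Bool}

lemma GoodConfig.le_cut (hG : GoodConfig p A b sn s z) {S : Finset (Fin n)}
    (hS : 2 * S.card ≤ n) : p / 2 * (S.card * Sᶜ.card) ≤ ∑ i ∈ S, ∑ j ∈ Sᶜ, adj z i j := by
  rcases S.eq_empty_or_nonempty with rfl | ⟨m, hm⟩
  · simp
  · have := hG.cut_le m S hS
    rwa [Finset.insert_eq_of_mem hm] at this

/-- The cuts of the leave-one-out graph: the vertex `m` contributes its mean `p` on every edge, the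
other edges form a cut that avoids `m`. -/
lemma GoodConfig.le_cut_looGraph (hp : 0 ≤ p) (hG : GoodConfig p A b sn s z) (m : Fin n)
    {S : Finset (Fin n)} (hS : 2 * S.card ≤ n) :
    p / 2 * (S.card * Sᶜ.card) ≤ ∑ i ∈ S, ∑ j ∈ Sᶜ, looGraph p (adj z) m i j := by
  have hoff : ∀ i ∈ S, ∀ j ∈ Sᶜ, i ≠ m → j ≠ m → looGraph p (adj z) m i j = adj z i j := by
    intro i hi j hj him hjm
    have hij : i ≠ j := fun h => Finset.mem_compl.mp hj (h ▸ hi)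
    rw [looGraph, if_neg hij, if_neg (by tauto)]
  have hon : ∀ i ∈ S, ∀ j ∈ Sᶜ, (i = m ∨ j = m) → looGraph p (adj z) m i j = p := by
    intro i hi j hj h
    have hij : i ≠ j := fun h => Finset.mem_compl.mp hj (h ▸ hi)
    rw [looGraph, if_neg hij, if_pos h]
  by_cases hm : m ∈ S
  · have hcut := hG.cut_le m (S.erase m)
      ((Nat.mul_le_mul_left 2 (Finset.card_erase_le)).trans hS)
    rw [Finset.insert_erase hm] at hcut
    have hc : ((S.erase m).card : ℝ) = S.card - 1 := by
      rw [Finset.card_erase_of_mem hm, Nat.cast_sub (Finset.card_pos.mpr ⟨m, hm⟩), Nat.cast_one]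
    rw [hc] at hcut
    rw [← Finset.add_sum_erase S _ hm]
    have e1 : ∑ j ∈ Sᶜ, looGraph p (adj z) m m j = Sᶜ.card * p := by
      rw [Finset.sum_congr rfl fun j hj => hon m hm j hj (Or.inl rfl), Finset.sum_const,
        nsmul_eq_mul]
    have e2 : ∑ i ∈ S.erase m, ∑ j ∈ Sᶜ, looGraph p (adj z) m i j
        = ∑ i ∈ S.erase m, ∑ j ∈ Sᶜ, adj z i j :=
      Finset.sum_congr rfl fun i hi => Finset.sum_congr rfl fun j hj =>
        hoff i (Finset.mem_of_mem_erase hi) j hj (Finset.ne_of_mem_erase hi)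
          fun h => Finset.mem_compl.mp hj (h ▸ hm)
    rw [e1, e2]
    have e3 : 0 ≤ p * (Sᶜ.card : ℝ) := by positivity
    linarith only [hcut, e3]
  · have hcut := hG.cut_le m S hS
    have hins : insert m (insert m S)ᶜ = Sᶜ := by
      ext j
      by_cases hj : j = m
      · simp [hj, hm]
      · simp [hj]
    have hnot : m ∉ (insert m S)ᶜ := by simp
    have hc : ((insert m S)ᶜ.card : ℝ) = Sᶜ.card - 1 := by
      rw [← hins, Finset.card_insert_of_notMem hnot, Nat.cast_add, Nat.cast_one, add_sub_cancel_right]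
    rw [hc] at hcut
    have e1 : ∑ i ∈ S, ∑ j ∈ Sᶜ, looGraph p (adj z) m i j
        = S.card * p + ∑ i ∈ S, ∑ j ∈ (insert m S)ᶜ, adj z i j := by
      rw [← nsmul_eq_mul, ← Finset.sum_const, ← Finset.sum_add_distrib]
      refine Finset.sum_congr rfl fun i hi => ?_
      rw [← hins, Finset.sum_insert hnot,
        hon i hi m (Finset.mem_compl.mpr hm) (Or.inr rfl)]
      congr 1
      refine Finset.sum_congr rfl fun j hj => ?_
      have hjm : j ≠ m := fun h => hnot (h ▸ hj)
      exact hoff i hi j (hins ▸ Finset.mem_insert_of_mem hj) (fun h => hm (h ▸ hi)) hjm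
    rw [e1]
    have e3 : 0 ≤ p * (S.card : ℝ) := by positivity
    linarith only [hcut, e3]

lemma GoodConfig.deg_le (hp : Admissible g κ p A b r sn) (hn : √(n : ℝ) = sn)
    (hG : GoodConfig p A b sn s z) (m : Fin n) : ∑ j, adj z m j ≤ 2 * A ^ 2 := by
  have h1 := hp.one_le_κ
  have h2 := hp.one_le_g
  have h3 := hp.A_pos
  have hsn := hp.sn_pos
  have hb : 0 < b := by linarith [hp.b_ge]
  have hrow := (abs_le.mp (hG.row_one m)).2
  have e1 : l2 (fun _ : Fin n => (1 : ℝ)) ≤ sn := by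
    have := l2_le_sqrt_card_mul (f := fun _ : Fin n => (1 : ℝ)) (c := 1) (by simp) zero_le_one
    rwa [Fintype.card_fin, hn, mul_one] at this
  have e2 : ‖fun _ : Fin n => (1 : ℝ)‖ ≤ 1 :=
    (pi_norm_le_iff_of_nonneg zero_le_one).mpr fun j => by simp
  have e3 : 10 * (A * b / sn * l2 (fun _ : Fin n => (1 : ℝ)) + b ^ 2 * ‖fun _ : Fin n => (1 : ℝ)‖)
      ≤ 10 * (A * b / sn * sn + b ^ 2 * 1) := by gcongr
  have e4 : A * b / sn * sn = A * b := by field_simp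
  have e5 : ∑ j ∈ Finset.univ.erase m, (adj z m j - p) * 1 = ∑ j, adj z m j - (n - 1) * p := by
    have hpos : 1 ≤ n := m.pos
    simp only [mul_one]
    rw [Finset.sum_sub_distrib, sum_erase_eq_of_diag m (f := fun j => adj z m j) (adj_self z m),
      Finset.sum_const, Finset.card_erase_of_mem (Finset.mem_univ m), Finset.card_univ,
      Fintype.card_fin, nsmul_eq_mul, Nat.cast_sub hpos, Nat.cast_one]
  have e6 : (n : ℝ) * p = A ^ 2 := by
    have : (n : ℝ) = sn ^ 2 := by rw [← hn, Real.sq_sqrt (by positivity)]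
    rw [this, hp.p_eq]; field_simp
  have e7 : b ≤ A / 10000 := by
    have := hp.small₁
    have e8 : 10000 * 1 * (1 * b / A) ≤ 10000 * g * (κ * b / A) := by gcongr
    have e9 : b / A ≤ 1 / 10000 := by
      rw [one_mul] at e8
      linarith
    rw [div_le_iff₀ h3] at e9
    linarith
  have hpp := hp.p_pos
  rw [e5] at hrow
  rw [e4] at e3
  nlinarith

/-- On a typical configuration, every weighted degree is at least half its mean. -/
lemma GoodConfig.le_wdeg (hp : Admissible g κ p A b r sn) (hn : √(n : ℝ) = sn)
    (hw : ∀ i j, 1 / (4 * κ) ≤ logisticWeight s i j) (hG : GoodConfig p A b sn s z) (m : Fin n) :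
    p / 2 * ∑ j ∈ Finset.univ.erase m, logisticWeight s m j
      ≤ ∑ j, adj z m j * logisticWeight s m j := by
  have h1 := hp.one_le_κ
  have h2 := hp.one_le_g
  have h3 := hp.A_pos
  have hsn := hp.sn_pos
  have hb : 0 < b := by linarith [hp.b_ge]
  set W := ∑ j ∈ Finset.univ.erase m, logisticWeight s m j with hW
  have hWge : sn ^ 2 / (8 * κ) ≤ W := hp.le_sum_w (by rw [Fintype.card_fin, hn]) hw m
  have hW0 : 0 < W := lt_of_lt_of_le (by positivity) hWge
  set v : Fin n → ℝ := fun j => if j = m then 0 else logisticWeight s m j with hv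
  have hvne : ∀ j ∈ Finset.univ.erase m, v j = logisticWeight s m j := fun j hj =>
    if_neg (Finset.ne_of_mem_erase hj)
  have hrow := (abs_le.mp (hG.row_weight m)).1
  have hle4 : ∀ i j, logisticWeight s i j ≤ 1 / 4 := fun i j => sigmoidDeriv_le _
  have hpos := logisticWeight_pos s
  have e1 : l2 v ≤ √W / 2 := by
    refine l2_le_of_sum_sq_le (by positivity) ?_
    rw [div_pow, Real.sq_sqrt hW0.le, ← sum_erase_eq_of_diag m (f := fun j => v j ^ 2) (by simp [hv]),
      hW, Finset.sum_div]
    refine Finset.sum_le_sum fun j hj => ?_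
    rw [hvne j hj]
    nlinarith [hle4 m j, hpos m j]
  have e2 : ‖v‖ ≤ 1 / 4 := (pi_norm_le_iff_of_nonneg (by norm_num)).mpr fun j => by
    rw [Real.norm_eq_abs]
    simp only [hv]
    split_ifs
    · norm_num
    · rw [abs_of_pos (hpos m j)]; exact hle4 m j
  have e3 : 10 * (A * b / sn * l2 v + b ^ 2 * ‖v‖)
      ≤ 10 * (A * b / sn * (√W / 2) + b ^ 2 * (1 / 4)) := by gcongr
  have e5 : ∑ j ∈ Finset.univ.erase m, (adj z m j - p) * v j
      = ∑ j, adj z m j * logisticWeight s m j - p * W := by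
    rw [← sum_erase_eq_of_diag m (f := fun j => adj z m j * logisticWeight s m j)
      (by simp [adj_self]), hW, Finset.mul_sum, ← Finset.sum_sub_distrib]
    refine Finset.sum_congr rfl fun j hj => ?_
    rw [hvne j hj]; ring
  have e6 : 10000 * (κ * b ^ 2) ≤ A ^ 2 := by
    have e8 : 10000 * 1 * (κ * b ^ 2 / A ^ 2) ≤ 10000 * g * (κ * b ^ 2 / A ^ 2) := by gcongr
    have e9 : 10000 * (κ * b ^ 2) / A ^ 2 ≤ 1 := by
      have : 10000 * (κ * b ^ 2) / A ^ 2 = 10000 * 1 * (κ * b ^ 2 / A ^ 2) := by ring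
      rw [this]; exact e8.trans hp.small₃
    rwa [div_le_one (by positivity)] at e9
  -- In units of `T = A √W / sn`, whose square is `p W`, the fluctuation is `5 b T + (5/2) b²`.
  set T := A * √W / sn with hT
  have hT0 : 0 < T := by positivity
  have hTsq : T ^ 2 = p * W := by
    rw [hT, div_pow, mul_pow, Real.sq_sqrt hW0.le, hp.p_eq]; ring
  have e7 : 1250 * b ^ 2 ≤ T ^ 2 := by
    rw [hTsq, hp.p_eq]
    calc 1250 * b ^ 2 = 10000 * (κ * b ^ 2) / (8 * κ) := by field_simp; norm_num
      _ ≤ A ^ 2 / (8 * κ) := by gcongr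
      _ = A ^ 2 / sn ^ 2 * (sn ^ 2 / (8 * κ)) := by field_simp
      _ ≤ A ^ 2 / sn ^ 2 * W := by gcongr
  have e8 : 35 * b ≤ T := by
    refine le_of_sq_le_sq ?_ hT0.le
    nlinarith [sq_nonneg b]
  have e9 : A * b / sn * (√W / 2) = b * T / 2 := by rw [hT]; ring
  have e10 : b * T ≤ T / 35 * T := by gcongr; linarith
  rw [e5] at hrow
  rw [e9] at e3
  nlinarith

/-- A typical configuration is regular, with the noise scale `r = √(log n / (n p L))`. -/
lemma GoodConfig.regular (hL : 1 ≤ L) (hr : r = b / (A * √L)) (hp : Admissible g κ p A b r sn)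
    (hg : 4608 ≤ g) (hn : √(n : ℝ) = sn) (hw : ∀ i j, 1 / (4 * κ) ≤ logisticWeight s i j)
    (hG : GoodConfig p A b sn s z) :
    Regular g κ p A b r sn (adj z) (dev s z) (logisticWeight s) := by
  have h3 := hp.A_pos
  have hsn := hp.sn_pos
  have hpp := hp.p_pos
  have hb : 0 < b := by linarith [hp.b_ge]
  have hL1 : (1 : ℝ) ≤ L := by exact_mod_cast hL
  set l := √(L : ℝ) with hl
  have hl1 : 1 ≤ l := Real.one_le_sqrt.mpr hL1
  have hlsq : l ^ 2 = L := Real.sq_sqrt (by linarith)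
  have hl0 : 0 < l := by linarith
  have hdeg := hG.deg_le hp hn
  have hcard : (n : ℝ) = sn ^ 2 := by rw [← hn, Real.sq_sqrt n.cast_nonneg]
  have e6 : p * n = A ^ 2 := by rw [hcard, hp.p_eq]; field_simp
  have hhalf : ∀ S : Finset (Fin n), 2 * S.card ≤ n →
      A ^ 2 / 4 * S.card ≤ p / 2 * (S.card * Sᶜ.card) := fun S hS => by
    have h1 := Finset.card_add_card_compl S
    rw [Fintype.card_fin] at h1
    have h2 : (n : ℝ) ≤ 2 * Sᶜ.card := by exact_mod_cast (by omega : n ≤ 2 * Sᶜ.card)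
    have h4 := mul_le_mul_of_nonneg_left h2 (mul_nonneg hpp.le (Nat.cast_nonneg S.card))
    rw [← e6]
    linarith only [h4]
  have hAr : A * r = b / l := by rw [hr]; field_simp
  have hA2r : A ^ 2 * r = A * (b / l) := by rw [← hAr]; ring
  have hquot : b ^ 2 * (1 / L) = (b / l) ^ 2 := by rw [← hlsq]; ring
  have hbl0 : 0 < b / l := by positivity
  refine ⟨by rw [Fintype.card_fin, hn], adj_nonneg z, adj_le_one z, adj_self z, dev_symm s z,
    logisticWeight_symm s, hw, fun i j => sigmoidDeriv_le _, fun i j => ?_, fun i => ?_, hdeg,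
    hG.le_wdeg hp hn hw, ?_, fun m => ?_⟩
  · by_cases hij : i = j
    · have := hp.r_pos
      rw [dev, dif_pos hij, abs_zero]
      positivity
    · rw [dev, dif_neg hij, abs_mul, abs_orient, one_mul, hAr]
      rcases le_total (b / l) 1 with hbl | hbl
      · refine (hG.pairDev_le _).trans ?_
        rw [hquot, mul_one_div]
        nlinarith
      · refine (abs_pairDev_le_one hL s z _).trans ?_
        linarith
  · rw [hA2r]
    refine (hG.noise_le i).trans ?_
    have h1 : √(∑ j, adj z i j) ≤ 3 / 2 * A := by
      refine Real.sqrt_le_iff.mpr ⟨by positivity, (hdeg i).trans ?_⟩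
      nlinarith [sq_nonneg A]
    have h2 : b / l ≤ A := (div_le_self hb.le hl1).trans hp.b_le
    rw [hquot]
    calc 10 * (b * (√(∑ j, adj z i j) / l) + (b / l) ^ 2)
        ≤ 10 * (b * (3 / 2 * A / l) + (b / l) * A) := by
          rw [sq]; gcongr
      _ = _ := by ring
  · refine isGapGraph_of_cuts h3 hg (adj_nonneg z) (adj_symm z) (fun i => ?_) fun S hS => ?_
    · nlinarith [hdeg i, sq_nonneg A]
    · rw [Fintype.card_fin] at hS
      exact (hhalf S hS).trans (hG.le_cut hS)
  · have hnn : ∀ i j, 0 ≤ looGraph p (adj z) m i j := fun i j => by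
      unfold looGraph
      split_ifs
      exacts [le_rfl, hpp.le, adj_nonneg z i j]
    refine isGapGraph_of_cuts h3 hg hnn (fun i j => ?_) (fun i => ?_) fun S hS => ?_
    · simp only [looGraph, eq_comm (a := j) (b := i), or_comm (a := j = m), adj_symm z j i]
    · by_cases him : i = m
      · calc ∑ j, looGraph p (adj z) m i j ≤ ∑ _j : Fin n, p := by
              refine Finset.sum_le_sum fun j _ => ?_
              unfold looGraph
              rw [if_pos (Or.inl him)]
              split_ifs
              exacts [hpp.le, le_rfl]
          _ = A ^ 2 := by rw [Finset.sum_const, Finset.card_univ, Fintype.card_fin, nsmul_eq_mul,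
                mul_comm, e6]
          _ ≤ _ := by nlinarith [sq_nonneg A]
      · have h1 : p ≤ A ^ 2 := by
          rw [hp.p_eq]
          exact div_le_self (sq_nonneg A) (by linarith [hp.two_le])
        calc ∑ j, looGraph p (adj z) m i j ≤ ∑ j, (adj z i j + if j = m then p else 0) := by
              refine Finset.sum_le_sum fun j _ => ?_
              have := adj_nonneg z i j
              unfold looGraph
              split_ifs with h1 h2 h3 h4 <;> first | linarith | tauto
          _ = ∑ j, adj z i j + p := by rw [Finset.sum_add_distrib]; simp
          _ ≤ _ := by linarith [hdeg i]
    · rw [Fintype.card_fin] at hS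
      exact (hhalf S hS).trans (hG.le_cut_looGraph hpp.le m hS)

end Regularity

/-! ### The scores as coordinates of the parameter space -/

section Coordinates

variable {n d : ℕ} {x : Fin n → EuclideanSpace ℝ (Fin d)}

lemma score_eq (b : Param n d) (i : Fin n) :
    score x b i = b (Sum.inl i) + ∑ k, x i k * b (Sum.inr k) := by
  rw [score, PiLp.inner_apply, Fintype.sum_sum_type]
  congr 1
  · simp [lift, Pi.single_apply]
  · simp [lift, mul_comm]

lemma score_sub (b b' : Param n d) (i : Fin n) : score x (b - b') i = score x b i - score x b' i :=
  inner_sub_right _ _ _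

lemma paramSpace_sub {b b' : Param n d} (hb : b ∈ paramSpace x) (hb' : b' ∈ paramSpace x) :
    b - b' ∈ paramSpace x := by
  rw [paramSpace, Set.mem_ofPred_eq] at *
  have : (fun i => (b - b') (Sum.inl i)) = (fun i => b (Sum.inl i)) - fun i => b' (Sum.inl i) := rfl
  rw [this, Matrix.mulVec_sub, hb, hb', sub_self]

lemma designBar_mulVec_cons (c : ℝ) (β : Fin d → ℝ) (i : Fin n) :
    Matrix.mulVec (designBar x) (Matrix.vecCons c β) i = c + ∑ k, x i k * β k := by
  simp [designBar, Matrix.mulVec, Matrix.vecCons, dotProduct, Fin.sum_univ_succ]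

/-- The sum over ordered pairs, in terms of the pairs `i > j`. -/
lemma sum_sum_eq_sum_pair {f : Fin n → Fin n → ℝ} (hf : ∀ i, f i i = 0) :
    ∑ i, ∑ j, f i j = ∑ q : Pair n, (f q.1.1 q.1.2 + f q.1.2 q.1.1) := by
  have h1 : ∀ g : Fin n → Fin n → ℝ,
      ∑ q : Pair n, g q.1.1 q.1.2 = ∑ i, ∑ j, if j < i then g i j else 0 := fun g => by
    rw [← Fintype.sum_prod_type' (f := fun i j => if j < i then g i j else 0),
      ← Finset.sum_filter]
    exact (Finset.sum_subtype (Finset.univ.filter fun q : Fin n × Fin n => q.2 < q.1) (by simp)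
      (fun q => g q.1 q.2)).symm
  rw [Finset.sum_add_distrib, h1, h1 fun i j => f j i,
    Finset.sum_comm (f := fun i j => if j < i then f j i else 0), ← Finset.sum_add_distrib]
  refine Finset.sum_congr rfl fun i _ => ?_
  rw [← Finset.sum_add_distrib]
  refine Finset.sum_congr rfl fun j _ => ?_
  rcases lt_trichotomy i j with h | h | h
  · simp [h, h.not_gt]
  · simp [h, hf]
  · simp [h, h.not_gt]

lemma sigmaMat_quadratic_form (z : Param n d) :
    WithLp.ofLp z ⬝ᵥ Matrix.mulVec (sigmaMat x) (WithLp.ofLp z)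
      = ∑ q : Pair n, (score x z q.1.1 - score x z q.1.2) ^ 2 := by
  rw [sigmaMat, Matrix.sum_mulVec, dotProduct_sum]
  refine Finset.sum_congr rfl fun q _ => ?_
  have h1 : score x z q.1.1 - score x z q.1.2
      = WithLp.ofLp z ⬝ᵥ WithLp.ofLp (lift x q.1.1 - lift x q.1.2) := by
    rw [score, score, ← inner_sub_left, EuclideanSpace.inner_eq_star_dotProduct]
    simp
  rw [Matrix.vecMulVec_mulVec, h1, dotProduct_comm (WithLp.ofLp (lift x q.1.1 - lift x q.1.2))]
  simp [sq]

variable {c₂ : ℝ}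

/-- The supremum that defines `lambdaMinOn` is attained, as soon as it is positive. -/
lemma le_of_le_lambdaMinOn {S : Set (Param n d)}
    {M : Matrix (Fin n ⊕ Fin d) (Fin n ⊕ Fin d) ℝ} {μ : ℝ} (hμ : 0 < μ) (h : μ ≤ lambdaMinOn S M)
    {z : Param n d} (hz : z ∈ S) :
    μ * ‖z‖ ^ 2 ≤ WithLp.ofLp z ⬝ᵥ Matrix.mulVec M (WithLp.ofLp z) := by
  by_contra hlt
  rw [not_le] at hlt
  set T := {ν : ℝ | ∀ z ∈ S, ν * ‖z‖ ^ 2 ≤ WithLp.ofLp z ⬝ᵥ Matrix.mulVec M (WithLp.ofLp z)} with hT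
  have hne : T.Nonempty := by
    rw [Set.nonempty_iff_ne_empty]
    intro he
    rw [lambdaMinOn, ← hT, he, Real.sSup_empty] at h
    linarith
  obtain ⟨ν₀, hν₀⟩ := hne
  have hz0 : 0 < ‖z‖ ^ 2 := by
    refine lt_of_le_of_ne (sq_nonneg _) fun h0 => ?_
    have := hν₀ z hz
    rw [← h0] at hlt this
    linarith
  have hlt' : (WithLp.ofLp z ⬝ᵥ Matrix.mulVec M (WithLp.ofLp z)) / ‖z‖ ^ 2 < sSup T :=
    lt_of_lt_of_le ((div_lt_iff₀ hz0).mpr hlt) h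
  obtain ⟨ν, hν, hlt2⟩ := exists_lt_of_lt_csSup ⟨ν₀, hν₀⟩ hlt'
  exact absurd (hν z hz) (not_le.mpr ((div_lt_iff₀ hz0).mp hlt2))

/-- The scores, up to a common shift, control the Euclidean norm of the parameter. -/
lemma norm_le_of_score_eq (hn : 0 < n) (hc₂ : 0 < c₂)
    (hlam : c₂ * n ≤ lambdaMinOn (paramSpace x) (sigmaMat x)) {b : Param n d}
    (hb : b ∈ paramSpace x) {u : Fin n → ℝ} {c : ℝ} (hu : ∑ i, u i = 0)
    (hs : ∀ i, score x b i = u i + c) : ‖b‖ ≤ l2 u / √c₂ := by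
  have hn' : (0 : ℝ) < n := by exact_mod_cast hn
  have h1 := le_of_le_lambdaMinOn (by positivity) hlam hb
  rw [sigmaMat_quadratic_form] at h1
  have h2 : ∑ i, ∑ j, (u i - u j) ^ 2 = 2 * (n * l2 u ^ 2) := by
    have e : ∀ i, ∑ j, (u i - u j) ^ 2 = n * u i ^ 2 + l2 u ^ 2 := fun i => by
      rw [l2_sq]
      calc ∑ j, (u i - u j) ^ 2 = ∑ j, (u i ^ 2 + u j ^ 2 - 2 * u i * u j) :=
            Finset.sum_congr rfl fun j _ => by ring
        _ = _ := by rw [Finset.sum_sub_distrib, Finset.sum_add_distrib, ← Finset.mul_sum, hu]; simp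
    simp_rw [e]
    rw [Finset.sum_add_distrib, ← Finset.mul_sum, ← l2_sq]
    simp; ring
  have h3 : ∑ q : Pair n, (score x b q.1.1 - score x b q.1.2) ^ 2 = n * l2 u ^ 2 := by
    have e := sum_sum_eq_sum_pair (f := fun i j => (u i - u j) ^ 2) (fun i => by simp)
    rw [h2] at e
    have e2 : ∑ q : Pair n, ((u q.1.1 - u q.1.2) ^ 2 + (u q.1.2 - u q.1.1) ^ 2)
        = 2 * ∑ q : Pair n, (score x b q.1.1 - score x b q.1.2) ^ 2 := by
      rw [Finset.mul_sum]
      refine Finset.sum_congr rfl fun q _ => ?_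
      rw [hs, hs]; ring
    linarith
  rw [h3] at h1
  rw [le_div_iff₀ (Real.sqrt_pos.mpr hc₂)]
  refine le_of_sq_le_sq ?_ (l2_nonneg _)
  rw [mul_pow, Real.sq_sqrt hc₂.le]
  have h4 : (n : ℝ) * (‖b‖ ^ 2 * c₂) ≤ n * l2 u ^ 2 := by linarith
  exact le_of_mul_le_mul_left h4 hn'

/-- A parameter is determined by its scores, up to a common shift. -/
lemma eq_of_score_sub_eq (hn : 0 < n) (hc₂ : 0 < c₂)
    (hlam : c₂ * n ≤ lambdaMinOn (paramSpace x) (sigmaMat x)) {b b' : Param n d}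
    (hb : b ∈ paramSpace x) (hb' : b' ∈ paramSpace x) {c : ℝ}
    (hs : ∀ i, score x b i - score x b' i = c) : b = b' := by
  have h := norm_le_of_score_eq hn hc₂ hlam (paramSpace_sub hb hb') (u := 0) (c := c) (by simp)
    (fun i => by rw [score_sub, hs]; simp)
  have h0 : l2 (0 : Fin n → ℝ) = 0 := by simp [l2]
  rw [h0, zero_div] at h
  exact sub_eq_zero.mp (norm_le_zero_iff.mp h)

lemma isUnit_gram (hn : 0 < n) (hc₂ : 0 < c₂)
    (hlam : c₂ * n ≤ lambdaMinOn (paramSpace x) (sigmaMat x)) :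
    IsUnit ((designBar x).transpose * designBar x) := by
  rw [← Matrix.mulVec_injective_iff_isUnit]
  refine (injective_iff_map_eq_zero
    (Matrix.mulVecLin ((designBar x).transpose * designBar x))).mpr fun γ hγ => ?_
  have h1 : Matrix.mulVec (designBar x) γ = 0 := by
    have h2 : Matrix.mulVec (designBar x) γ ⬝ᵥ Matrix.mulVec (designBar x) γ = 0 := by
      have h3 : Matrix.mulVec ((designBar x).transpose * designBar x) γ = 0 := hγ
      rw [Matrix.dotProduct_mulVec, ← Matrix.mulVec_transpose, Matrix.mulVec_mulVec, h3,
        zero_dotProduct]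
    exact dotProduct_self_eq_zero.mp h2
  have hcons : γ = Matrix.vecCons (γ 0) (fun k => γ k.succ) := by
    funext k
    refine Fin.cases rfl (fun k => rfl) k
  -- The parameter with `α = 0` and the slopes of `γ` has constant scores, hence vanishes.
  set b : Param n d := WithLp.toLp 2 (Sum.elim 0 fun k => γ k.succ) with hb
  have h0 : (0 : Param n d) ∈ paramSpace x := by
    rw [paramSpace, Set.mem_ofPred_eq]
    exact Matrix.mulVec_zero _
  have hbm : b ∈ paramSpace x := by
    rw [paramSpace, Set.mem_ofPred_eq]
    exact Matrix.mulVec_zero _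
  have hrow : ∀ i, γ 0 + ∑ k, x i k * γ k.succ = 0 := fun i => by
    rw [← designBar_mulVec_cons, ← hcons, h1]; rfl
  have hb0 : b = 0 := eq_of_score_sub_eq hn hc₂ hlam hbm h0 (c := -γ 0) fun i => by
    rw [← score_sub, sub_zero, score_eq]
    have : ∑ k, x i k * b (Sum.inr k) = ∑ k, x i k * γ k.succ := rfl
    rw [this, ← eq_neg_of_add_eq_zero_right (hrow i)]
    simp [hb]
  have hβ : ∀ k : Fin d, γ k.succ = 0 := fun k => congrArg (fun b : Param n d => b (Sum.inr k)) hb0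
  funext k
  refine Fin.cases ?_ (fun k => hβ k) k
  have := hrow ⟨0, hn⟩
  simpa [hβ] using this

/-- Every vector of scores is realized in the parameter space, up to a common shift. -/
lemma exists_score_eq (hn : 0 < n) (hc₂ : 0 < c₂)
    (hlam : c₂ * n ≤ lambdaMinOn (paramSpace x) (sigmaMat x)) (s : Fin n → ℝ) :
    ∃ b ∈ paramSpace x, ∃ c : ℝ, ∀ i, score x b i = s i + c := by
  have hdet := (Matrix.isUnit_iff_isUnit_det _).mp (isUnit_gram hn hc₂ hlam)
  set X := designBar x with hX
  set γ := Matrix.mulVec (X.transpose * X)⁻¹ (Matrix.mulVec X.transpose s) with hγ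
  have hcons : γ = Matrix.vecCons (γ 0) (fun k => γ k.succ) := by
    funext k
    refine Fin.cases rfl (fun k => rfl) k
  refine ⟨WithLp.toLp 2 (Sum.elim (s - Matrix.mulVec X γ) fun k => γ k.succ), ?_, -γ 0,
    fun i => ?_⟩
  · rw [paramSpace, Set.mem_ofPred_eq]
    change Matrix.mulVec X.transpose (s - Matrix.mulVec X γ) = 0
    rw [Matrix.mulVec_sub, Matrix.mulVec_mulVec, hγ, Matrix.mulVec_mulVec,
      Matrix.mul_nonsing_inv _ hdet, Matrix.one_mulVec, sub_self]
  · rw [score_eq]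
    change s i - Matrix.mulVec X γ i + ∑ k, x i k * γ k.succ = _
    rw [hcons, hX, designBar_mulVec_cons]
    simp only [Matrix.cons_val_zero, Matrix.cons_val_succ]
    ring

/-- The intrinsic scores are, up to the projection, the total scores; the incoherence of the
projection bounds them in the sup norm. -/
lemma abs_inl_le_of_score_eq {c₀ : ℝ} (hn : 0 < n) (hc₂ : 0 < c₂)
    (hlam : c₂ * n ≤ lambdaMinOn (paramSpace x) (sigmaMat x))
    (hinc : twoInftyNorm (projBar x) ≤ c₀) {b : Param n d}
    (hb : b ∈ paramSpace x) {u : Fin n → ℝ} {c : ℝ} (hs : ∀ i, score x b i = u i + c) (i : Fin n) :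
    |b (Sum.inl i)| ≤ ‖u‖ + c₀ * l2 u := by
  have hdet := (Matrix.isUnit_iff_isUnit_det _).mp (isUnit_gram hn hc₂ hlam)
  rw [paramSpace, Set.mem_ofPred_eq] at hb
  set α : Fin n → ℝ := fun i => b (Sum.inl i) with hα
  set γ : Fin (d + 1) → ℝ := Matrix.vecCons (-c) fun k => b (Sum.inr k) with hγ
  have hu : u = α + Matrix.mulVec (designBar x) γ := by
    funext i
    rw [Pi.add_apply, hγ, designBar_mulVec_cons]
    have := hs i
    rw [score_eq] at this
    simp only [hα]
    linarith
  have hproj : Matrix.mulVec (projBar x) u = Matrix.mulVec (designBar x) γ := by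
    rw [hu, Matrix.mulVec_add, projBar, ← Matrix.mulVec_mulVec α, hb, Matrix.mulVec_zero, zero_add,
      Matrix.mulVec_mulVec, Matrix.mul_assoc, Matrix.mul_assoc, Matrix.nonsing_inv_mul _ hdet,
      Matrix.mul_one]
  have hαi : b (Sum.inl i) = u i - Matrix.mulVec (projBar x) u i := by
    rw [hproj, hu]; simp [hα]
  have hrow : |Matrix.mulVec (projBar x) u i| ≤ c₀ * l2 u := by
    have h1 : ∀ v : Fin n → ℝ, Matrix.mulVec (projBar x) v i ≤ l2 (projBar x i) * l2 v :=
      fun v => sum_mul_le_l2 (projBar x i) v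
    have h2 : l2 (projBar x i) ≤ c₀ := (le_ciSup
      (f := fun i => ‖(WithLp.toLp 2 (projBar x i) : EuclideanSpace ℝ (Fin n))‖)
      (Set.finite_range _).bddAbove i).trans hinc
    have h3 := mul_le_mul_of_nonneg_right h2 (l2_nonneg u)
    refine abs_le.mpr ⟨?_, (h1 u).trans h3⟩
    have h4 := h1 (-u)
    rw [Matrix.mulVec_neg, Pi.neg_apply, l2_neg] at h4
    linarith
  rw [hαi]
  exact (abs_sub _ _).trans (add_le_add (abs_apply_le_norm u i) hrow)

end Coordinates

/-! ### Minimizers and flow equations -/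

section Minimizers

/-- The strict tangent inequality of the logistic loss. -/
lemma log_one_add_exp_tangent_lt {t t' : ℝ} (h : t' ≠ t) :
    Real.log (1 + Real.exp t) + Real.sigmoid t * (t' - t) < Real.log (1 + Real.exp t') := by
  have h1 := strictConvexOn_exp.2 (Set.mem_univ 0) (Set.mem_univ (t' - t))
    (sub_ne_zero.mpr h).symm (sub_pos.mpr (Real.sigmoid_lt_one t)) (Real.sigmoid_pos t) (by ring)
  simp only [smul_eq_mul, mul_zero, zero_add, Real.exp_zero, mul_one] at h1
  have h2 : (1 + Real.exp t) * (1 - Real.sigmoid t + Real.sigmoid t * Real.exp (t' - t))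
      = 1 + Real.exp t' := by
    have h3 := Real.exp_pos t
    rw [Real.sigmoid_def, Real.exp_neg, Real.exp_sub]
    field_simp
    ring
  rw [← h2, Real.log_mul (by positivity) (by linarith [Real.exp_pos (Real.sigmoid t * (t' - t))])]
  have h4 := Real.log_lt_log (Real.exp_pos _) h1
  rw [Real.log_exp] at h4
  linarith

lemma hasDerivAt_log_one_add_exp (t : ℝ) :
    HasDerivAt (fun t => Real.log (1 + Real.exp t)) (Real.sigmoid t) t := by
  have h := ((Real.hasDerivAt_exp t).const_add 1).log (by positivity)
  convert h using 1
  have h3 := Real.exp_pos t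
  rw [Real.sigmoid_def, Real.exp_neg]
  field_simp
  ring

variable {n d L : ℕ} {x : Fin n → EuclideanSpace ℝ (Fin d)}

lemma adj_pair (z : Idx n L → Bool) (q : Pair n) :
    adj z q.1.1 q.1.2 = boolVal (z (Sum.inl q)) := by
  rw [adj_of_ne z q.2.ne', pairOf_of_lt q.2]

lemma dev_pair (s : Fin n → ℝ) (z : Idx n L → Bool) (q : Pair n) :
    dev s z q.1.1 q.1.2 = pairDev s z q := by
  rw [dev, dif_neg q.2.ne', pairOf_of_lt q.2, orient, if_pos q.2, one_mul]

/-- The flow equation is the stationarity condition for a sum of strictly convex functions of the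
score differences over the edges; on a graph with a spectral gap, its solution gives the unique
minimizer. -/
lemma isArgmin_of_flow {c₂ : ℝ} (hn : 0 < n) (hc₂ : 0 < c₂)
    (hlam : c₂ * n ≤ lambdaMinOn (paramSpace x) (sigmaMat x)) {z : Idx n L → Bool} {μ : ℝ}
    (hμ : 0 < μ) (hgap : IsGapGraph (adj z) μ) {w : Fin n → Fin n → ℝ} {φ : Fin n → Fin n → ℝ → ℝ}
    (hφ : IsLink w φ) {F : Param n d → ℝ} {f f' : Pair n → ℝ → ℝ}
    (hF : ∀ b, F b = ∑ q : Pair n,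
      if z (Sum.inl q) then f q (score x b q.1.1 - score x b q.1.2) else 0)
    (hf : ∀ q t t', t' ≠ t → f q t + f' q t * (t' - t) < f q t') {s δ : Fin n → ℝ}
    (hδ : ∀ i, flow (adj z) φ δ i = noise (adj z) (dev s z) i) {b₀ : Param n d}
    (hb₀ : b₀ ∈ paramSpace x) {c : ℝ} (hs : ∀ i, score x b₀ i = s i + δ i + c)
    (hf' : ∀ q : Pair n, f' q (s q.1.1 - s q.1.2 + (δ q.1.1 - δ q.1.2))
      = φ q.1.1 q.1.2 (δ q.1.1 - δ q.1.2) - pairDev s z q) :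
    IsArgmin F (paramSpace x) b₀ ∧ ∀ b, IsArgmin F (paramSpace x) b → b = b₀ := by
  set D : Param n d → Pair n → ℝ := fun b q => score x b q.1.1 - score x b q.1.2 with hD
  have hD₀ : ∀ q, D b₀ q = s q.1.1 - s q.1.2 + (δ q.1.1 - δ q.1.2) := fun q => by
    simp only [hD]
    rw [hs, hs]; ring
  -- The gradient at `b₀` vanishes in the direction of every parameter.
  have hstat : ∀ b, ∑ q : Pair n,
      (if z (Sum.inl q) then f' q (D b₀ q) * (D b q - D b₀ q) else 0) = 0 := by
    intro b
    set v : Fin n → ℝ := fun i => score x b i - score x b₀ i with hv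
    set G : Fin n → Fin n → ℝ := fun i j => adj z i j * (φ i j (δ i - δ j) - dev s z i j) with hG
    have hanti : ∀ i j, G j i = -G i j := fun i j => by
      simp only [hG]
      rw [mul_sub, flow_antisymm hφ (adj_symm z), dev_symm s z i j, adj_symm z j i]; ring
    have h1 := sum_mul_sum_antisymm hanti v
    have h2 : ∀ i, ∑ j, G i j = 0 := fun i => by
      have := hδ i
      rw [flow, noise] at this
      simp only [hG, mul_sub]
      rw [Finset.sum_sub_distrib, this, sub_self]
    simp only [h2, mul_zero, Finset.sum_const_zero] at h1
    have h3 := sum_sum_eq_sum_pair (f := fun i j => G i j * (v i - v j)) (fun i => by simp)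
    rw [h3] at h1
    have h4 : ∑ q : Pair n, (G q.1.1 q.1.2 * (v q.1.1 - v q.1.2)
        + G q.1.2 q.1.1 * (v q.1.2 - v q.1.1)) = 2 * ∑ q : Pair n,
          (if z (Sum.inl q) then f' q (D b₀ q) * (D b q - D b₀ q) else 0) := by
      rw [Finset.mul_sum]
      refine Finset.sum_congr rfl fun q _ => ?_
      rw [hanti q.1.1 q.1.2, hD₀, hf']
      have h5 : G q.1.1 q.1.2 = boolVal (z (Sum.inl q))
          * (φ q.1.1 q.1.2 (δ q.1.1 - δ q.1.2) - pairDev s z q) := by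
        simp only [hG]
        rw [adj_pair, dev_pair]
      have h6 : v q.1.1 - v q.1.2
          = D b q - (s q.1.1 - s q.1.2 + (δ q.1.1 - δ q.1.2)) := by
        rw [← hD₀]; simp only [hv, hD]; ring
      have h7 : v q.1.2 - v q.1.1 = -(v q.1.1 - v q.1.2) := by ring
      rw [h7, h6, h5, boolVal]
      split_ifs <;> ring
    rw [h4] at h1
    linarith
  -- The gap between `F` and its tangent at `b₀`.
  set R : Param n d → Pair n → ℝ := fun b q => if z (Sum.inl q) then
    f q (D b q) - f q (D b₀ q) - f' q (D b₀ q) * (D b q - D b₀ q) else 0 with hR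
  have hRpos : ∀ b q, z (Sum.inl q) = true → D b q ≠ D b₀ q → 0 < R b q := fun b q hz hne => by
    simp only [hR, hz, if_true]
    linarith [hf q _ _ hne]
  have hRnn : ∀ b q, 0 ≤ R b q := fun b q => by
    by_cases hz : z (Sum.inl q) = true
    · by_cases hne : D b q = D b₀ q
      · simp [hR, hne]
      · exact (hRpos b q hz hne).le
    · simp [hR, hz]
  have hFR : ∀ b, F b = F b₀ + ∑ q, R b q := fun b => by
    have h1 := hstat b
    have h2 : ∑ q, R b q = ∑ q : Pair n, (if z (Sum.inl q) then f q (D b q) else 0)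
        - ∑ q : Pair n, (if z (Sum.inl q) then f q (D b₀ q) else 0) - ∑ q : Pair n,
      (if z (Sum.inl q) then f' q (D b₀ q) * (D b q - D b₀ q) else 0) := by
      rw [← Finset.sum_sub_distrib, ← Finset.sum_sub_distrib]
      refine Finset.sum_congr rfl fun q _ => ?_
      simp only [hR]
      split_ifs <;> ring
    rw [h2, h1, hF b, hF b₀]
    ring
  have hmin : IsArgmin F (paramSpace x) b₀ := ⟨hb₀, fun b _ => by
    rw [Set.mem_ofPred_eq, hFR b]
    linarith [Finset.sum_nonneg fun q (_ : q ∈ Finset.univ) => hRnn b q]⟩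
  refine ⟨hmin, fun b hb => ?_⟩
  have hle : F b ≤ F b₀ := hb.2 hb₀
  have hzero : ∀ q, R b q = 0 := by
    have h1 : ∑ q, R b q = 0 := le_antisymm (by linarith [hFR b])
      (Finset.sum_nonneg fun q _ => hRnn b q)
    exact fun q => (Finset.sum_eq_zero_iff_of_nonneg fun q _ => hRnn b q).mp h1 q (Finset.mem_univ q)
  have hedge : ∀ q, z (Sum.inl q) = true → D b q = D b₀ q := fun q hz => by
    by_contra hne
    exact (hRpos b q hz hne).ne' (hzero q)
  set v : Fin n → ℝ := fun i => score x b i - score x b₀ i with hv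
  have henergy : ∑ i, ∑ j, adj z i j * (v i - v j) ^ 2 = 0 := by
    rw [sum_sum_eq_sum_pair fun i => by simp]
    refine Finset.sum_eq_zero fun q _ => ?_
    rw [adj_symm z q.1.2, adj_pair, boolVal]
    split_ifs with hz
    · have h1 : v q.1.1 - v q.1.2 = D b q - D b₀ q := by simp only [hv, hD]; ring
      have h2 : v q.1.2 - v q.1.1 = -(v q.1.1 - v q.1.2) := by ring
      rw [h2, h1, hedge q hz]; ring
    · ring
  have hn' : (n : ℝ) ≠ 0 := by exact_mod_cast hn.ne'
  set m := (∑ i, v i) / n with hm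
  have hgap' := hgap.gap (fun i => v i - m) (by
    rw [Finset.sum_sub_distrib, Finset.sum_const, Finset.card_univ, Fintype.card_fin, nsmul_eq_mul,
      hm]
    field_simp
    ring)
  have h1 : ∑ i, ∑ j, adj z i j * ((v i - m) - (v j - m)) ^ 2 = 0 := by
    simpa only [sub_sub_sub_cancel_right] using henergy
  rw [h1] at hgap'
  have h2 : ∑ i, (v i - m) ^ 2 = 0 := le_antisymm (by
    by_contra hpos
    exact absurd hgap' (not_le.mpr (mul_pos hμ (not_le.mp hpos))))
    (Finset.sum_nonneg fun i _ => sq_nonneg _)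
  refine eq_of_score_sub_eq hn hc₂ hlam hb.1 hb₀ (c := m) fun i => ?_
  have h3 := (Finset.sum_eq_zero_iff_of_nonneg fun i _ => sq_nonneg (v i - m)).mp h2 i
    (Finset.mem_univ i)
  have h4 := pow_eq_zero_iff two_ne_zero |>.mp h3
  simp only [hv] at h4
  linarith

/-- The score difference of a pair, as a linear functional. -/
def scoreDiff (x : Fin n → EuclideanSpace ℝ (Fin d)) (q : Pair n) : Param n d →L[ℝ] ℝ :=
  innerSL ℝ (lift x q.1.1 - lift x q.1.2)

lemma scoreDiff_apply (q : Pair n) (b : Param n d) :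
    scoreDiff x q b = score x b q.1.1 - score x b q.1.2 := by
  rw [scoreDiff, innerSL_apply_apply, inner_sub_left]; rfl

/-- The loss of a pair, as a function of the score difference. -/
def pairLoss (e : Pair n → Bool) (y : Pair n → Fin L → Bool) (q : Pair n) (t : ℝ) : ℝ :=
  if e q then -(meanOutcome y q) * t + Real.log (1 + Real.exp t) else 0

lemma quadExpansion_loss (e : Pair n → Bool) (y : Pair n → Fin L → Bool) (a b : Param n d) :
    quadExpansion (loss x e y) a b = ∑ q : Pair n, if e q then
      (-(meanOutcome y q) * (score x a q.1.1 - score x a q.1.2)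
          + Real.log (1 + Real.exp (score x a q.1.1 - score x a q.1.2)))
        + (Real.sigmoid (score x a q.1.1 - score x a q.1.2) - meanOutcome y q)
          * ((score x b q.1.1 - score x b q.1.2) - (score x a q.1.1 - score x a q.1.2))
        + 1 / 2 * sigmoidDeriv (score x a q.1.1 - score x a q.1.2)
          * ((score x b q.1.1 - score x b q.1.2) - (score x a q.1.1 - score x a q.1.2)) ^ 2
      else 0 := by
  set g' : Pair n → ℝ → ℝ := fun q t =>
    if e q then -(meanOutcome y q) + Real.sigmoid t else 0 with hg'
  set g'' : Pair n → ℝ → ℝ := fun q t => if e q then sigmoidDeriv t else 0 with hg''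
  have hd1 : ∀ q t, HasDerivAt (pairLoss e y q) (g' q t) t := fun q t => by
    unfold pairLoss
    simp only [hg']
    split_ifs
    · have h := ((hasDerivAt_id t).const_mul (-(meanOutcome y q))).add
        (hasDerivAt_log_one_add_exp t)
      rw [mul_one] at h
      exact h
    · exact hasDerivAt_const t 0
  have hd2 : ∀ q t, HasDerivAt (g' q) (g'' q t) t := fun q t => by
    simp only [hg', hg'']
    split_ifs
    · exact (Real.hasDerivAt_sigmoid t).const_add _
    · exact hasDerivAt_const t 0
  have hloss : loss x e y = fun b => ∑ q, pairLoss e y q (scoreDiff x q b) := by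
    funext b
    simp only [loss, pairLoss, scoreDiff_apply]
  have hf1 : ∀ b, HasFDerivAt (loss x e y) (∑ q, g' q (scoreDiff x q b) • scoreDiff x q) b := by
    intro b
    rw [hloss]
    exact HasFDerivAt.fun_sum fun q _ =>
      (hd1 q _).comp_hasFDerivAt b (scoreDiff x q).hasFDerivAt
  have hf1' : fderiv ℝ (loss x e y) = fun b => ∑ q, g' q (scoreDiff x q b) • scoreDiff x q :=
    funext fun b => (hf1 b).fderiv
  have hf2 : HasFDerivAt (fderiv ℝ (loss x e y))
      (∑ q, (g'' q (scoreDiff x q a) • scoreDiff x q).smulRight (scoreDiff x q)) a := by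
    rw [hf1']
    exact HasFDerivAt.fun_sum fun q _ =>
      ((hd2 q _).comp_hasFDerivAt a (scoreDiff x q).hasFDerivAt).smul_const (scoreDiff x q)
  have hτ : ∀ q, scoreDiff x q (b - a)
      = (score x b q.1.1 - score x b q.1.2) - (score x a q.1.1 - score x a q.1.2) := fun q => by
    rw [map_sub, scoreDiff_apply, scoreDiff_apply]
  rw [quadExpansion, hf2.fderiv, (hf1 a).fderiv, hloss]
  simp only [sum_apply, smul_apply, ContinuousLinearMap.smulRight_apply, smul_eq_mul, hτ]
  rw [Finset.mul_sum, ← Finset.sum_add_distrib, ← Finset.sum_add_distrib]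
  refine Finset.sum_congr rfl fun q _ => ?_
  simp only [pairLoss, hg', hg'', scoreDiff_apply]
  split_ifs <;> ring

/-- The minimizer of the loss, from the solution of the flow equation with logistic links. The
solution has to be small, because the logistic links are linear away from the origin. -/
lemma isArgmin_loss {c₂ : ℝ} (hn : 0 < n) (hc₂ : 0 < c₂)
    (hlam : c₂ * n ≤ lambdaMinOn (paramSpace x) (sigmaMat x)) {z : Idx n L → Bool} {μ : ℝ}
    (hμ : 0 < μ) (hgap : IsGapGraph (adj z) μ) {s δ : Fin n → ℝ}
    (hδ : IsSol (adj z) (logisticLink s) (noise (adj z) (dev s z)) δ) (hsmall : 2 * ‖δ‖ ≤ 1)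
    {b₀ : Param n d} (hb₀ : b₀ ∈ paramSpace x) {c : ℝ} (hs : ∀ i, score x b₀ i = s i + δ i + c) :
    IsArgmin (loss x (fun q => z (Sum.inl q)) (fun q l => z (Sum.inr (q, l)))) (paramSpace x) b₀ ∧
    ∀ b, IsArgmin (loss x (fun q => z (Sum.inl q)) (fun q l => z (Sum.inr (q, l)))) (paramSpace x) b
      → b = b₀ := by
  refine isArgmin_of_flow hn hc₂ hlam hμ hgap (isLink_logisticLink s) (fun b => rfl)
    (f := fun q t => -(meanOutcome (fun q l => z (Sum.inr (q, l))) q) * t + Real.log (1 + Real.exp t))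
    (f' := fun q t => -(meanOutcome (fun q l => z (Sum.inr (q, l))) q) + Real.sigmoid t)
    (fun q t t' h => ?_) hδ.2 hb₀ hs fun q => ?_
  · have := log_one_add_exp_tangent_lt h
    linarith
  · have h1 : |δ q.1.1 - δ q.1.2| ≤ 1 := by
      have := abs_sub (δ q.1.1) (δ q.1.2)
      linarith [abs_apply_le_norm δ q.1.1, abs_apply_le_norm δ q.1.2]
    rw [logisticLink_of_abs_le s _ _ h1, pairDev]
    ring

/-- The minimizer of the second-order expansion of the loss, from the solution of the linearized
flow equation. -/
lemma isArgmin_quadExpansion {c₂ : ℝ} (hn : 0 < n) (hc₂ : 0 < c₂)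
    (hlam : c₂ * n ≤ lambdaMinOn (paramSpace x) (sigmaMat x)) {z : Idx n L → Bool} {μ : ℝ}
    (hμ : 0 < μ) (hgap : IsGapGraph (adj z) μ) {a : Param n d} {δ : Fin n → ℝ}
    (hδ : IsSol (adj z) (linearLink (logisticWeight (score x a)))
      (noise (adj z) (dev (score x a) z)) δ)
    {b₀ : Param n d} (hb₀ : b₀ ∈ paramSpace x) {c : ℝ}
    (hs : ∀ i, score x b₀ i = score x a i + δ i + c) :
    IsArgmin (quadExpansion (loss x (fun q => z (Sum.inl q)) (fun q l => z (Sum.inr (q, l)))) a)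
      (paramSpace x) b₀ ∧
    ∀ b, IsArgmin (quadExpansion (loss x (fun q => z (Sum.inl q)) (fun q l => z (Sum.inr (q, l)))) a)
      (paramSpace x) b → b = b₀ := by
  set y : Pair n → Fin L → Bool := fun q l => z (Sum.inr (q, l)) with hy
  set D : Pair n → ℝ := fun q => score x a q.1.1 - score x a q.1.2 with hD
  refine isArgmin_of_flow hn hc₂ hlam hμ hgap
    (isLink_linearLink (fun i j => (logisticWeight_pos _ i j).le) (logisticWeight_symm _))
    (fun b => quadExpansion_loss _ y a b)
    (f := fun q t => (-(meanOutcome y q) * D q + Real.log (1 + Real.exp (D q)))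
      + (Real.sigmoid (D q) - meanOutcome y q) * (t - D q)
      + 1 / 2 * sigmoidDeriv (D q) * (t - D q) ^ 2)
    (f' := fun q t => Real.sigmoid (D q) - meanOutcome y q + sigmoidDeriv (D q) * (t - D q))
    (fun q t t' h => ?_) hδ.2 hb₀ hs fun q => ?_
  · have h1 : 0 < sigmoidDeriv (D q) * (t' - t) ^ 2 :=
      mul_pos (sigmoidDeriv_pos _) (by have := sub_ne_zero.mpr h; positivity)
    linarith
  · simp only [hD, pairDev, linearLink, logisticWeight, hy]
    ring

end Minimizers

/-! ### The estimates on a typical configuration -/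

section Estimates

variable {n d L : ℕ} {x : Fin n → EuclideanSpace ℝ (Fin d)} {a : Param n d}

lemma exp_score_sub_le_kappa (i j : Fin n) :
    Real.exp (score x a i - score x a j) ≤ kappa x a := by
  have : Nonempty (Fin n) := ⟨i⟩
  obtain ⟨k, hk⟩ := exists_eq_ciInf_of_finite (f := fun i => Real.exp (score x a i))
  have hpos : 0 < ⨅ i, Real.exp (score x a i) := hk ▸ Real.exp_pos _
  rw [Real.exp_sub, kappa]
  exact div_le_div₀ ((Real.exp_pos _).le.trans
      (le_ciSup (Set.finite_range fun i => Real.exp (score x a i)).bddAbove i))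
    (le_ciSup (Set.finite_range fun i => Real.exp (score x a i)).bddAbove i) hpos
    (ciInf_le (Set.finite_range fun i => Real.exp (score x a i)).bddBelow j)

lemma one_le_kappa (hn : 0 < n) : 1 ≤ kappa x a := by
  simpa using exp_score_sub_le_kappa (x := x) (a := a) ⟨0, hn⟩ ⟨0, hn⟩

lemma one_div_kappa_le_logisticWeight (i j : Fin n) :
    1 / (4 * kappa x a) ≤ logisticWeight (score x a) i j := by
  have h1 : Real.exp |score x a i - score x a j| ≤ kappa x a := by
    rcases abs_choice (score x a i - score x a j) with h | h <;> rw [h]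
    · exact exp_score_sub_le_kappa i j
    · rw [neg_sub]
      exact exp_score_sub_le_kappa j i
  refine le_trans ?_ (exp_neg_abs_mul_le_sigmoidDeriv _)
  rw [Real.exp_neg, ← one_div, div_div, mul_comm]
  exact one_div_le_one_div_of_le (by positivity) (by linarith)

/-- On a typical configuration, the minimizers exist and are unique, and their distance is
controlled by the comparison of the nonlinear with the linear flow equation. -/
lemma GoodConfig.argmin_estimate {g κ p A b r sn c₁ c₂ : ℝ} {z : Idx n L → Bool} (hn0 : 0 < n)
    (hL : 1 ≤ L) (hr : r = b / (A * √L)) (hp : Admissible g κ p A b r sn) (hg : 4608 ≤ g)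
    (hn : √(n : ℝ) = sn) (hw : ∀ i j, 1 / (4 * κ) ≤ logisticWeight (score x a) i j)
    (hsmall : 2 * (2500 * g * (κ * √κ * r)) ≤ 1) (hc₂ : 0 < c₂)
    (hlam : c₂ * n ≤ lambdaMinOn (paramSpace x) (sigmaMat x))
    (hc₁ : 0 ≤ c₁) (hinc : twoInftyNorm (projBar x) ≤ c₁)
    (hG : GoodConfig p A b sn (score x a) z) :
    (∃! bM, IsArgmin (loss x (fun q => z (Sum.inl q)) (fun q l => z (Sum.inr (q, l))))
      (paramSpace x) bM) ∧
    (∃! bbar, IsArgmin (quadExpansion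
      (loss x (fun q => z (Sum.inl q)) (fun q l => z (Sum.inr (q, l)))) a) (paramSpace x) bbar) ∧
    ∀ bM bbar,
      IsArgmin (loss x (fun q => z (Sum.inl q)) (fun q l => z (Sum.inr (q, l)))) (paramSpace x) bM →
      IsArgmin (quadExpansion (loss x (fun q => z (Sum.inl q)) (fun q l => z (Sum.inr (q, l)))) a)
        (paramSpace x) bbar →
      ‖bM - bbar‖ ≤ 10 ^ 8 * g ^ 3 * (κ ^ 4 * r ^ 2 * sn) / √c₂ ∧
      ∀ i, |bM (Sum.inl i) - bbar (Sum.inl i)|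
        ≤ 10 ^ 8 * g ^ 3 * (κ ^ 4 * (r ^ 2 + r / A + r * b ^ 2 / A ^ 2))
          + c₁ * (10 ^ 8 * g ^ 3 * (κ ^ 4 * r ^ 2 * sn)) := by
  set s := score x a with hs
  have hreg := hG.regular hL hr hp hg hn hw
  have hlink := isLink_logisticLink s
  have hlin := isLink_linearLink (fun i j => (logisticWeight_pos s i j).le) (logisticWeight_symm s)
  obtain ⟨δ, hδ⟩ := hreg.exists_sol hp hlink
  obtain ⟨δb, hδb⟩ := hreg.exists_sol hp hlin
  obtain ⟨e1, e2, e3⟩ := hreg.newton_error hp hlink (abs_logisticLink_sub_le s) hδ hδb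
    (δ' := looSol p s (logisticLink s) z) (δb' := looSol p s (linearLink (logisticWeight s)) z)
    (fun m => sol_spec (hreg.exists_looSol hp hlink m))
    (fun m => sol_spec (hreg.exists_looSol hp hlin m)) hG.row_loo
  have hμ : 0 < 24 * A ^ 2 / g := by
    have := hp.A_pos; have := hp.one_le_g; positivity
  obtain ⟨b₁, hb₁, k₁, hk₁⟩ := exists_score_eq hn0 hc₂ hlam (s + δ)
  obtain ⟨b₂, hb₂, k₂, hk₂⟩ := exists_score_eq hn0 hc₂ hlam (s + δb)
  obtain ⟨m₁, u₁⟩ := isArgmin_loss hn0 hc₂ hlam hμ hreg.gap hδ (by linarith) hb₁ hk₁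
  obtain ⟨m₂, u₂⟩ := isArgmin_quadExpansion hn0 hc₂ hlam hμ hreg.gap hδb hb₂ hk₂
  refine ⟨⟨b₁, m₁, u₁⟩, ⟨b₂, m₂, u₂⟩, fun bM bbar hM hbar => ?_⟩
  rw [u₁ bM hM, u₂ bbar hbar]
  have hdiff := paramSpace_sub hb₁ hb₂
  have hsc : ∀ i, score x (b₁ - b₂) i = (δ - δb) i + (k₁ - k₂) := fun i => by
    rw [score_sub, hk₁, hk₂]
    simp only [Pi.add_apply, Pi.sub_apply]; ring
  have hsum : ∑ i, (δ - δb) i = 0 := by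
    simp only [Pi.sub_apply, Finset.sum_sub_distrib]
    rw [hδ.1, hδb.1, sub_self]
  refine ⟨(norm_le_of_score_eq hn0 hc₂ hlam hdiff hsum hsc).trans
    (div_le_div_of_nonneg_right e2 (Real.sqrt_nonneg _)), fun i => ?_⟩
  have h1 := abs_inl_le_of_score_eq hn0 hc₂ hlam hinc hdiff hsc i
  exact h1.trans (add_le_add e3 (mul_le_mul_of_nonneg_left e2 hc₁))

end Estimates

/-! ### Admissibility of the parameters and the probabilistic bound -/

section Parameters

variable {n L : ℕ} {p κ m c CB : ℝ}

/-- If `c` is small, the smallness conditions make the parameters admissible, for the spectral gap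
constant `4608`, and the solution of the flow equation small. They also exclude small `n`. The
numbers are `23040000 = 5000 * 4608` and its double `10000 * 4608`. -/
lemma admissible_of_small (hn : 2 ≤ n) (hL : 1 ≤ L) (hp : 0 < p) (hp1 : p ≤ 1) (hκ : 1 ≤ κ)
    (hm : 1 ≤ m) (hc : 0 < c) (hcH : 23040000 ^ 4 * c ≤ 1) (hcCB : 23040000 ^ 4 * (CB ^ 2 * c) ≤ 1)
    (h1 : κ ^ 2 * √(m * Real.log n / (n * p * L)) ≤ CB)
    (h2 : κ ^ 2 * (√(m / (n * p)) + Real.log n / (n * p)) ≤ c) :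
    Admissible 4608 κ p √(n * p) √(Real.log n) (√(Real.log n) / (√(n * p) * √L)) √n ∧
    2 * (2500 * 4608 * (κ * √κ * (√(Real.log n) / (√(n * p) * √L)))) ≤ 1 ∧
    512 * √(Real.log n) ^ 2 ≤ √(n * p) ^ 2 ∧ 4 ≤ n := by
  have hn' : (2 : ℝ) ≤ n := by exact_mod_cast hn
  have hL' : (1 : ℝ) ≤ L := by exact_mod_cast hL
  have hnp : 0 < n * p := by positivity
  have hlog : 1 / 2 ≤ Real.log n :=
    (by linarith [Real.log_two_gt_d9] : (1 / 2 : ℝ) ≤ Real.log 2).trans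
      (Real.log_le_log (by norm_num) hn')
  set A := √(n * p) with hA
  set b := √(Real.log n) with hb
  set l := √(L : ℝ) with hl
  set sn := √(n : ℝ) with hsn
  have hA0 : 0 < A := Real.sqrt_pos.mpr hnp
  have hA2 : A ^ 2 = n * p := Real.sq_sqrt hnp.le
  have hb0 : 0 < b := Real.sqrt_pos.mpr (by linarith)
  have hb2 : b ^ 2 = Real.log n := Real.sq_sqrt (by linarith)
  have hl1 : 1 ≤ l := Real.one_le_sqrt.mpr hL'
  have hl2 : l ^ 2 = L := Real.sq_sqrt (by linarith)
  have hsn0 : 0 < sn := Real.sqrt_pos.mpr (by linarith)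
  have hsn2 : sn ^ 2 = n := Real.sq_sqrt (by linarith)
  have hκ2 : κ ≤ κ ^ 2 := by nlinarith
  rw [Real.sqrt_div (by linarith), ← hA, ← hb2, ← hA2] at h2
  have hsm : 1 ≤ √m := Real.one_le_sqrt.mpr hm
  have f0 : 0 ≤ κ ^ 2 * (√m / A) := by positivity
  have f1 : κ ^ 2 * b ^ 2 / A ^ 2 ≤ c := by
    have : κ ^ 2 * (√m / A + b ^ 2 / A ^ 2) = κ ^ 2 * (√m / A) + κ ^ 2 * b ^ 2 / A ^ 2 := by ring
    linarith
  have f2 : κ / A ≤ c := by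
    have e1 : 0 ≤ κ ^ 2 * b ^ 2 / A ^ 2 := by positivity
    have e2 : κ ^ 2 * (√m / A + b ^ 2 / A ^ 2) = κ ^ 2 * (√m / A) + κ ^ 2 * b ^ 2 / A ^ 2 := by ring
    have e3 : κ / A ≤ κ ^ 2 * √m / A := by
      gcongr
      calc κ ≤ κ ^ 2 := hκ2
        _ ≤ κ ^ 2 * √m := le_mul_of_one_le_right (by positivity) hsm
    have e4 : κ ^ 2 * √m / A = κ ^ 2 * (√m / A) := by ring
    linarith
  have f3 : κ * b / A ≤ √c := by
    refine Real.le_sqrt_of_sq_le ?_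
    rw [div_pow, mul_pow]; exact f1
  have hc1 : c ≤ 1 / 23040000 ^ 4 := by
    rw [le_div_iff₀ (by norm_num)]; linarith
  have f4 : √c ≤ 1 / 46080000 := by
    refine Real.sqrt_le_iff.mpr ⟨by norm_num, hc1.trans (by norm_num)⟩
  have f5 : b ≤ A / 46080000 := by
    have e1 : b / A ≤ κ * b / A := by
      gcongr; exact le_mul_of_one_le_left hb0.le hκ
    have e2 := (e1.trans f3).trans f4
    rw [div_le_iff₀ hA0] at e2
    linarith
  have hb7 : 7 / 10 ≤ b := Real.le_sqrt_of_sq_le (by linarith)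
  have hAsn : A ≤ sn := Real.sqrt_le_sqrt (mul_le_of_le_one_right (by linarith) hp1)
  have hr0 : 0 < b / (A * l) := by positivity
  have f6 : κ ^ 2 * (b / (A * l)) ^ 2 ≤ c := by
    refine le_trans ?_ f1
    rw [div_pow, mul_pow, mul_div_assoc]
    gcongr
    exact le_mul_of_one_le_right (by positivity) (one_le_pow₀ hl1)
  have f7 : κ ^ 4 * (b / (A * l)) ^ 2 ≤ CB ^ 2 := by
    have e1 : κ ^ 2 * (b / (A * l)) ≤ κ ^ 2 * √(m * Real.log n / (n * p * L)) := by
      refine mul_le_mul_of_nonneg_left (Real.le_sqrt_of_sq_le ?_) (by positivity)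
      rw [div_pow, mul_pow, hb2, hA2, hl2]
      gcongr
      exact le_mul_of_one_le_left (by linarith) hm
    have e2 := pow_le_pow_left₀ (by positivity) (e1.trans h1) 2
    calc _ = (κ ^ 2 * (b / (A * l))) ^ 2 := by ring
      _ ≤ _ := e2
  refine ⟨⟨by norm_num, hκ, hA0, hb7, by linarith, hr0, hAsn, by rw [hsn2]; exact hn', ?_, ?_, ?_,
    ?_⟩, ?_, ?_, ?_⟩
  · rw [hA2, hsn2]; field_simp
  · linarith
  · linarith
  · have e1 : κ * b ^ 2 / A ^ 2 ≤ κ ^ 2 * b ^ 2 / A ^ 2 := by gcongr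
    linarith
  · -- The fourth power of `κ √κ r` is `(κ² r²) (κ⁴ r²)`.
    set r := b / (A * l) with hr
    have e1 : (23040000 * (κ * √κ * r)) ^ 4 ≤ 1 ^ 4 := by
      have e2 : (κ * √κ * r) ^ 4 = (κ ^ 4 * r ^ 2) * (κ ^ 2 * r ^ 2) := by
        have : √κ ^ 4 = κ ^ 2 := by
          rw [show (4 : ℕ) = 2 * 2 from rfl, pow_mul, Real.sq_sqrt (by linarith)]
        rw [mul_pow, mul_pow, this]; ring
      have e3 : (κ ^ 4 * r ^ 2) * (κ ^ 2 * r ^ 2) ≤ CB ^ 2 * c := by gcongr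
      rw [mul_pow, e2]
      calc _ ≤ 23040000 ^ 4 * (CB ^ 2 * c) := by gcongr
        _ ≤ 1 ^ 4 := by rw [one_pow]; exact hcCB
    have e4 := le_of_pow_le_pow_left₀ (by norm_num) zero_le_one e1
    linarith
  · have e1 := pow_le_pow_left₀ hb0.le f5 2
    linarith only [e1, sq_nonneg A]
  · by_contra hlt
    have h3 : (n : ℝ) ≤ 3 := by exact_mod_cast (by omega : n ≤ 3)
    have e1 : A ^ 2 ≤ 3 := by
      rw [hA2]
      exact (mul_le_of_le_one_right (by linarith) hp1).trans h3
    have e2 : 2 ≤ A := by linarith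
    nlinarith only [e1, e2]

/-- The sup norm bound for the scores and the error of the projection, in the form of the theorem,
with `q = √(d + 1)`. -/
lemma sup_bound_le {κ r A b q c₀ Λ : ℝ} (hκ : 1 ≤ κ) (hq : 1 ≤ q) (hr : 0 ≤ r) (hA : 0 < A)
    (hc₀ : 0 ≤ c₀) (hΛ : 0 ≤ Λ) :
    Λ * (κ ^ 4 * (r ^ 2 + r / A + r * b ^ 2 / A ^ 2)) + Λ * c₀ * (κ ^ 4 * (q * r ^ 2))
      ≤ Λ * (1 + c₀) * (κ ^ 6 * (q ^ 2 * r ^ 2)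
        + κ ^ 4 / A ^ 2 * (q * (r * A)) * (q + b ^ 2 / A)) := by
  have hκ0 : 0 ≤ κ := zero_le_one.trans hκ
  have hq0 : 0 ≤ q := zero_le_one.trans hq
  have e3 : κ ^ 4 ≤ κ ^ 6 := pow_le_pow_right₀ hκ (by norm_num)
  have e4 : q ≤ q ^ 2 := le_self_pow₀ hq two_ne_zero
  have e5 : κ ^ 4 / A ^ 2 * (q * (r * A)) * (q + b ^ 2 / A)
      = κ ^ 4 * (q ^ 2 * (r / A)) + κ ^ 4 * (q * (r * b ^ 2 / A ^ 2)) := by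
    field_simp
  have q1 : κ ^ 4 * (q * r ^ 2) ≤ κ ^ 6 * (q ^ 2 * r ^ 2) := by gcongr
  have q2 : κ ^ 4 * r ^ 2 ≤ κ ^ 6 * (q ^ 2 * r ^ 2) := by
    gcongr
    exact le_mul_of_one_le_left (by positivity) (one_le_pow₀ hq)
  have q3 : κ ^ 4 * (r / A) ≤ κ ^ 4 * (q ^ 2 * (r / A)) := by
    gcongr
    exact le_mul_of_one_le_left (by positivity) (one_le_pow₀ hq)
  have q4 : κ ^ 4 * (r * b ^ 2 / A ^ 2) ≤ κ ^ 4 * (q * (r * b ^ 2 / A ^ 2)) := by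
    gcongr
    exact le_mul_of_one_le_left (by positivity) hq
  rw [e5]
  have hY : 0 ≤ κ ^ 4 * (q ^ 2 * (r / A)) + κ ^ 4 * (q * (r * b ^ 2 / A ^ 2)) := by positivity
  have h1 := mul_le_mul_of_nonneg_left (add_le_add q2 (add_le_add q3 q4)) hΛ
  have h2 := mul_le_mul_of_nonneg_left (q1.trans (le_add_of_nonneg_right hY)) (mul_nonneg hΛ hc₀)
  linarith only [h1, h2]

end Parameters

end CARE

end


theorem theorem2 (c₀ c₁ c₂ cp CD c₄ c₅ CB : ℝ) (hc₀ : 0 < c₀) (hc₁ : 0 < c₁) (hc₂ : 0 < c₂)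
    (hcp : 0 < cp) (hCD : 0 < CD) (hc₄ : 0 < c₄) (hc₅ : 0 < c₅) (hCB : 0 < CB) :
    ∃ c : ℝ, 0 < c ∧ ∃ C : ℝ, 0 < C ∧ ∃ K : ℝ, 0 < K ∧
      ∀ (n d L : ℕ) (p : ℝ) (x : Fin n → EuclideanSpace ℝ (Fin d)) (bstar : CARE.Param n d)
        (Ω : Type*) [MeasurableSpace Ω] (P : Measure Ω) [IsProbabilityMeasure P]
        (E : CARE.Pair n → Ω → Bool) (Y : CARE.Pair n → Fin L → Ω → Bool),
        CARE.IsSample P x bstar p E Y →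
        bstar ∈ CARE.paramSpace x →
        (∀ i, ‖x i‖ ≤ √(((d : ℝ) + 1) / n)) →
        CARE.twoInftyNorm (CARE.projBar x) ≤ c₀ * √(((d : ℝ) + 1) / n) →
        c₂ * n ≤ CARE.lambdaMinOn (CARE.paramSpace x) (CARE.sigmaMat x) →
        CARE.opNorm (CARE.sigmaMat x) ≤ c₁ * n →
        d + 1 < n →
        1 ≤ L →
        0 < p →
        p ≤ 1 →
        cp * Real.log n < n * p →
        ((d : ℝ) + 1) * Real.log n ≤ CD * (n * p) →
        (L : ℝ) ≤ c₄ * (n : ℝ) ^ c₅ →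
        CARE.kappa x bstar ^ 2 * √(((d : ℝ) + 1) * Real.log n / (n * p * L)) ≤ CB →
        CARE.kappa x bstar ^ 2 *
          (√(((d : ℝ) + 1) / (n * p)) + Real.log n / (n * p)) ≤ c →
        1 - K / (n : ℝ) ^ 5 ≤ P.real {ω |
          (∃! bM, CARE.IsArgmin (CARE.loss x (fun q => E q ω) (fun q l => Y q l ω))
            (CARE.paramSpace x) bM) ∧
          (∃! bbar, CARE.IsArgmin (CARE.quadExpansion
            (CARE.loss x (fun q => E q ω) (fun q l => Y q l ω)) bstar)
            (CARE.paramSpace x) bbar) ∧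
          ∀ bM bbar : CARE.Param n d,
            CARE.IsArgmin (CARE.loss x (fun q => E q ω) (fun q l => Y q l ω))
              (CARE.paramSpace x) bM →
            CARE.IsArgmin (CARE.quadExpansion
              (CARE.loss x (fun q => E q ω) (fun q l => Y q l ω)) bstar)
              (CARE.paramSpace x) bbar →
            ‖bM - bbar‖ ≤ C * (CARE.kappa x bstar ^ 4 *
              (√((d : ℝ) + 1) * Real.log n / (√(n : ℝ) * p * L))) ∧
            ‖fun i : Fin n => bM (Sum.inl i) - bbar (Sum.inl i)‖ ≤
              C * (CARE.kappa x bstar ^ 6 * (((d : ℝ) + 1) * Real.log n / (n * p * L)) +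
                CARE.kappa x bstar ^ 4 / (n * p) * √(((d : ℝ) + 1) * Real.log n / L) *
                  (√((d : ℝ) + 1) + Real.log n / √(n * p)))} := by
  set Λ : ℝ := 10 ^ 8 * 4608 ^ 3 with hΛ
  have hΛ0 : 0 < Λ := by norm_num [hΛ]
  have hsc₂ : 0 < √c₂ := Real.sqrt_pos.mpr hc₂
  refine ⟨1 / (23040000 ^ 4 * (1 + CB ^ 2)), by positivity, Λ * (1 + c₀) + Λ / √c₂, by positivity,
    22, by norm_num, ?_⟩
  intro n d L p x bstar Ω _ P _ E Y hS _ _ hinc hlam _ hdn hL hp0 hp1 _ _ _ hB hsmall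
  set c : ℝ := 1 / (23040000 ^ 4 * (1 + CB ^ 2)) with hc
  have hc0 : 0 < c := by positivity
  have hcH : 23040000 ^ 4 * c ≤ 1 := by
    have : 23040000 ^ 4 * c = 1 / (1 + CB ^ 2) := by rw [hc]; field_simp
    rw [this, div_le_one (by positivity)]
    linarith [sq_nonneg CB]
  have hcCB : 23040000 ^ 4 * (CB ^ 2 * c) ≤ 1 := by
    have : 23040000 ^ 4 * (CB ^ 2 * c) = CB ^ 2 / (1 + CB ^ 2) := by rw [hc]; field_simp
    rw [this, div_le_one (by positivity)]
    linarith
  set κ := CARE.kappa x bstar with hκ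
  have hn0 : 0 < n := by omega
  have hκ1 : 1 ≤ κ := CARE.one_le_kappa hn0
  have hn' : (0 : ℝ) < n := by exact_mod_cast hn0
  have hL' : (0 : ℝ) < L := by exact_mod_cast hL
  have hm1 : (1 : ℝ) ≤ (d : ℝ) + 1 := by linarith [(Nat.cast_nonneg d : (0 : ℝ) ≤ d)]
  obtain ⟨hadm, hsm, hAb, hn4⟩ := CARE.admissible_of_small (by omega) hL hp0 hp1 hκ1 hm1 hc0 hcH
    hcCB hB hsmall
  set m : ℝ := (d : ℝ) + 1 with hm
  set A := √(n * p) with hA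
  set b := √(Real.log n) with hb
  set sn := √(n : ℝ) with hsn
  set r := b / (A * √L) with hr
  have hA0 := hadm.A_pos
  have hr0 := hadm.r_pos
  have hsn0 := hadm.sn_pos
  have hb0 : 0 < b := by linarith [hadm.b_ge]
  have hlog0 : 0 ≤ Real.log n := (Real.sqrt_pos.mp hb0).le
  have hA2 : A ^ 2 = n * p := Real.sq_sqrt (by positivity)
  have hb2 : b ^ 2 = Real.log n := Real.sq_sqrt hlog0
  have hsn2 : sn ^ 2 = n := Real.sq_sqrt hn'.le
  have hl2 : √(L : ℝ) ^ 2 = L := Real.sq_sqrt hL'.le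
  have hl0 : 0 < √(L : ℝ) := Real.sqrt_pos.mpr hL'
  have hsm1 : 1 ≤ √m := Real.one_le_sqrt.mpr hm1
  have hsm2 : √m ^ 2 = m := Real.sq_sqrt (by linarith)
  -- The bounds of the theorem in terms of `κ`, `r`, `A`, `b`, `sn` and the dimension `m`.
  have t1 : √m * Real.log n / (sn * p * L) = √m * (r ^ 2 * sn) := by
    rw [← hb2, hr, div_pow, mul_pow, hA2, hl2, ← hsn2]
    field_simp
  have t2 : m * Real.log n / (n * p * L) = m * r ^ 2 := by
    rw [← hb2, hr, div_pow, mul_pow, hA2, hl2]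
    field_simp
  have t3 : √(m * Real.log n / L) = √m * (r * A) := by
    rw [Real.sqrt_div (by positivity), Real.sqrt_mul (by positivity), hr, ← hb]
    field_simp
  have hgood := hS.prob_goodConfig hL hA0 hb0 hsn0 hsn2 hb2 hadm.p_eq hAb hn4
  have hcompl : 1 ≤ P.real {ω | CARE.GoodConfig p A b sn (CARE.score x bstar) (CARE.config E Y ω)}
      + P.real {ω | ¬CARE.GoodConfig p A b sn (CARE.score x bstar) (CARE.config E Y ω)} := by
    refine le_trans (le_of_eq ?_) (measureReal_union_le _ _)
    rw [← probReal_univ (μ := P)]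
    congr 1
    ext ω
    simpa using em _
  refine le_trans (by linarith) (measureReal_mono (μ := P)
    (s₁ := {ω | CARE.GoodConfig p A b sn (CARE.score x bstar) (CARE.config E Y ω)}) ?_)
  intro ω hω
  rw [Set.mem_ofPred_eq] at hω
  rw [Set.mem_ofPred_eq]
  obtain ⟨hM, hbar, hest⟩ := hω.argmin_estimate hn0 hL hr hadm le_rfl rfl
    (fun i j => CARE.one_div_kappa_le_logisticWeight i j) hsm hc₂ hlam (by positivity) hinc
  refine ⟨hM, hbar, fun bM bbar h1 h2 => ?_⟩
  obtain ⟨k1, k2⟩ := hest bM bbar h1 h2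
  rw [t1, t2, t3, ← hA2, ← hb2]
  constructor
  · refine k1.trans ?_
    calc Λ * (κ ^ 4 * r ^ 2 * sn) / √c₂ = Λ / √c₂ * (κ ^ 4 * (1 * (r ^ 2 * sn))) := by ring
      _ ≤ (Λ * (1 + c₀) + Λ / √c₂) * (κ ^ 4 * (√m * (r ^ 2 * sn))) := by
        gcongr
        exact le_add_of_nonneg_left (by positivity)
  · refine (pi_norm_le_iff_of_nonneg (by positivity)).mpr fun i => ?_
    rw [Real.norm_eq_abs]
    refine (k2 i).trans ?_
    have e1 : √(m / n) = √m / sn := Real.sqrt_div (by positivity) _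
    have e2 : c₀ * √(m / n) * (Λ * (κ ^ 4 * r ^ 2 * sn)) = Λ * c₀ * (κ ^ 4 * (√m * r ^ 2)) := by
      rw [e1]; field_simp
    rw [e2]
    refine (CARE.sup_bound_le hκ1 hsm1 hr0.le hA0 hc₀.le hΛ0.le).trans ?_
    rw [hsm2]
    gcongr
    exact le_add_of_nonneg_right (by positivity)
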